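/- Let $n\ge 1$, let $p_t(x)=t^{-n}p(x/t)$, $p(x)=\gamma_n(1+|x|^2)^{-\frac{n+1}{2}}$, $\gamma_n=\Gamma(\tfrac{n+1}{2})\pi^{-\frac{n+1}{2}}$, be the Poisson kernel on $\mathbb{R}^n$, and for $v:\mathbb{R}^n\to\mathbb{R}^m$ put $$|d_{\frac12}v|^2(x)=\frac{\gamma_n}{2}\int_{\mathbb{R}^n}\frac{|v(x+h)-v(x)|^2}{|h|^{n+1}}\,dh .$$ Define the seminorms $$[a]_{\mathcal{A}_\infty}^2=\sup_{r>0}\ \sup_{x\in\mathbb{R}^n}\int_0^r\frac{1}{|B_r(x)|}\int_{B_r(x)}|d_{\frac12}(p_t*a)|^2(y)\,dy\,dt,$$ $$[a]_{Q_0}^2=\sup_{x\in\mathbb{R}^n,\ r>0}\frac1{r^n}\int_{B_r(x)}\int_{B_r(x)}\frac{|a(y)-a(z)|^2}{|y-z|^n}\,dy\,dz,$$ and the spaces $\mathcal{A}=\{a\in L^\infty(\mathbb{R}^n;\mathbb{R}^m):[a]_{\mathcal{A}_\infty}<\infty\}$ and $Q_0=\{a:\mathbb{R}^n\to\mathbb{R}^m\text{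 measurable}:[a]_{Q_0}<\infty\}$. Then there is a constant $c>0$, depending only on $n$, such that for every $m$ and every $a\in Q_0(\mathbb{R}^n;\mathbb{R}^m)$ the integral defining $(p_t*a)(x)$ converges absolutely for all $t>0$, $x\in\mathbb{R}^n$, and $$[a]_{\mathcal{A}_\infty}\le c\,[a]_{Q_0}.$$ In particular $L^\infty\cap Q_0\subset\mathcal{A}$. Moreover $$L^\infty\cap\dot H^{\frac n2}\subset L^\infty\cap\dot B^{\frac n2}_{2,\infty}\subset L^\infty\cap\dot B^{\frac12}_{2n,\infty}\subset L^\infty\cap Q_0\subset\mathcal{A},$$ where $a\in L^\infty\cap\dot H^{s}$ means that $a$ is bounded and its Fourier transform coincides on $\mathbb{R}^n\setminus\{0\}$ with $|\xi|^{-s}g(\xi)$ for some $g\in L^2$, and $a\in L^\infty\cap\dot B^{s}_{p,\infty}$ means that $a$ is bounded and $\sup_{j\in\mathbb{Z}}2^{js}\|\psi_j*a\|_{L^p}<\infty$, with $(\psi_j)_{j\in\mathbb Z}$ the kernels of a homogeneous Littlewood–Paley decomposition. -/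

import Mathlib

open MeasureTheory Set
open scoped ENNReal FourierTransform SchwartzMap

noncomputable section

namespace HalfHarmonic

/-- Euclidean space `ℝᵈ`. -/
abbrev Euc (d : ℕ) : Type := EuclideanSpace ℝ (Fin d)

/-- The constant `γₙ = Γ((n+1)/2) / π^((n+1)/2)`. -/
def gammaConst (n : ℕ) : ℝ :=
  Real.Gamma (((n : ℝ) + 1) / 2) / Real.pi ^ (((n : ℝ) + 1) / 2)

/-- The profile `p(x) = γₙ (1 + |x|²)^(-(n+1)/2)` of the Poisson kernel. -/
def poissonProfile (n : ℕ) (x : Euc n) : ℝ :=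
  gammaConst n / (1 + ‖x‖ ^ 2) ^ (((n : ℝ) + 1) / 2)

/-- The Poisson kernel `p_t(x) = t⁻ⁿ p(x / t)`, for `t > 0`. -/
def poissonKernel (n : ℕ) (t : ℝ) (x : Euc n) : ℝ :=
  1 / t ^ n * poissonProfile n (t⁻¹ • x)

/-- The Poisson extension `(p_t * a)(x) = ∫ p_t(x - y) a(y) dy`. -/
def poissonExt {n m : ℕ} (a : Euc n → Euc m) (t : ℝ) (x : Euc n) : Euc m :=
  ∫ y, poissonKernel n t (x - y) • a y

/-- The fractional energy density
`|d_{1/2} v|²(x) = (γₙ / 2) ∫ |v(x+h) - v(x)|² / |h|^(n+1) dh`, with values in `[0, ∞]`. -/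
def energyDensity {n m : ℕ} (v : Euc n → Euc m) (x : Euc n) : ℝ≥0∞ :=
  ENNReal.ofReal (gammaConst n / 2) * ∫⁻ h : Euc n, ‖v (x + h) - v x‖ₑ ^ 2 / ‖h‖ₑ ^ (n + 1)

/-- The seminorm `[a]_{𝒜_T}`, the square root of the supremum over `0 < r < T` and `x` of
`∫₀ʳ ⨍_{B_r(x)} |d_{1/2} (p_t * a)|² dy dt`, for `T ∈ [0, ∞]`. -/
def seminormA {n m : ℕ} (T : ℝ≥0∞) (a : Euc n → Euc m) : ℝ≥0∞ :=
  (⨆ (r : ℝ) (_ : 0 < r) (_ : ENNReal.ofReal r < T) (x : Euc n),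
    ∫⁻ t in Ioo 0 r, ⨍⁻ y in Metric.ball x r, energyDensity (poissonExt a t) y ∂volume) ^ (1 / 2 : ℝ)

/-- `L^∞(ℝⁿ; ℝᵐ)`, as a set of functions. -/
def spaceLinf (n m : ℕ) : Set (Euc n → Euc m) :=
  {a | MemLp a ∞ volume}

/-- The space `𝒜` of bounded functions with `[a]_{𝒜_∞} < ∞`. -/
def spaceA (n m : ℕ) : Set (Euc n → Euc m) :=
  {a | a ∈ spaceLinf n m ∧ seminormA ∞ a < ∞}

/-- The seminorm `[f]_{Q_α}`, the square root of the supremum over `x` and `r > 0` of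
`r^(-(n-2α)) ∫_{B_r(x)} ∫_{B_r(x)} |f(y) - f(z)|² / |y - z|^(n+2α) dy dz`. -/
def seminormQ {n m : ℕ} (α : ℝ) (f : Euc n → Euc m) : ℝ≥0∞ :=
  (⨆ (x : Euc n) (r : ℝ) (_ : 0 < r),
    (∫⁻ z in Metric.ball x r, ∫⁻ y in Metric.ball x r,
      ‖f y - f z‖ₑ ^ 2 / ‖y - z‖ₑ ^ ((n : ℝ) + 2 * α)) /
        ENNReal.ofReal r ^ ((n : ℝ) - 2 * α)) ^ (1 / 2 : ℝ)

/-- The space `Q_α(ℝⁿ; ℝᵐ)`. -/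
def spaceQ (n m : ℕ) (α : ℝ) : Set (Euc n → Euc m) :=
  {f | AEStronglyMeasurable f volume ∧ seminormQ α f < ∞}

/-- A real Schwartz function whose Fourier transform is `1` on the unit ball and `0` outside the
ball of radius `2`: a low-frequency cutoff, generating a homogeneous Littlewood-Paley
decomposition. -/
def IsLowPass {n : ℕ} (χ : 𝓢(Euc n, ℝ)) : Prop :=
  (∀ ξ : Euc n, ‖ξ‖ ≤ 1 → 𝓕 (fun x : Euc n => (χ x : ℂ)) ξ = 1) ∧
  (∀ ξ : Euc n, 2 ≤ ‖ξ‖ → 𝓕 (fun x : Euc n => (χ x : ℂ)) ξ = 0)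

/-- The kernel `ψ_j(x) = 2^(jn) χ(2^j x) - 2^((j-1)n) χ(2^(j-1) x)` of the `j`-th homogeneous dyadic
block; its Fourier transform is `χ̂(2^(-j) ξ) - χ̂(2^(1-j) ξ)`. -/
def dyadicKernel {n : ℕ} (χ : 𝓢(Euc n, ℝ)) (j : ℤ) (x : Euc n) : ℝ :=
  ((2 : ℝ) ^ j) ^ n * χ ((2 : ℝ) ^ j • x) - ((2 : ℝ) ^ (j - 1)) ^ n * χ ((2 : ℝ) ^ (j - 1) • x)

/-- The `j`-th homogeneous dyadic block `ψ_j * a` of a bounded function `a`. -/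
def dyadicBlock {n m : ℕ} (χ : 𝓢(Euc n, ℝ)) (j : ℤ) (a : Euc n → Euc m) (x : Euc n) : Euc m :=
  ∫ y, dyadicKernel χ j (x - y) • a y

/-- `L^∞ ∩ Ḃ^s_{p,∞}(ℝⁿ; ℝᵐ)`: bounded functions with `sup_j 2^(js) ‖ψ_j * a‖_{L^p} < ∞`.
The space does not depend on the choice of the cutoff `χ`. -/
def spaceLinfBesov (n m : ℕ) (s : ℝ) (p : ℝ≥0∞) : Set (Euc n → Euc m) :=
  {a | a ∈ spaceLinf n m ∧ ∃ χ : 𝓢(Euc n, ℝ), IsLowPass χ ∧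
    (⨆ j : ℤ, ENNReal.ofReal ((2 : ℝ) ^ ((j : ℝ) * s)) * eLpNorm (dyadicBlock χ j a) p volume) < ∞}

/-- `L^∞ ∩ Ḣ^s(ℝⁿ; ℝᵐ)`: bounded functions whose (distributional) Fourier transform is, away from
the origin, of the form `|ξ|^(-s) g(ξ)` with `g ∈ L²`. -/
def spaceLinfSobolev (n m : ℕ) (s : ℝ) : Set (Euc n → Euc m) :=
  {a | a ∈ spaceLinf n m ∧ ∃ g : Fin m → Euc n → ℂ, ∀ i, MemLp (g i) 2 volume ∧
    ∀ φ : 𝓢(Euc n, ℂ), (0 : Euc n) ∉ tsupport φ →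
      ∫ x, 𝓕 (φ : Euc n → ℂ) x * (a x i : ℂ) =
        ∫ ξ, φ ξ * (((‖ξ‖ ^ (-s) : ℝ) : ℂ) * g i ξ)}

end HalfHarmonic

end

/-!
The proof has two halves.

**The estimate `[a]_{𝒜_∞} ≤ c [a]_{Q_0}`.** Telescoping over the balls `B_{2^k r}(x)` bounds the mean
square oscillation of `a` between `B_r(x)` and `B_{2^k r}(x)` by a geometric factor of rate below
`2^k` (`lintegral_ball_dyadic_sqOsc_le`), so kernels which decay like `r |w|⁻⁽ⁿ⁺¹⁾` may be integrated
against `|a(v) - a(z)|²`, uniformly over all balls (`tailEnergy_le`). At the scale `t` the increments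
of `p_t * a` are compared with the Poisson oscillation `∫ p_t(y - v) |a(v) - a(y)|² dv`: for `|h| ≤ t`
through the smoothness of the kernel, for `|h| ≥ t` by passing through `a` itself
(`exists_energyDensity_poissonExt_le`). Integrating over `t < r` turns the Poisson kernels into the
kernel `min(|w|⁻ⁿ, r |w|⁻⁽ⁿ⁺¹⁾)`, and everything is bounded by the tail energy
(`exists_lintegral_energyDensity_le`).

**The embeddings.** If `a` lies in the Sobolev space, then testing its Fourier transform with
`𝓕⁻¹(ψ_j(x - ·))` shows that `ψ_j * a` is the inverse Fourier transform of
`ψ̂_j |ξ|^(-n/2) g ∈ L¹ ∩ L²` (`dyadicBlock_eq_fourierInv`), and Plancherel's theorem gives the Besov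
bound. The embedding of the two Besov spaces follows from Bernstein's inequality
(`enorm_dyadicBlock_sq_le`) and `‖f‖_{2n}^{2n} ≤ ‖f‖_∞^{2n-2} ‖f‖_2²`. Finally, the differences of the
dyadic blocks satisfy `‖Δ_h (ψ_j * a)‖_{2n} ≲ min(1, 2^j |h|) 2^(-j/2)`; summing over `j` gives
`‖Δ_h a‖_{2n} ≲ |h|^{1/2}` (`exists_eLpNorm_difference_le`), where the convergence of the
decomposition holds at the Lebesgue points of `a`. By Hölder's inequality this implies `a ∈ Q_0`
(`exists_qBound_of_eLpNorm_difference_le`).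
-/

noncomputable section

namespace HalfHarmonic

open Metric

variable {n m : ℕ}

/-! ### Oscillation over dyadic balls -/

/-- The dyadic shell `{2^(k+1) ρ ≤ |v - x| < 2^(k+2) ρ}`. -/
def dyadicShell (x : Euc n) (ρ : ℝ) (k : ℕ) : Set (Euc n) :=
  ball x (2 ^ (k + 2) * ρ) \ ball x (2 ^ (k + 1) * ρ)

theorem measurableSet_dyadicShell (x : Euc n) (ρ : ℝ) (k : ℕ) :
    MeasurableSet (dyadicShell x ρ k) :=
  measurableSet_ball.diff measurableSet_ball

theorem ball_union_dyadicShell (x : Euc n) {ρ : ℝ} (hρ : 0 < ρ) :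
    ball x (2 * ρ) ∪ ⋃ k, dyadicShell x ρ k = univ := by
  refine eq_univ_of_forall fun v => ?_
  by_cases h : v ∈ ball x (2 * ρ)
  · exact Or.inl h
  refine Or.inr ?_
  rw [mem_ball, not_lt] at h
  obtain ⟨k, hk1, hk2⟩ := exists_nat_pow_near (x := dist v x / (2 * ρ)) (y := 2)
    (by rwa [one_le_div (by positivity)]) one_lt_two
  rw [le_div_iff₀ (by positivity)] at hk1
  rw [div_lt_iff₀ (by positivity)] at hk2
  refine mem_iUnion.2 ⟨k, ?_, ?_⟩
  · rw [mem_ball]; calc _ < _ := hk2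
      _ = _ := by ring
  · rw [mem_ball, not_lt]; calc _ = 2 ^ k * (2 * ρ) := by ring
      _ ≤ _ := hk1

theorem lintegral_le_dyadicShell (x : Euc n) {ρ : ℝ} (hρ : 0 < ρ) (g : Euc n → ℝ≥0∞) :
    ∫⁻ v, g v ≤ (∫⁻ v in ball x (2 * ρ), g v) + ∑' k, ∫⁻ v in dyadicShell x ρ k, g v := by
  rw [← setLIntegral_univ, ← ball_union_dyadicShell x hρ]
  exact (lintegral_union_le _ _ _).trans (add_le_add le_rfl (lintegral_iUnion_le _ _))

theorem volume_ball_eq (x : Euc n) {r : ℝ} (hr : 0 < r) :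
    volume (ball x r) = ENNReal.ofReal r ^ n * volume (ball (0 : Euc n) 1) := by
  rw [Measure.addHaar_ball_of_pos _ _ hr, ENNReal.ofReal_pow hr.le, finrank_euclideanSpace,
    Fintype.card_fin]

/-- The squared oscillation `|a(y) - a(z)|²`. -/
def sqOsc (a : Euc n → Euc m) (y z : Euc n) : ℝ≥0∞ := ‖a y - a z‖ₑ ^ 2

theorem sqOsc_comm (a : Euc n → Euc m) (y z : Euc n) : sqOsc a y z = sqOsc a z y := by
  simp only [sqOsc, ← neg_sub (a z) (a y), enorm_neg]

theorem two_mul_sqOsc_le (a : Euc n → Euc m) (v w z : Euc n) :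
    2 * sqOsc a v z ≤ 3 * sqOsc a w z + 6 * sqOsc a v w := by
  have key : 2 * ‖a v - a z‖ ^ 2 ≤ 3 * ‖a w - a z‖ ^ 2 + 6 * ‖a v - a w‖ ^ 2 := by
    have h : ‖a v - a z‖ ≤ ‖a v - a w‖ + ‖a w - a z‖ := norm_sub_le_norm_sub_add_norm_sub ..
    have h2 := pow_le_pow_left₀ (norm_nonneg _) h 2
    nlinarith [sq_nonneg (‖a w - a z‖ - 2 * ‖a v - a w‖)]
  have := ENNReal.ofReal_le_ofReal key
  rw [ENNReal.ofReal_add (by positivity) (by positivity)] at this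
  simpa [sqOsc, ENNReal.ofReal_mul, ENNReal.ofReal_pow, ofReal_norm] using this

theorem measurable_sqOsc {α : Type*} [MeasurableSpace α] {a : Euc n → Euc m} (ha : Measurable a)
    {f g : α → Euc n} (hf : Measurable f) (hg : Measurable g) :
    Measurable fun x => sqOsc a (f x) (g x) :=
  ((ha.comp hf).sub (ha.comp hg)).enorm.pow_const 2

/-- The statement that `∫_{B_r(x)} ∫_{B_r(x)} |a(y) - a(z)|² / |y - z|ⁿ ≤ rⁿ Q` for all balls,
that is, `[a]²_{Q_0} ≤ Q`. -/
def QBound (a : Euc n → Euc m) (Q : ℝ≥0∞) : Prop :=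
  ∀ (x : Euc n) (r : ℝ), 0 < r →
    ∫⁻ z in ball x r, ∫⁻ y in ball x r, sqOsc a y z / ‖y - z‖ₑ ^ n ≤ ENNReal.ofReal r ^ n * Q

/-- The mean square oscillation over a single ball, since `|y - z|ⁿ ≤ (2r)ⁿ` there. -/
theorem lintegral_ball_ball_sqOsc_le {a : Euc n → Euc m} {Q : ℝ≥0∞}
    (hQ : QBound a Q) (x : Euc n) {r : ℝ} (hr : 0 < r) :
    ∫⁻ z in ball x r, ∫⁻ y in ball x r, sqOsc a y z ≤
      2 ^ n * ENNReal.ofReal r ^ (2 * n) * Q := by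
  have h1 : ∀ z ∈ ball x r, ∀ y ∈ ball x r,
      sqOsc a y z ≤ (2 ^ n * ENNReal.ofReal r ^ n) * (sqOsc a y z / ‖y - z‖ₑ ^ n) := by
    intro z hz y hy
    rcases eq_or_ne y z with rfl | hyz
    · simp [sqOsc]
    have hne : ‖y - z‖ₑ ^ n ≠ 0 := pow_ne_zero _ (by simpa [sub_eq_zero] using hyz)
    have hni : ‖y - z‖ₑ ^ n ≠ ∞ := by finiteness
    have h2 : ‖y - z‖ₑ ≤ 2 * ENNReal.ofReal r := by
      have h3 : 2 * ENNReal.ofReal r = ENNReal.ofReal (2 * r) := by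
        rw [ENNReal.ofReal_mul zero_le_two, ENNReal.ofReal_ofNat]
      rw [← ofReal_norm, h3]
      apply ENNReal.ofReal_le_ofReal
      rw [← dist_eq_norm]
      have := dist_triangle_right y z x
      rw [mem_ball] at hz hy
      linarith
    calc sqOsc a y z = ‖y - z‖ₑ ^ n * (sqOsc a y z / ‖y - z‖ₑ ^ n) :=
          (ENNReal.mul_div_cancel hne hni).symm
      _ ≤ (2 * ENNReal.ofReal r) ^ n * (sqOsc a y z / ‖y - z‖ₑ ^ n) :=
        mul_le_mul_left (pow_le_pow_left' h2 n) _
      _ = _ := by rw [mul_pow]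
  calc _ ≤ ∫⁻ z in ball x r, ∫⁻ y in ball x r,
        (2 ^ n * ENNReal.ofReal r ^ n) * (sqOsc a y z / ‖y - z‖ₑ ^ n) :=
        setLIntegral_mono' measurableSet_ball fun z hz =>
          setLIntegral_mono' measurableSet_ball fun y hy => h1 z hz y hy
    _ = (2 ^ n * ENNReal.ofReal r ^ n) *
        ∫⁻ z in ball x r, ∫⁻ y in ball x r, (sqOsc a y z / ‖y - z‖ₑ ^ n) := by
        rw [← lintegral_const_mul' _ _ (by finiteness)]
        congr with z
        rw [← lintegral_const_mul' _ _ (by finiteness)]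
    _ ≤ (2 ^ n * ENNReal.ofReal r ^ n) * (ENNReal.ofReal r ^ n * Q) := by
        gcongr; exact hQ x r hr
    _ = _ := by ring

/-- Telescoping over dyadic balls: the mean square oscillation between `B_r(x)` and
`B_{2^k r}(x)` grows at most like `(7/4)^k`.  The logarithmic growth known for `BMO` is not needed:
any rate below `2^k` will do. -/
theorem lintegral_ball_dyadic_sqOsc_le {a : Euc n → Euc m} (ha : Measurable a) {Q : ℝ≥0∞}
    (hQ : QBound a Q) (x : Euc n) {r : ℝ} (hr : 0 < r) (k : ℕ) :
    4 ^ k * ∫⁻ z in ball x r, ∫⁻ v in ball x (2 ^ k * r), sqOsc a v z ≤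
      12 * 2 ^ (2 * n) * 7 ^ k * 2 ^ (k * n) * ENNReal.ofReal r ^ (2 * n) * Q := by
  set R := ENNReal.ofReal r with hR
  set V := volume (ball (0 : Euc n) 1) with hV
  have hR0 : R ≠ 0 := by simpa [hR] using hr
  have hRi : R ≠ ∞ := ENNReal.ofReal_ne_top
  have hV0 : V ≠ 0 := (measure_ball_pos _ _ one_pos).ne'
  have hVi : V ≠ ∞ := measure_ball_lt_top.ne
  have hRk : ∀ k : ℕ, ENNReal.ofReal (2 ^ k * r) = 2 ^ k * R := fun k => by
    rw [ENNReal.ofReal_mul (by positivity), ENNReal.ofReal_pow zero_le_two, ENNReal.ofReal_ofNat]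
  induction k with
  | zero =>
    have := lintegral_ball_ball_sqOsc_le hQ x hr
    simp only [pow_zero, one_mul, zero_mul, mul_one]
    refine this.trans ?_
    gcongr
    calc (2 : ℝ≥0∞) ^ n ≤ 2 ^ (2 * n) := pow_le_pow_right₀ (by norm_num) (by omega)
      _ ≤ 12 * 2 ^ (2 * n) := le_mul_of_one_le_left (by positivity) (by norm_num)
  | succ k ih =>
    set X := ∫⁻ z in ball x r, ∫⁻ v in ball x (2 ^ k * r), sqOsc a v z
    set X' := ∫⁻ z in ball x r, ∫⁻ v in ball x (2 ^ (k + 1) * r), sqOsc a v z with hX'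
    have hsub : ball x (2 ^ k * r) ⊆ ball x (2 ^ (k + 1) * r) :=
      ball_subset_ball (by gcongr <;> norm_num)
    have hY := lintegral_ball_ball_sqOsc_le hQ x (r := 2 ^ (k + 1) * r) (by positivity)
    set Y := ∫⁻ z in ball x (2 ^ (k + 1) * r), ∫⁻ v in ball x (2 ^ (k + 1) * r), sqOsc a v z
    have m1 : ∀ c : Euc n, Measurable fun w => sqOsc a w c := fun c =>
      measurable_sqOsc ha measurable_id measurable_const
    have m2 : ∀ c : Euc n, Measurable fun w => sqOsc a c w := fun c =>
      measurable_sqOsc ha measurable_const measurable_id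
    have step : 2 * volume (ball x (2 ^ k * r)) * X' ≤
        3 * volume (ball x (2 ^ (k + 1) * r)) * X + 6 * volume (ball x r) * Y := by
      calc 2 * volume (ball x (2 ^ k * r)) * X'
          = ∫⁻ z in ball x r, ∫⁻ v in ball x (2 ^ (k + 1) * r), ∫⁻ w in ball x (2 ^ k * r),
              2 * sqOsc a v z := by
            rw [hX', ← lintegral_const_mul' _ _ (by finiteness)]
            congr with z
            rw [← lintegral_const_mul' _ _ (by finiteness)]
            congr with v
            rw [setLIntegral_const]
            ring
        _ ≤ ∫⁻ z in ball x r, ∫⁻ v in ball x (2 ^ (k + 1) * r), ∫⁻ w in ball x (2 ^ k * r),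
              (3 * sqOsc a w z + 6 * sqOsc a v w) := by
            gcongr with z v w
            exact two_mul_sqOsc_le a v w z
        _ = ∫⁻ z in ball x r, (3 * volume (ball x (2 ^ (k + 1) * r)) *
              (∫⁻ w in ball x (2 ^ k * r), sqOsc a w z) +
              6 * ∫⁻ v in ball x (2 ^ (k + 1) * r), ∫⁻ w in ball x (2 ^ k * r), sqOsc a v w) := by
            congr with z
            have h1 : ∀ v, ∫⁻ w in ball x (2 ^ k * r), (3 * sqOsc a w z + 6 * sqOsc a v w) =
                3 * (∫⁻ w in ball x (2 ^ k * r), sqOsc a w z) +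
                  6 * ∫⁻ w in ball x (2 ^ k * r), sqOsc a v w := fun v => by
              rw [lintegral_add_left ((m1 z).const_mul 3), lintegral_const_mul' _ _ (by finiteness),
                lintegral_const_mul' _ _ (by finiteness)]
            simp_rw [h1]
            rw [lintegral_add_left measurable_const, setLIntegral_const,
              lintegral_const_mul' _ _ (by finiteness)]
            ring
        _ = 3 * volume (ball x (2 ^ (k + 1) * r)) * X + 6 * volume (ball x r) *
              ∫⁻ v in ball x (2 ^ (k + 1) * r), ∫⁻ w in ball x (2 ^ k * r), sqOsc a v w := by
            rw [lintegral_add_right _ measurable_const, setLIntegral_const,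
              lintegral_const_mul' _ _ (by finiteness)]
            ring
        _ ≤ _ := by
            refine add_le_add le_rfl (mul_le_mul_right ?_ _)
            refine lintegral_mono fun v => ?_
            simp_rw [sqOsc_comm a v]
            exact lintegral_mono_set hsub
    rw [volume_ball_eq x (by positivity), volume_ball_eq x (by positivity),
      volume_ball_eq x hr, hRk, hRk, ← hV, ← hR] at step
    rw [hRk] at hY
    have hc0 : 2 * V * 2 ^ (k * n) * R ^ n ≠ 0 := by positivity
    have hci : 2 * V * 2 ^ (k * n) * R ^ n ≠ ∞ := by finiteness
    refine (ENNReal.mul_le_mul_iff_right hc0 hci).1 ?_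
    calc 2 * V * 2 ^ (k * n) * R ^ n * (4 ^ (k + 1) * X')
        = 4 ^ (k + 1) * (2 * ((2 ^ k * R) ^ n * V) * X') := by ring
      _ ≤ 4 ^ (k + 1) * (3 * ((2 ^ (k + 1) * R) ^ n * V) * X +
            6 * (R ^ n * V) * (2 ^ n * (2 ^ (k + 1) * R) ^ (2 * n) * Q)) :=
          mul_le_mul_right (step.trans (by gcongr)) _
      _ = 12 * 2 ^ ((k + 1) * n) * R ^ n * V * (4 ^ k * X) +
            24 * 2 ^ n * 2 ^ ((k + 1) * (2 * n)) * R ^ (3 * n) * V * Q * 4 ^ k := by ring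
      _ ≤ 12 * 2 ^ ((k + 1) * n) * R ^ n * V *
            (12 * 2 ^ (2 * n) * 7 ^ k * 2 ^ (k * n) * R ^ (2 * n) * Q) +
            24 * 2 ^ n * 2 ^ ((k + 1) * (2 * n)) * R ^ (3 * n) * V * Q * 7 ^ k := by
          gcongr; norm_num
      _ = _ := by ring

/-! ### The tail energy -/

/-- The kernel `min(|w|⁻ⁿ, r |w|⁻⁽ⁿ⁺¹⁾)`, comparable to the time average `∫₀ʳ p_t(w) dt / t` of the
Poisson kernel. -/
def tailKernel (n : ℕ) (r : ℝ) (w : Euc n) : ℝ≥0∞ :=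
  min (‖w‖ₑ ^ n)⁻¹ (ENNReal.ofReal r * (‖w‖ₑ ^ (n + 1))⁻¹)

theorem measurable_tailKernel (r : ℝ) : Measurable (tailKernel n r) := by
  unfold tailKernel
  exact (measurable_enorm.pow_const n).inv.min
    ((measurable_enorm.pow_const (n + 1)).inv.const_mul _)

theorem tailKernel_mono {r s : ℝ} (h : r ≤ s) (w : Euc n) : tailKernel n r w ≤ tailKernel n s w :=
  min_le_min le_rfl (mul_le_mul_left (ENNReal.ofReal_le_ofReal h) _)

/-- The oscillation of `a` around the points of `B_r(x)`, measured by the kernel `tailKernel`. -/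
def tailEnergy (a : Euc n → Euc m) (x : Euc n) (r : ℝ) : ℝ≥0∞ :=
  ∫⁻ z in ball x r, ∫⁻ v, tailKernel n r (v - z) * sqOsc a v z

theorem measurable_tailKernel_mul_sqOsc {a : Euc n → Euc m} (ha : Measurable a) (r : ℝ) :
    Measurable fun p : Euc n × Euc n => tailKernel n r (p.2 - p.1) * sqOsc a p.2 p.1 :=
  ((measurable_tailKernel r).comp (measurable_snd.sub measurable_fst)).mul
    (measurable_sqOsc ha measurable_snd measurable_fst)

/-- Points of the `k`-th dyadic shell have distance at least `2^k r` from all points of the ball. -/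
theorem enorm_ge_of_mem_dyadicShell {x z v : Euc n} {r : ℝ} (hr : 0 < r) {k : ℕ}
    (hz : z ∈ ball x r) (hv : v ∈ dyadicShell x r k) :
    2 ^ k * ENNReal.ofReal r ≤ ‖v - z‖ₑ := by
  have h : 2 ^ k * r ≤ ‖v - z‖ := by
    rw [← dist_eq_norm]
    have h1 := hv.2
    rw [mem_ball, not_lt] at h1
    rw [mem_ball] at hz
    have h2 := dist_triangle v z x
    have h3 : (1 : ℝ) ≤ 2 ^ k := one_le_pow₀ one_le_two
    nlinarith [pow_succ (2 : ℝ) k]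
  rw [← ofReal_norm]
  refine le_trans (le_of_eq ?_) (ENNReal.ofReal_le_ofReal h)
  rw [ENNReal.ofReal_mul (by positivity), ENNReal.ofReal_pow zero_le_two, ENNReal.ofReal_ofNat]

theorem lintegral_tailKernel_le (f : Euc n → ℝ≥0∞) {x z : Euc n} {r : ℝ} (hr : 0 < r)
    (hz : z ∈ ball x r) :
    ∫⁻ v, tailKernel n r (v - z) * f v ≤ (∫⁻ v in ball x (2 * r), f v / ‖v - z‖ₑ ^ n) +
      ∑' k : ℕ, ENNReal.ofReal r * ((2 ^ k * ENNReal.ofReal r) ^ (n + 1))⁻¹ *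
        ∫⁻ v in ball x (2 ^ (k + 2) * r), f v := by
  refine (lintegral_le_dyadicShell x hr _).trans ?_
  refine add_le_add (lintegral_mono fun v => ?_) (ENNReal.tsum_le_tsum fun k => ?_)
  · rw [div_eq_mul_inv, mul_comm (f v)]
    exact mul_le_mul_left (min_le_left _ _) _
  · calc _ ≤ ∫⁻ v in dyadicShell x r k,
          ENNReal.ofReal r * ((2 ^ k * ENNReal.ofReal r) ^ (n + 1))⁻¹ * f v := by
          refine setLIntegral_mono' (measurableSet_dyadicShell x r k) fun v hv => ?_
          refine mul_le_mul_left ((min_le_right _ _).trans (mul_le_mul_right ?_ _)) _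
          exact ENNReal.inv_le_inv.2 (pow_le_pow_left' (enorm_ge_of_mem_dyadicShell hr hz hv) _)
      _ ≤ ∫⁻ v in ball x (2 ^ (k + 2) * r),
          ENNReal.ofReal r * ((2 ^ k * ENNReal.ofReal r) ^ (n + 1))⁻¹ * f v :=
          lintegral_mono_set sdiff_subset
      _ = _ := by
          refine lintegral_const_mul' _ _ ?_
          have : (2 ^ k * ENNReal.ofReal r) ^ (n + 1) ≠ 0 := by
            have : ENNReal.ofReal r ≠ 0 := by simpa using hr
            positivity
          finiteness

/-- The tail energy is controlled by `[a]²_{Q_0}`: the ball `B_{2r}(x)` is covered by the definition of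
`Q_0`, and on the `k`-th dyadic shell the decay `2^(-k)` of the kernel beats the growth `(7/4)^k` of the
mean oscillation. -/
theorem tailEnergy_le {a : Euc n → Euc m} (ha : Measurable a) {Q : ℝ≥0∞}
    (hQ : QBound a Q) (x : Euc n) {r : ℝ} (hr : 0 < r) :
    tailEnergy a x r ≤ 1000 * 2 ^ (4 * n) * ENNReal.ofReal r ^ n * Q := by
  set R := ENNReal.ofReal r with hR
  have hR0 : R ≠ 0 := by simpa [hR] using hr
  have hRi : R ≠ ∞ := ENNReal.ofReal_ne_top
  have m1 : ∀ s : ℝ, Measurable fun z => ∫⁻ v in ball x s, sqOsc a v z := fun s =>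
    Measurable.lintegral_prod_right' (f := fun p : Euc n × Euc n => sqOsc a p.2 p.1)
      (measurable_sqOsc ha measurable_snd measurable_fst)
  have m2 : Measurable fun z => ∫⁻ v in ball x (2 * r), sqOsc a v z / ‖v - z‖ₑ ^ n :=
    Measurable.lintegral_prod_right'
      (f := fun p : Euc n × Euc n => sqOsc a p.2 p.1 / ‖p.2 - p.1‖ₑ ^ n)
      ((measurable_sqOsc ha measurable_snd measurable_fst).div
        ((measurable_snd.sub measurable_fst).enorm.pow_const n))
  have hfin : ∀ k : ℕ, R * ((2 ^ k * R) ^ (n + 1))⁻¹ ≠ ∞ := fun k => by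
    have : (2 ^ k * R) ^ (n + 1) ≠ 0 := by positivity
    finiteness
  have near : ∫⁻ z in ball x r, ∫⁻ v in ball x (2 * r), sqOsc a v z / ‖v - z‖ₑ ^ n ≤
      2 ^ n * R ^ n * Q := by
    calc _ ≤ ∫⁻ z in ball x (2 * r), ∫⁻ v in ball x (2 * r), sqOsc a v z / ‖v - z‖ₑ ^ n :=
          lintegral_mono_set (ball_subset_ball (by linarith))
      _ ≤ ENNReal.ofReal (2 * r) ^ n * Q := hQ x _ (by positivity)
      _ = _ := by rw [ENNReal.ofReal_mul zero_le_two, ENNReal.ofReal_ofNat, mul_pow]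
  have far : ∀ k : ℕ, R * ((2 ^ k * R) ^ (n + 1))⁻¹ *
      ∫⁻ z in ball x r, ∫⁻ v in ball x (2 ^ (k + 2) * r), sqOsc a v z ≤
      (37 * 2 ^ (4 * n) * R ^ n * Q) * (7 / 8) ^ k := fun k => by
    have h := lintegral_ball_dyadic_sqOsc_le ha hQ x hr (k + 2)
    rw [← hR] at h
    set X := ∫⁻ z in ball x r, ∫⁻ v in ball x (2 ^ (k + 2) * r), sqOsc a v z
    have hc0 : 4 ^ (k + 2) * (2 ^ k * R) ^ (n + 1) ≠ 0 := by positivity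
    have hci : 4 ^ (k + 2) * (2 ^ k * R) ^ (n + 1) ≠ ∞ := by finiteness
    have e1 : (2 ^ k * R) ^ (n + 1) * ((2 ^ k * R) ^ (n + 1))⁻¹ = 1 :=
      ENNReal.mul_inv_cancel (by positivity) (by finiteness)
    have e2 : (8 : ℝ≥0∞) ^ k * (7 / 8) ^ k = 7 ^ k := by
      rw [← mul_pow, ENNReal.mul_div_cancel (by norm_num) (by finiteness)]
    have e3 : (8 : ℝ≥0∞) ^ k = 4 ^ k * 2 ^ k := by rw [← mul_pow]; norm_num
    refine (ENNReal.mul_le_mul_iff_right hc0 hci).1 ?_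
    calc _ = ((2 ^ k * R) ^ (n + 1) * ((2 ^ k * R) ^ (n + 1))⁻¹) * (R * (4 ^ (k + 2) * X)) := by ring
      _ ≤ R * (12 * 2 ^ (2 * n) * 7 ^ (k + 2) * 2 ^ ((k + 2) * n) * R ^ (2 * n) * Q) := by
          rw [e1, one_mul]; gcongr
      _ = 588 * 2 ^ (4 * n) * 2 ^ (k * n) * R ^ (2 * n + 1) * Q * (4 ^ k * 2 ^ k * (7 / 8) ^ k) := by
          rw [← e3, e2]; ring
      _ = 588 * (2 ^ (4 * n) * 2 ^ (k * n) * R ^ (2 * n + 1) * Q *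
            (4 ^ k * 2 ^ k * (7 / 8) ^ k)) := by ring
      -- `588 = 12 * 7 ^ 2` is rounded up to a multiple of `16 = 4 ^ 2`
      _ ≤ 592 * (2 ^ (4 * n) * 2 ^ (k * n) * R ^ (2 * n + 1) * Q *
            (4 ^ k * 2 ^ k * (7 / 8) ^ k)) := by gcongr; norm_num
      _ = _ := by ring
  calc tailEnergy a x r
      ≤ ∫⁻ z in ball x r, ((∫⁻ v in ball x (2 * r), sqOsc a v z / ‖v - z‖ₑ ^ n) +
          ∑' k : ℕ, R * ((2 ^ k * R) ^ (n + 1))⁻¹ *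
            ∫⁻ v in ball x (2 ^ (k + 2) * r), sqOsc a v z) :=
        setLIntegral_mono' measurableSet_ball fun z hz => lintegral_tailKernel_le _ hr hz
    _ = (∫⁻ z in ball x r, ∫⁻ v in ball x (2 * r), sqOsc a v z / ‖v - z‖ₑ ^ n) +
          ∑' k : ℕ, R * ((2 ^ k * R) ^ (n + 1))⁻¹ *
            ∫⁻ z in ball x r, ∫⁻ v in ball x (2 ^ (k + 2) * r), sqOsc a v z := by
        rw [lintegral_add_left m2, lintegral_tsum fun k => ((m1 _).const_mul _).aemeasurable]
        congr with k
        rw [lintegral_const_mul' _ _ (hfin k)]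
    _ ≤ 2 ^ n * R ^ n * Q + ∑' k : ℕ, (37 * 2 ^ (4 * n) * R ^ n * Q) * (7 / 8) ^ k :=
        add_le_add near (ENNReal.tsum_le_tsum far)
    _ = 2 ^ n * (R ^ n * Q) + (296 * 2 ^ (4 * n)) * (R ^ n * Q) := by
        rw [ENNReal.tsum_mul_left, ENNReal.tsum_geometric]
        have : (1 - 7 / 8 : ℝ≥0∞) = 8⁻¹ := by
          refine ENNReal.sub_eq_of_eq_add (by finiteness) ?_
          rw [← one_div, ENNReal.div_add_div_same, show (1 + 7 : ℝ≥0∞) = 8 by norm_num]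
          exact (ENNReal.div_self (by norm_num) (by finiteness)).symm
        rw [this, inv_inv]; ring
    _ ≤ (704 * 2 ^ (4 * n)) * (R ^ n * Q) + (296 * 2 ^ (4 * n)) * (R ^ n * Q) := by
        gcongr
        calc (2 : ℝ≥0∞) ^ n ≤ 2 ^ (4 * n) := pow_le_pow_right₀ (by norm_num) (by omega)
          _ ≤ 704 * 2 ^ (4 * n) := le_mul_of_one_le_left (by positivity) (by norm_num)
    _ = _ := by ring

/-! ### Bounds for the Poisson kernel -/

theorem gammaConst_pos (n : ℕ) : 0 < gammaConst n := by
  unfold gammaConst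
  have : 0 < Real.Gamma (((n : ℝ) + 1) / 2) := Real.Gamma_pos_of_pos (by positivity)
  positivity

theorem poissonKernel_eq {t : ℝ} (ht : 0 < t) (w : Euc n) :
    poissonKernel n t w = gammaConst n * (t / √(t ^ 2 + ‖w‖ ^ 2) ^ (n + 1)) := by
  have h1 : (1 + ‖t⁻¹ • w‖ ^ 2) ^ (((n : ℝ) + 1) / 2) = (√(t ^ 2 + ‖w‖ ^ 2) / t) ^ (n + 1) := by
    have h2 : 1 + ‖t⁻¹ • w‖ ^ 2 = (t ^ 2 + ‖w‖ ^ 2) / t ^ 2 := by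
      rw [norm_smul, norm_inv, Real.norm_of_nonneg ht.le]
      field_simp
    have h3 : √(t ^ 2 + ‖w‖ ^ 2) / t = √((t ^ 2 + ‖w‖ ^ 2) / t ^ 2) := by
      rw [Real.sqrt_div (by positivity), Real.sqrt_sq ht.le]
    rw [h2, h3, Real.sqrt_eq_rpow, ← Real.rpow_natCast _ (n + 1), ← Real.rpow_mul (by positivity)]
    congr 1
    push_cast
    ring
  have h4 : 0 < √(t ^ 2 + ‖w‖ ^ 2) := Real.sqrt_pos.2 (by positivity)
  unfold poissonKernel poissonProfile
  rw [h1, div_pow, pow_succ t n]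
  field_simp

/-- `√(t² + |w|²)` is a norm of the pair `(t, |w|)`, hence `1`-Lipschitz in `w`. -/
theorem sqrt_sq_add_sq_sub_le (t : ℝ) (w h : Euc n) :
    |√(t ^ 2 + ‖w + h‖ ^ 2) - √(t ^ 2 + ‖w‖ ^ 2)| ≤ ‖h‖ := by
  have e : ∀ s : ℝ, √(t ^ 2 + s ^ 2) = ‖(!₂[t, s] : EuclideanSpace ℝ (Fin 2))‖ := fun s => by
    simp [EuclideanSpace.norm_eq, Fin.sum_univ_two]
  rw [e, e]
  refine (abs_norm_sub_norm_le _ _).trans ?_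
  have : (!₂[t, ‖w + h‖] - !₂[t, ‖w‖] : EuclideanSpace ℝ (Fin 2)) = !₂[0, ‖w + h‖ - ‖w‖] := by
    ext i; fin_cases i <;> simp
  rw [this, EuclideanSpace.norm_eq]
  simp only [Fin.sum_univ_two]
  simp only [Matrix.cons_val_zero, Matrix.cons_val_one, norm_zero,
    ne_eq, OfNat.ofNat_ne_zero, not_false_eq_true, zero_pow, zero_add, Real.norm_eq_abs, sq_abs]
  rw [Real.sqrt_sq_eq_abs]
  simpa using abs_norm_sub_norm_le (w + h) w

theorem le_sqrt_sq_add_sq (t s : ℝ) : (t + s) / 2 ≤ √(t ^ 2 + s ^ 2) := by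
  apply Real.le_sqrt_of_sq_le
  nlinarith [sq_nonneg (t - s)]

/-- The function `t / (t + |w|)ⁿ⁺¹`, comparable to the Poisson kernel `p_t`. -/
def poissonMajorant (n : ℕ) (t : ℝ) (w : Euc n) : ℝ := t / (t + ‖w‖) ^ (n + 1)

theorem poissonMajorant_nonneg {t : ℝ} (ht : 0 < t) (w : Euc n) : 0 ≤ poissonMajorant n t w := by
  unfold poissonMajorant; positivity

theorem poissonKernel_nonneg {t : ℝ} (ht : 0 < t) (w : Euc n) : 0 ≤ poissonKernel n t w := by
  rw [poissonKernel_eq ht]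
  have := gammaConst_pos n
  positivity

theorem poissonKernel_le {t : ℝ} (ht : 0 < t) (w : Euc n) :
    poissonKernel n t w ≤ gammaConst n * 2 ^ (n + 1) * poissonMajorant n t w := by
  have hg := gammaConst_pos n
  rw [poissonKernel_eq ht, mul_assoc]
  refine mul_le_mul_of_nonneg_left ?_ hg.le
  unfold poissonMajorant
  calc t / √(t ^ 2 + ‖w‖ ^ 2) ^ (n + 1) ≤ t / ((t + ‖w‖) / 2) ^ (n + 1) := by
        gcongr
        exact le_sqrt_sq_add_sq t ‖w‖
    _ = _ := by rw [div_pow]; field_simp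

theorem abs_poissonKernel_add_sub_le {t : ℝ} (ht : 0 < t) (w h : Euc n) (hh : ‖h‖ ≤ t) :
    |poissonKernel n t (w + h) - poissonKernel n t w| ≤
      gammaConst n * ((n + 1) * 8 ^ (n + 1)) * (‖h‖ / t) * poissonMajorant n t w := by
  have hg := gammaConst_pos n
  rw [poissonKernel_eq ht, poissonKernel_eq ht, ← mul_sub, abs_mul, abs_of_pos hg, mul_assoc,
    mul_assoc]
  refine mul_le_mul_of_nonneg_left ?_ hg.le
  set α := √(t ^ 2 + ‖w + h‖ ^ 2)
  set β := √(t ^ 2 + ‖w‖ ^ 2)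
  have hα : t ≤ α := Real.le_sqrt_of_sq_le (by nlinarith [sq_nonneg ‖w + h‖])
  have hβ : t ≤ β := Real.le_sqrt_of_sq_le (by nlinarith [sq_nonneg ‖w‖])
  have hαβ : |α - β| ≤ ‖h‖ := sqrt_sq_add_sq_sub_le t w h
  have hα0 : 0 < α := ht.trans_le hα
  have hβ0 : 0 < β := ht.trans_le hβ
  have hβα : β ≤ 2 * α := by have := (abs_le.1 hαβ).1; linarith
  have hmax : max |α| |β| ≤ 2 * α := by
    rw [abs_of_pos hα0, abs_of_pos hβ0]; exact max_le (by linarith) hβα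
  have hpow := abs_pow_sub_pow_le β α (n + 1)
  have e : t / α ^ (n + 1) - t / β ^ (n + 1) =
      t * (β ^ (n + 1) - α ^ (n + 1)) / (α ^ (n + 1) * β ^ (n + 1)) := by
    field_simp
  rw [e, abs_div, abs_mul, abs_of_pos ht, abs_of_pos (by positivity : 0 < α ^ (n+1) * β ^ (n+1))]
  have h1 : |β ^ (n + 1) - α ^ (n + 1)| ≤ ‖h‖ * (n + 1) * (2 * α) ^ n := by
    refine hpow.trans ?_
    rw [abs_sub_comm, max_comm]
    push_cast
    gcongr
  have h2 : (t + ‖w‖) / 2 ≤ β := le_sqrt_sq_add_sq t ‖w‖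
  unfold poissonMajorant
  calc t * |β ^ (n + 1) - α ^ (n + 1)| / (α ^ (n + 1) * β ^ (n + 1))
      ≤ t * (‖h‖ * (n + 1) * (2 * α) ^ n) / (α ^ (n + 1) * β ^ (n + 1)) := by gcongr
    _ = ((n + 1) * 2 ^ n) * (‖h‖ / α) * (t / β ^ (n + 1)) := by rw [mul_pow, pow_succ α n]; field_simp
    _ ≤ ((n + 1) * 2 ^ n) * (‖h‖ / t) * (t / ((t + ‖w‖) / 2) ^ (n + 1)) := by gcongr
    _ = ((n + 1) * (2 ^ n * 2 ^ (n + 1))) * ((‖h‖ / t) * (t / (t + ‖w‖) ^ (n + 1))) := by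
        rw [div_pow]; field_simp
    _ ≤ ((n + 1) * 8 ^ (n + 1)) * ((‖h‖ / t) * (t / (t + ‖w‖) ^ (n + 1))) := by
        gcongr
        rw [show (8 : ℝ) = 4 * 2 by norm_num, mul_pow]
        gcongr
        calc (2 : ℝ) ^ n ≤ 4 ^ n := by gcongr; norm_num
          _ ≤ 4 ^ (n + 1) := pow_le_pow_right₀ (by norm_num) (by omega)

theorem measurable_poissonKernel (t : ℝ) : Measurable (poissonKernel n t) := by
  unfold poissonKernel poissonProfile
  fun_prop

theorem measurable_poissonMajorant :
    Measurable fun p : ℝ × Euc n => poissonMajorant n p.1 p.2 := by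
  unfold poissonMajorant
  fun_prop

theorem integrable_one_add_norm_pow_inv :
    Integrable fun w : Euc n => ((1 + ‖w‖) ^ (n + 1))⁻¹ := by
  have := integrable_one_add_norm (E := Euc n) (μ := volume) (r := (n + 1 : ℕ)) (by simp)
  refine this.congr (Filter.Eventually.of_forall fun w => ?_)
  simp only [Real.rpow_neg (by positivity : (0 : ℝ) ≤ 1 + ‖w‖), Real.rpow_natCast]

theorem poissonMajorant_scale {t : ℝ} (ht : 0 < t) (w : Euc n) :
    poissonMajorant n t (t • w) = (t ^ n)⁻¹ * ((1 + ‖w‖) ^ (n + 1))⁻¹ := by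
  unfold poissonMajorant
  rw [norm_smul, Real.norm_of_nonneg ht.le, ← mul_one_add, mul_pow, pow_succ t n]
  field_simp

theorem lintegral_smul_eq {t : ℝ} (ht : 0 < t) (f : Euc n → ℝ≥0∞) :
    ∫⁻ w, f w = ENNReal.ofReal t ^ n * ∫⁻ w, f (t • w) := by
  have h := lintegral_map_equiv (μ := (volume : Measure (Euc n))) f
    (Homeomorph.smulOfNeZero t ht.ne' : Euc n ≃ₜ Euc n).toMeasurableEquiv
  have h2 := Measure.map_addHaar_smul (volume : Measure (Euc n)) ht.ne'
  simp only [Homeomorph.toMeasurableEquiv_coe, Homeomorph.smulOfNeZero_apply] at h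
  rw [h2, lintegral_smul_measure, finrank_euclideanSpace,
    Fintype.card_fin, abs_of_pos (by positivity), smul_eq_mul] at h
  rw [← h, ← mul_assoc, ← ENNReal.ofReal_pow ht.le, ← ENNReal.ofReal_mul (by positivity),
    mul_inv_cancel₀ (by positivity), ENNReal.ofReal_one, one_mul]

/-- The mass of the majorant of the Poisson kernel, which does not depend on `t`. -/
def majorantMass (n : ℕ) : ℝ≥0∞ := ∫⁻ w : Euc n, ENNReal.ofReal ((1 + ‖w‖) ^ (n + 1))⁻¹

theorem majorantMass_ne_top : majorantMass n ≠ ∞ :=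
  (integrable_one_add_norm_pow_inv (n := n)).lintegral_lt_top.ne

theorem lintegral_poissonMajorant {t : ℝ} (ht : 0 < t) :
    ∫⁻ w : Euc n, ENNReal.ofReal (poissonMajorant n t w) = majorantMass n := by
  rw [lintegral_smul_eq ht, majorantMass, ← lintegral_const_mul' _ _ (by finiteness)]
  congr with w
  rw [poissonMajorant_scale ht, ← ENNReal.ofReal_pow ht.le, ← ENNReal.ofReal_mul (by positivity),
    mul_inv_cancel_left₀ (by positivity)]

theorem integrable_poissonMajorant {t : ℝ} (ht : 0 < t) :
    Integrable fun w : Euc n => poissonMajorant n t w := by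
  refine ⟨(measurable_poissonMajorant.comp measurable_prodMk_left).aestronglyMeasurable, ?_⟩
  rw [hasFiniteIntegral_iff_ofReal (Filter.Eventually.of_forall (poissonMajorant_nonneg ht)),
    lintegral_poissonMajorant ht]
  exact majorantMass_ne_top.lt_top

theorem integrable_poissonKernel {t : ℝ} (ht : 0 < t) : Integrable (poissonKernel n t) := by
  refine ((integrable_poissonMajorant ht).const_mul (gammaConst n * 2 ^ (n + 1))).mono'
    (measurable_poissonKernel t).aestronglyMeasurable (Filter.Eventually.of_forall fun w => ?_)
  rw [Real.norm_of_nonneg (poissonKernel_nonneg ht w)]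
  exact poissonKernel_le ht w

/-- `∫_{|h| ≥ t} |h|⁻⁽ⁿ⁺¹⁾ dh ≤ C / t`. -/
theorem lintegral_compl_ball_enorm_pow_inv_le {t : ℝ} (ht : 0 < t) :
    ∫⁻ h in {h : Euc n | t ≤ ‖h‖}, (‖h‖ₑ ^ (n + 1))⁻¹ ≤
      2 ^ (n + 1) * majorantMass n * (ENNReal.ofReal t)⁻¹ := by
  have hms : MeasurableSet {h : Euc n | t ≤ ‖h‖} := measurableSet_le measurable_const measurable_norm
  calc _ ≤ ∫⁻ h in {h : Euc n | t ≤ ‖h‖}, (2 ^ (n + 1) * (ENNReal.ofReal t)⁻¹) *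
        ENNReal.ofReal (poissonMajorant n t h) := by
        refine setLIntegral_mono' hms fun h (hh : t ≤ ‖h‖) => ?_
        have h0 : 0 < ‖h‖ := ht.trans_le hh
        have h2 : (2 : ℝ≥0∞) ^ (n + 1) = ENNReal.ofReal (2 ^ (n + 1)) := by
          rw [ENNReal.ofReal_pow zero_le_two, ENNReal.ofReal_ofNat]
        rw [← ofReal_norm, ← ENNReal.ofReal_pow h0.le, ← ENNReal.ofReal_inv_of_pos (by positivity),
          ← ENNReal.ofReal_inv_of_pos ht, h2,
          ← ENNReal.ofReal_mul (by positivity), ← ENNReal.ofReal_mul (by positivity)]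
        refine ENNReal.ofReal_le_ofReal ?_
        unfold poissonMajorant
        calc (‖h‖ ^ (n + 1))⁻¹ = 2 ^ (n + 1) / (‖h‖ + ‖h‖) ^ (n + 1) := by
              rw [← two_mul, mul_pow]; field_simp
          _ ≤ 2 ^ (n + 1) / (t + ‖h‖) ^ (n + 1) := by gcongr
          _ = _ := by field_simp
    _ ≤ ∫⁻ h : Euc n, (2 ^ (n + 1) * (ENNReal.ofReal t)⁻¹) *
        ENNReal.ofReal (poissonMajorant n t h) := setLIntegral_le_lintegral _ _
    _ = _ := by
        have : (ENNReal.ofReal t)⁻¹ ≠ ∞ := by simpa using ht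
        rw [lintegral_const_mul' _ _ (by finiteness), lintegral_poissonMajorant ht]; ring

/-- `∫₀ʳ t / (t + |w|)ⁿ⁺¹ dt / t ≤ min(|w|⁻ⁿ, r |w|⁻⁽ⁿ⁺¹⁾)`, up to a constant. -/
theorem lintegral_poissonMajorant_div_le (hn : 1 ≤ n) {r : ℝ} (hr : 0 < r) (w : Euc n) :
    ∫⁻ t in Ioo 0 r, (ENNReal.ofReal t)⁻¹ * ENNReal.ofReal (poissonMajorant n t w) ≤
      2 * tailKernel n r w := by
  rcases eq_or_ne w 0 with rfl | hw
  · have : tailKernel n r 0 = ∞ := by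
      have : ENNReal.ofReal r ≠ 0 := by simpa using hr
      simp [tailKernel, zero_pow (by omega : n ≠ 0), ENNReal.mul_top this]
    rw [this, ENNReal.mul_top (by norm_num)]; exact le_top
  have hw0 : 0 < ‖w‖ := norm_pos_iff.2 hw
  have hwe : ‖w‖ₑ ≠ 0 := by simpa using hw
  have e1 : ∀ t ∈ Ioi (0 : ℝ), (ENNReal.ofReal t)⁻¹ * ENNReal.ofReal (poissonMajorant n t w) =
      ENNReal.ofReal ((t + ‖w‖) ^ (n + 1))⁻¹ := fun t (ht : 0 < t) => by
    rw [← ENNReal.ofReal_inv_of_pos ht, ← ENNReal.ofReal_mul (by positivity), poissonMajorant]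
    congr 1
    field_simp
  have b1 : ∀ t ∈ Ioi (0 : ℝ), ENNReal.ofReal ((t + ‖w‖) ^ (n + 1))⁻¹ ≤ (‖w‖ₑ ^ (n + 1))⁻¹ :=
      fun t (ht : 0 < t) => by
    rw [← ofReal_norm, ← ENNReal.ofReal_pow hw0.le, ← ENNReal.ofReal_inv_of_pos (by positivity)]
    gcongr
    linarith
  have b2 : ∀ t ∈ Ioi ‖w‖, ENNReal.ofReal ((t + ‖w‖) ^ (n + 1))⁻¹ ≤
      ENNReal.ofReal (t ^ (-(n + 1 : ℕ) : ℝ)) := fun t (ht : ‖w‖ < t) => by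
    have : 0 < t := hw0.trans ht
    rw [Real.rpow_neg this.le, Real.rpow_natCast]
    gcongr
    linarith
  rw [setLIntegral_congr_fun measurableSet_Ioo fun t ht => e1 t ht.1]
  have c1 : ∫⁻ t in Ioo 0 r, ENNReal.ofReal ((t + ‖w‖) ^ (n + 1))⁻¹ ≤
      ENNReal.ofReal r * (‖w‖ₑ ^ (n + 1))⁻¹ := by
    refine (setLIntegral_mono' measurableSet_Ioo fun t ht => b1 t ht.1).trans ?_
    rw [setLIntegral_const, Real.volume_Ioo, sub_zero, mul_comm]
  have c2 : ∫⁻ t in Ioo 0 r, ENNReal.ofReal ((t + ‖w‖) ^ (n + 1))⁻¹ ≤ 2 * (‖w‖ₑ ^ n)⁻¹ := by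
    have hsub : Ioo 0 r ⊆ Ioc 0 ‖w‖ ∪ Ioi ‖w‖ := by
      rw [Ioc_union_Ioi_eq_Ioi hw0.le]; exact fun t ht => ht.1
    refine (lintegral_mono_set hsub).trans ((lintegral_union_le _ _ _).trans ?_)
    rw [two_mul]
    refine add_le_add ?_ ?_
    · refine (setLIntegral_mono' measurableSet_Ioc fun t ht => b1 t ht.1).trans ?_
      rw [setLIntegral_const, Real.volume_Ioc, sub_zero, ofReal_norm, pow_succ,
        ENNReal.mul_inv (by simp) (by simp), mul_assoc, ENNReal.inv_mul_cancel hwe (by finiteness),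
        mul_one]
    · refine (setLIntegral_mono' measurableSet_Ioi b2).trans ?_
      have hlt : (-(n + 1 : ℕ) : ℝ) < -1 := by
        have : (1 : ℝ) ≤ n := by exact_mod_cast hn
        push_cast; linarith
      rw [← ofReal_integral_eq_lintegral_ofReal (integrableOn_Ioi_rpow_of_lt hlt hw0)
        ((ae_restrict_mem measurableSet_Ioi).mono fun t (ht : ‖w‖ < t) =>
          Real.rpow_nonneg (hw0.trans ht).le _), integral_Ioi_rpow_of_lt hlt hw0]
      rw [← ofReal_norm, ← ENNReal.ofReal_pow hw0.le, ← ENNReal.ofReal_inv_of_pos (by positivity)]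
      refine ENNReal.ofReal_le_ofReal ?_
      have hn' : (1 : ℝ) ≤ n := by exact_mod_cast hn
      have : (-(n + 1 : ℕ) : ℝ) + 1 = -(n : ℝ) := by push_cast; ring
      rw [this, neg_div_neg_eq, Real.rpow_neg hw0.le, Real.rpow_natCast]
      exact div_le_self (by positivity) hn'
  unfold tailKernel
  rw [mul_min]
  exact le_min c2 (c1.trans (le_mul_of_one_le_left (by positivity) (by norm_num)))

/-- `∫_{|h| < t} |h|^(1-n) dh ≤ C t`. -/
theorem exists_lintegral_ball_enorm_le (hn : 1 ≤ n) : ∃ C : ℝ≥0∞, C ≠ ∞ ∧ ∀ t : ℝ, 0 < t →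
    ∫⁻ h in ball (0 : Euc n) t, ‖h‖ₑ * (‖h‖ₑ ^ n)⁻¹ ≤ C * ENNReal.ofReal t := by
  refine ⟨∫⁻ h in ball (0 : Euc n) 1, ‖h‖ₑ * (‖h‖ₑ ^ n)⁻¹, ?_, fun t ht => le_of_eq ?_⟩
  · have : Nontrivial (Euc n) :=
      Module.nontrivial_of_finrank_pos (R := ℝ) (by rw [finrank_euclideanSpace_fin]; omega)
    have : IntegrableOn (fun h : Euc n => ‖h‖ * (‖h‖ ^ n)⁻¹) (ball 0 1) volume := by
      rw [integrableOn_fun_norm_addHaar volume (f := fun y : ℝ => y * (y ^ n)⁻¹)]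
      refine (integrableOn_const (C := (1 : ℝ)) (by simp)).congr_fun (fun y hy => ?_)
        measurableSet_Ioo
      have : y ≠ 0 := hy.1.ne'
      obtain ⟨k, rfl⟩ := Nat.exists_eq_add_of_le' hn
      simp only [finrank_euclideanSpace, Fintype.card_fin, smul_eq_mul, Nat.add_sub_cancel, pow_succ]
      field_simp
    refine ne_of_eq_of_ne (lintegral_congr fun h => ?_) this.lintegral_lt_top.ne
    rcases eq_or_ne h 0 with rfl | hh
    · simp
    have hh0 : 0 < ‖h‖ := norm_pos_iff.2 hh
    rw [ENNReal.ofReal_mul hh0.le, ENNReal.ofReal_inv_of_pos (by positivity),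
      ENNReal.ofReal_pow hh0.le, ofReal_norm]
  · have ht0 : ENNReal.ofReal t ≠ 0 := by simpa using ht
    rw [← lintegral_indicator measurableSet_ball, lintegral_smul_eq ht,
      ← lintegral_indicator measurableSet_ball, mul_comm,
      ← lintegral_mul_const' _ _ (by finiteness), ← lintegral_mul_const' _ _ (by finiteness)]
    congr with h
    have hmem : t • h ∈ ball (0 : Euc n) t ↔ h ∈ ball (0 : Euc n) 1 := by
      simp [norm_smul, abs_of_pos ht, mul_lt_iff_lt_one_right ht]
    have hnorm : ‖t • h‖ₑ = ENNReal.ofReal t * ‖h‖ₑ := by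
      rw [enorm_smul, Real.enorm_of_nonneg ht.le]
    by_cases hb : h ∈ ball (0 : Euc n) 1
    · rw [indicator_of_mem hb, indicator_of_mem (hmem.2 hb), hnorm, mul_pow,
        ENNReal.mul_inv (Or.inl (by positivity)) (Or.inl (by finiteness))]
      calc _ = ENNReal.ofReal t * ‖h‖ₑ * (‖h‖ₑ ^ n)⁻¹ *
            ((ENNReal.ofReal t ^ n)⁻¹ * ENNReal.ofReal t ^ n) := by ring
        _ = _ := by rw [ENNReal.inv_mul_cancel (by positivity) (by finiteness)]; ring
    · rw [indicator_of_notMem hb, indicator_of_notMem (hmem.not.2 hb), zero_mul, zero_mul]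

/-! ### Increments of the Poisson extension -/

/-- Jensen's inequality for the measure `k μ`, in the homogeneous form
`(∫ k g)^p ≤ (∫ k)^(p-1) ∫ k g^p`. -/
theorem lintegral_mul_rpow_le {α : Type*} [MeasurableSpace α] {μ : Measure α} {p : ℝ} (hp : 1 < p)
    {k g : α → ℝ≥0∞} (hk : AEMeasurable k μ) (hg : AEMeasurable g μ) :
    (∫⁻ x, k x * g x ∂μ) ^ p ≤ (∫⁻ x, k x ∂μ) ^ (p - 1) * ∫⁻ x, k x * g x ^ p ∂μ := by
  have hp0 : 0 < p := by linarith
  have hq := Real.HolderConjugate.conjExponent hp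
  set q := Real.conjExponent p
  have hq0 : 0 < q := hq.symm.pos
  have h := ENNReal.lintegral_mul_le_Lp_mul_Lq μ hq.symm (f := fun x => k x ^ (1 / q))
    (g := fun x => k x ^ (1 / p) * g x) (hk.pow_const _) ((hk.pow_const _).mul hg)
  have e1 : ∀ x, ((fun x => k x ^ (1 / q)) * fun x => k x ^ (1 / p) * g x) x = k x * g x := fun x => by
    simp only [Pi.mul_apply]
    rw [← mul_assoc, ← ENNReal.rpow_add_of_nonneg _ _ (by positivity) (by positivity), add_comm,
      one_div, one_div, hq.inv_add_inv_eq_one, ENNReal.rpow_one]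
  have e2 : ∀ x, (k x ^ (1 / q)) ^ q = k x := fun x => by
    rw [← ENNReal.rpow_mul, one_div_mul_cancel hq0.ne', ENNReal.rpow_one]
  have e3 : ∀ x, (k x ^ (1 / p) * g x) ^ p = k x * g x ^ p := fun x => by
    rw [ENNReal.mul_rpow_of_nonneg _ _ hp0.le, ← ENNReal.rpow_mul, one_div_mul_cancel hp0.ne',
      ENNReal.rpow_one]
  simp only [e1, e2, e3] at h
  have h2 := ENNReal.rpow_le_rpow h hp0.le
  rw [ENNReal.mul_rpow_of_nonneg _ _ hp0.le, ← ENNReal.rpow_mul, ← ENNReal.rpow_mul,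
    one_div_mul_cancel hp0.ne', ENNReal.rpow_one] at h2
  have e4 : 1 / q * p = p - 1 := by
    have := hq.inv_add_inv_eq_one
    field_simp at this ⊢
    linarith
  rwa [e4] at h2

theorem lintegral_mul_sq_le {α : Type*} [MeasurableSpace α] {μ : Measure α}
    {k g : α → ℝ≥0∞} (hk : AEMeasurable k μ) (hg : AEMeasurable g μ) :
    (∫⁻ x, k x * g x ∂μ) ^ 2 ≤ (∫⁻ x, k x ∂μ) * ∫⁻ x, k x * g x ^ 2 ∂μ := by
  have := lintegral_mul_rpow_le one_lt_two hk hg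
  norm_num at this
  exact this

/-- The mean square oscillation `∫ p_t(y - v) |a(v) - a(y)|² dv` of `a` at the point `y` and the
scale `t`, with the Poisson kernel replaced by its majorant. -/
def poissonOsc (a : Euc n → Euc m) (t : ℝ) (y : Euc n) : ℝ≥0∞ :=
  ∫⁻ v, ENNReal.ofReal (poissonMajorant n t (y - v)) * sqOsc a v y

/-- All Poisson majorants are dominated by the tail kernel at scale `1` around any other point, with a
constant that may depend on the points. -/
theorem majorant_le_tailKernel {t : ℝ} (ht : 0 < t) (x z : Euc n) : ∃ K : ℝ≥0∞, K ≠ ∞ ∧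
    ∀ v, ENNReal.ofReal (poissonMajorant n t (x - v)) ≤ K * tailKernel n 1 (v - z) := by
  set K₀ := (1 + ‖x - z‖) / t + 1 with hK₀
  have hK₀pos : 0 < K₀ := by positivity
  refine ⟨ENNReal.ofReal (t * K₀ ^ (n + 1)), by finiteness, fun v => ?_⟩
  have h1 : 1 + ‖v - z‖ ≤ K₀ * (t + ‖x - v‖) := by
    have h2 : ‖v - z‖ ≤ ‖x - v‖ + ‖x - z‖ := by
      have := norm_sub_le (x - z) (x - v)
      rw [sub_sub_sub_cancel_left] at this
      linarith
    have h3 : K₀ * (t + ‖x - v‖) =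
        1 + ‖x - z‖ + t + (1 + ‖x - z‖) / t * ‖x - v‖ + ‖x - v‖ := by
      rw [hK₀]; field_simp; ring
    have h4 : 0 ≤ (1 + ‖x - z‖) / t * ‖x - v‖ := by positivity
    linarith
  have h5 : ENNReal.ofReal (((1 + ‖v - z‖) ^ (n + 1))⁻¹) ≤ tailKernel n 1 (v - z) := by
    have h6 : ENNReal.ofReal (((1 + ‖v - z‖) ^ (n + 1))⁻¹) = ((1 + ‖v - z‖ₑ) ^ (n + 1))⁻¹ := by
      rw [ENNReal.ofReal_inv_of_pos (by positivity), ENNReal.ofReal_pow (by positivity),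
        ENNReal.ofReal_add zero_le_one (norm_nonneg _), ENNReal.ofReal_one, ofReal_norm]
    rw [h6, tailKernel, ENNReal.ofReal_one, one_mul]
    refine le_min (ENNReal.inv_le_inv.2 ?_) (ENNReal.inv_le_inv.2 ?_)
    · calc ‖v - z‖ₑ ^ n ≤ (1 + ‖v - z‖ₑ) ^ n := pow_le_pow_left' le_add_self n
        _ ≤ _ := pow_le_pow_right₀ le_self_add (by omega)
    · exact pow_le_pow_left' le_add_self _
  refine le_trans ?_ (mul_le_mul_right h5 _)
  rw [← ENNReal.ofReal_mul (by positivity)]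
  refine ENNReal.ofReal_le_ofReal ?_
  unfold poissonMajorant
  have h7 := pow_le_pow_left₀ (by positivity) h1 (n + 1)
  rw [mul_pow] at h7
  rw [mul_assoc, div_eq_mul_inv]
  refine mul_le_mul_of_nonneg_left ?_ ht.le
  rw [← div_eq_mul_inv, inv_eq_one_div, div_le_div_iff₀ (by positivity) (by positivity), one_mul]
  exact h7

/-- Some base point `z` makes all Poisson averages of `|a - a(z)|²` finite: almost every point of the
unit ball will do, since the tail energy there is finite. -/
theorem exists_lintegral_majorant_sqOsc_ne_top {a : Euc n → Euc m} (ha : Measurable a)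
    {Q : ℝ≥0∞} (hQ : QBound a Q) (hQt : Q ≠ ∞) :
    ∃ z, ∀ (t : ℝ) (x : Euc n), 0 < t →
      ∫⁻ v, ENNReal.ofReal (poissonMajorant n t (x - v)) * sqOsc a v z ≠ ∞ := by
  have h1 : tailEnergy a 0 1 ≠ ∞ := ne_top_of_le_ne_top (by finiteness) (tailEnergy_le ha hQ 0 one_pos)
  have h2 : ∀ᵐ z ∂volume.restrict (ball (0 : Euc n) 1),
      ∫⁻ v, tailKernel n 1 (v - z) * sqOsc a v z < ∞ :=
    ae_lt_top (measurable_tailKernel_mul_sqOsc ha 1).lintegral_prod_right' h1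
  have : (ae (volume.restrict (ball (0 : Euc n) 1))).NeBot := by
    rw [ae_neBot, Ne, Measure.restrict_eq_zero]
    exact (measure_ball_pos _ _ one_pos).ne'
  obtain ⟨z, hz⟩ := h2.exists
  refine ⟨z, fun t x ht => ?_⟩
  obtain ⟨K, hK, hKv⟩ := majorant_le_tailKernel ht x z
  refine ne_top_of_le_ne_top (ENNReal.mul_ne_top hK hz.ne) ?_
  rw [← lintegral_const_mul' _ _ hK]
  refine lintegral_mono fun v => ?_
  rw [← mul_assoc]
  exact mul_le_mul_left (hKv v) _

theorem measurable_ofReal_majorant_sub (t : ℝ) (x : Euc n) :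
    Measurable fun v => ENNReal.ofReal (poissonMajorant n t (x - v)) :=
  ENNReal.measurable_ofReal.comp
    (measurable_poissonMajorant.comp (measurable_const.prodMk (measurable_const.sub measurable_id)))

theorem lintegral_ofReal_majorant_sub {t : ℝ} (ht : 0 < t) (x : Euc n) :
    ∫⁻ v, ENNReal.ofReal (poissonMajorant n t (x - v)) = majorantMass n := by
  rw [lintegral_sub_left_eq_self fun w => ENNReal.ofReal (poissonMajorant n t w),
    lintegral_poissonMajorant ht]

theorem enorm_poissonKernel_le {t : ℝ} (ht : 0 < t) (w : Euc n) :
    ‖poissonKernel n t w‖ₑ ≤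
      ENNReal.ofReal (gammaConst n * 2 ^ (n + 1)) * ENNReal.ofReal (poissonMajorant n t w) := by
  have hg := gammaConst_pos n
  rw [Real.enorm_of_nonneg (poissonKernel_nonneg ht w), ← ENNReal.ofReal_mul (by positivity)]
  exact ENNReal.ofReal_le_ofReal (poissonKernel_le ht w)

/-- The Poisson integral of a function of `Q_0` converges absolutely. -/
theorem integrable_poissonKernel_smul_of_QBound {a : Euc n → Euc m} (ha : Measurable a)
    {Q : ℝ≥0∞} (hQ : QBound a Q) (hQt : Q ≠ ∞) {t : ℝ} (ht : 0 < t) (x : Euc n) :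
    Integrable fun y => poissonKernel n t (x - y) • a y := by
  obtain ⟨z, hz⟩ := exists_lintegral_majorant_sqOsc_ne_top ha hQ hQt
  have hp : Integrable fun y => poissonKernel n t (x - y) :=
    (integrable_poissonKernel ht).comp_sub_left x
  have h1 : Integrable fun y => poissonKernel n t (x - y) • (a y - a z) := by
    refine ⟨hp.1.smul (ha.sub measurable_const).aestronglyMeasurable, ?_⟩
    calc ∫⁻ y, ‖poissonKernel n t (x - y) • (a y - a z)‖ₑ
        ≤ ∫⁻ y, ENNReal.ofReal (gammaConst n * 2 ^ (n + 1)) *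
            (ENNReal.ofReal (poissonMajorant n t (x - y)) +
              ENNReal.ofReal (poissonMajorant n t (x - y)) * sqOsc a y z) := by
          refine lintegral_mono fun y => ?_
          have : ‖a y - a z‖ₑ ≤ 1 + sqOsc a y z := by
            unfold sqOsc
            rcases le_total ‖a y - a z‖ₑ 1 with h | h
            · exact h.trans le_self_add
            · exact (le_self_pow₀ h two_ne_zero).trans le_add_self
          calc _ ≤ (ENNReal.ofReal (gammaConst n * 2 ^ (n + 1)) *
                ENNReal.ofReal (poissonMajorant n t (x - y))) * (1 + sqOsc a y z) := by
                rw [enorm_smul]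
                exact mul_le_mul' (enorm_poissonKernel_le ht _) this
            _ = _ := by ring
      _ = ENNReal.ofReal (gammaConst n * 2 ^ (n + 1)) * (majorantMass n +
            ∫⁻ y, ENNReal.ofReal (poissonMajorant n t (x - y)) * sqOsc a y z) := by
          rw [lintegral_const_mul' _ _ (by finiteness),
            lintegral_add_left (measurable_ofReal_majorant_sub t x),
            lintegral_ofReal_majorant_sub ht]
      _ < ∞ := ENNReal.mul_lt_top (by finiteness)
          (ENNReal.add_lt_top.2 ⟨majorantMass_ne_top.lt_top, (hz t x ht).lt_top⟩)
  refine (h1.add (hp.smul_const (a z))).congr (Filter.Eventually.of_forall fun y => ?_)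
  simp [← smul_add]

/-- A weighted integral of `a(v) - a(y)`, estimated by the mean square oscillation. -/
theorem enorm_integral_smul_sub_sq_le {a : Euc n → Euc m} (ha : Measurable a) {t : ℝ} (ht : 0 < t)
    (y : Euc n) {k : Euc n → ℝ} {c : ℝ≥0∞} (hc : c ≠ ∞)
    (hk : ∀ v, ‖k v‖ₑ ≤ c * ENNReal.ofReal (poissonMajorant n t (y - v))) :
    ‖∫ v, k v • (a v - a y)‖ₑ ^ 2 ≤ c ^ 2 * majorantMass n * poissonOsc a t y := by
  calc ‖∫ v, k v • (a v - a y)‖ₑ ^ 2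
      ≤ (∫⁻ v, c * (ENNReal.ofReal (poissonMajorant n t (y - v)) * ‖a v - a y‖ₑ)) ^ 2 := by
        refine pow_le_pow_left' ((enorm_integral_le_lintegral_enorm _).trans ?_) 2
        refine lintegral_mono fun v => ?_
        rw [enorm_smul, ← mul_assoc]
        exact mul_le_mul_left (hk v) _
    _ = c ^ 2 * (∫⁻ v, ENNReal.ofReal (poissonMajorant n t (y - v)) * ‖a v - a y‖ₑ) ^ 2 := by
        rw [lintegral_const_mul' _ _ hc, mul_pow]
    _ ≤ c ^ 2 * ((∫⁻ v, ENNReal.ofReal (poissonMajorant n t (y - v))) *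
          ∫⁻ v, ENNReal.ofReal (poissonMajorant n t (y - v)) * ‖a v - a y‖ₑ ^ 2) := by
        gcongr
        exact lintegral_mul_sq_le (measurable_ofReal_majorant_sub t y).aemeasurable
          (ha.sub measurable_const).enorm.aemeasurable
    _ = _ := by rw [lintegral_ofReal_majorant_sub ht, mul_assoc]; rfl

/-- Increments of the Poisson extension below the scale `t`. -/
theorem enorm_poissonExt_sub_sq_le_of_norm_le {a : Euc n → Euc m} (ha : Measurable a) {t : ℝ}
    (ht : 0 < t) (hint : ∀ x, Integrable fun y => poissonKernel n t (x - y) • a y)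
    (y h : Euc n) (hh : ‖h‖ ≤ t) :
    ‖poissonExt a t (y + h) - poissonExt a t y‖ₑ ^ 2 ≤
      (ENNReal.ofReal (gammaConst n * ((n + 1) * 8 ^ (n + 1))) * (‖h‖ₑ / ENNReal.ofReal t)) ^ 2 *
        majorantMass n * poissonOsc a t y := by
  have hp : ∀ x, Integrable fun v => poissonKernel n t (x - v) := fun x =>
    (integrable_poissonKernel ht).comp_sub_left x
  have hm : ∀ x, ∫ v, poissonKernel n t (x - v) = ∫ v, poissonKernel n t v := fun x =>
    integral_sub_left_eq_self (poissonKernel n t) volume x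
  have e : poissonExt a t (y + h) - poissonExt a t y =
      ∫ v, (poissonKernel n t (y + h - v) - poissonKernel n t (y - v)) • (a v - a y) := by
    have e1 : ∀ v, (poissonKernel n t (y + h - v) - poissonKernel n t (y - v)) • (a v - a y) =
        (poissonKernel n t (y + h - v) • a v - poissonKernel n t (y - v) • a v) -
          (poissonKernel n t (y + h - v) - poissonKernel n t (y - v)) • a y := fun v => by
      rw [smul_sub, sub_smul]
    have i1 : Integrable fun v =>
        poissonKernel n t (y + h - v) • a v - poissonKernel n t (y - v) • a v :=
      (hint _).sub (hint _)
    have i2 : Integrable fun v =>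
        (poissonKernel n t (y + h - v) - poissonKernel n t (y - v)) • a y :=
      ((hp _).sub (hp _)).smul_const _
    simp_rw [e1]
    rw [integral_sub i1 i2, integral_sub (hint _) (hint _), integral_smul_const,
      integral_sub (hp _) (hp _), hm, hm, sub_self, zero_smul, sub_zero]
    rfl
  have ht0 : ENNReal.ofReal t ≠ 0 := by simpa using ht
  rw [e]
  refine enorm_integral_smul_sub_sq_le ha ht y (by finiteness) fun v => ?_
  have hb := abs_poissonKernel_add_sub_le ht (y - v) h hh
  rw [sub_add_eq_add_sub] at hb
  have hg := gammaConst_pos n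
  rw [← ofReal_norm, ← ofReal_norm, ← ENNReal.ofReal_div_of_pos ht,
    ← ENNReal.ofReal_mul (by positivity), ← ENNReal.ofReal_mul (by positivity)]
  exact ENNReal.ofReal_le_ofReal hb

/-- The difference between the Poisson extension and `a`. The value of the integral of the Poisson
kernel is not needed, only that it does not depend on the base point. -/
theorem enorm_poissonExt_sub_smul_sq_le {a : Euc n → Euc m} (ha : Measurable a) {t : ℝ}
    (ht : 0 < t) (hint : ∀ x, Integrable fun y => poissonKernel n t (x - y) • a y) (y : Euc n) :
    ‖poissonExt a t y - (∫ w, poissonKernel n t w) • a y‖ₑ ^ 2 ≤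
      ENNReal.ofReal (gammaConst n * 2 ^ (n + 1)) ^ 2 * majorantMass n * poissonOsc a t y := by
  have hp : Integrable fun v => poissonKernel n t (y - v) :=
    (integrable_poissonKernel ht).comp_sub_left y
  have e : poissonExt a t y - (∫ w, poissonKernel n t w) • a y =
      ∫ v, poissonKernel n t (y - v) • (a v - a y) := by
    simp_rw [smul_sub]
    rw [integral_sub (hint _) (hp.smul_const _), integral_smul_const,
      integral_sub_left_eq_self (poissonKernel n t) volume y]
    rfl
  rw [e]
  exact enorm_integral_smul_sub_sq_le ha ht y (by finiteness) fun v => enorm_poissonKernel_le ht _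

theorem enorm_integral_poissonKernel_le {t : ℝ} (ht : 0 < t) :
    ‖∫ w, poissonKernel n t w‖ₑ ≤ ENNReal.ofReal (gammaConst n * 2 ^ (n + 1)) * majorantMass n := by
  refine (enorm_integral_le_lintegral_enorm _).trans ?_
  rw [← lintegral_poissonMajorant ht, ← lintegral_const_mul' _ _ (by finiteness)]
  exact lintegral_mono fun w => enorm_poissonKernel_le ht w

theorem enorm_add_add_sq_le {E : Type*} [SeminormedAddCommGroup E] (x y z : E) :
    ‖x + y + z‖ₑ ^ 2 ≤ 3 * (‖x‖ₑ ^ 2 + ‖y‖ₑ ^ 2 + ‖z‖ₑ ^ 2) := by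
  have key : ‖x + y + z‖ ^ 2 ≤ 3 * (‖x‖ ^ 2 + ‖y‖ ^ 2 + ‖z‖ ^ 2) := by
    have h := pow_le_pow_left₀ (norm_nonneg _) (norm_add₃_le (a := x) (b := y) (c := z)) 2
    nlinarith [sq_nonneg (‖x‖ - ‖y‖), sq_nonneg (‖x‖ - ‖z‖), sq_nonneg (‖y‖ - ‖z‖)]
  have := ENNReal.ofReal_le_ofReal key
  rw [ENNReal.ofReal_mul (by positivity), ENNReal.ofReal_add (by positivity) (by positivity),
    ENNReal.ofReal_add (by positivity) (by positivity)] at this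
  simpa [ENNReal.ofReal_pow, ofReal_norm] using this

/-- Increments of the Poisson extension at any scale. -/
theorem exists_enorm_poissonExt_sub_sq_le (n : ℕ) : ∃ C : ℝ≥0∞, C ≠ ∞ ∧
    ∀ {m : ℕ} {a : Euc n → Euc m}, Measurable a → ∀ {t : ℝ}, 0 < t →
    (∀ x, Integrable fun y => poissonKernel n t (x - y) • a y) → ∀ y h : Euc n,
    ‖poissonExt a t (y + h) - poissonExt a t y‖ₑ ^ 2 ≤
      C * (poissonOsc a t y + (poissonOsc a t (y + h) + sqOsc a (y + h) y)) := by
  set c := ENNReal.ofReal (gammaConst n * 2 ^ (n + 1))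
  have hM := majorantMass_ne_top (n := n)
  refine ⟨3 * (c ^ 2 * majorantMass n + (c * majorantMass n) ^ 2), by finiteness,
    fun {m a} ha {t} ht hint y h => ?_⟩
  set M := ∫ w, poissonKernel n t w
  have e : poissonExt a t (y + h) - poissonExt a t y =
      (poissonExt a t (y + h) - M • a (y + h)) + -(poissonExt a t y - M • a y) +
        M • (a (y + h) - a y) := by
    rw [smul_sub]; abel
  rw [e]
  refine (enorm_add_add_sq_le _ _ _).trans ?_
  rw [enorm_neg, enorm_smul, mul_pow]
  have h1 := enorm_poissonExt_sub_smul_sq_le ha ht hint y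
  have h2 := enorm_poissonExt_sub_smul_sq_le ha ht hint (y + h)
  have h3 := pow_le_pow_left' (enorm_integral_poissonKernel_le (n := n) ht) 2
  set D := poissonOsc a t y
  set D' := poissonOsc a t (y + h)
  calc _ ≤ 3 * (c ^ 2 * majorantMass n * D' + c ^ 2 * majorantMass n * D +
        (c * majorantMass n) ^ 2 * sqOsc a (y + h) y) := by
        gcongr
        exact le_rfl
    _ ≤ 3 * ((c ^ 2 * majorantMass n + (c * majorantMass n) ^ 2) * D' +
        (c ^ 2 * majorantMass n + (c * majorantMass n) ^ 2) * D +
        (c ^ 2 * majorantMass n + (c * majorantMass n) ^ 2) * sqOsc a (y + h) y) := by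
        gcongr
        · exact le_self_add
        · exact le_self_add
        · exact le_add_self
    _ = _ := by ring

/-- The fractional energy density of the Poisson extension at the scale `t`. -/
theorem exists_energyDensity_poissonExt_le (hn : 1 ≤ n) : ∃ C : ℝ≥0∞, C ≠ ∞ ∧
    ∀ {m : ℕ} {a : Euc n → Euc m}, Measurable a → ∀ {t : ℝ}, 0 < t →
    (∀ x, Integrable fun y => poissonKernel n t (x - y) • a y) → ∀ y : Euc n,
    energyDensity (poissonExt a t) y ≤
      C * ((ENNReal.ofReal t)⁻¹ * poissonOsc a t y + ∫⁻ h in {h : Euc n | t ≤ ‖h‖},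
        (‖h‖ₑ ^ (n + 1))⁻¹ * (poissonOsc a t (y + h) + sqOsc a (y + h) y)) := by
  obtain ⟨C₁, hC₁, h₁⟩ := exists_lintegral_ball_enorm_le hn
  obtain ⟨C₂, hC₂, h₂⟩ := exists_enorm_poissonExt_sub_sq_le n
  set c := ENNReal.ofReal (gammaConst n * ((n + 1) * 8 ^ (n + 1)))
  set g := ENNReal.ofReal (gammaConst n / 2)
  have hM := majorantMass_ne_top (n := n)
  refine ⟨g * (c ^ 2 * majorantMass n * C₁ + C₂ * (2 ^ (n + 1) * majorantMass n) + C₂),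
    by finiteness, fun {m a} ha {t} ht hint y => ?_⟩
  set T := ENNReal.ofReal t with hT
  have ht0 : T ≠ 0 := by simpa [hT] using ht
  have hti : T ≠ ∞ := by finiteness
  set D := poissonOsc a t y
  set F := fun h : Euc n => ‖poissonExt a t (y + h) - poissonExt a t y‖ₑ ^ 2 / ‖h‖ₑ ^ (n + 1)
  set I := ∫⁻ h in {h : Euc n | t ≤ ‖h‖},
    (‖h‖ₑ ^ (n + 1))⁻¹ * (poissonOsc a t (y + h) + sqOsc a (y + h) y)
  have hw : ∀ k : ℕ, Measurable fun h : Euc n => (‖h‖ₑ ^ k)⁻¹ := fun k =>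
    (measurable_enorm.pow_const k).inv
  have hw' : Measurable fun h : Euc n => ‖h‖ₑ * (‖h‖ₑ ^ n)⁻¹ := measurable_enorm.mul (hw n)
  have hsplit : ∫⁻ h, F h ≤ (∫⁻ h in ball 0 t, F h) + ∫⁻ h in {h : Euc n | t ≤ ‖h‖}, F h := by
    rw [← setLIntegral_univ]
    have : (univ : Set (Euc n)) = ball 0 t ∪ {h : Euc n | t ≤ ‖h‖} := by
      ext h; simpa using lt_or_ge ‖h‖ t
    rw [this]
    exact lintegral_union_le _ _ _
  have hnear : ∫⁻ h in ball 0 t, F h ≤ c ^ 2 * majorantMass n * C₁ * (T⁻¹ * D) := by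
    calc ∫⁻ h in ball 0 t, F h
        ≤ ∫⁻ h in ball (0 : Euc n) t, (c ^ 2 * majorantMass n * T⁻¹ ^ 2 * D) *
            (‖h‖ₑ * (‖h‖ₑ ^ n)⁻¹) := by
          refine setLIntegral_mono' measurableSet_ball fun h hh => ?_
          rcases eq_or_ne h 0 with rfl | h0
          · simp [F]
          have he0 : ‖h‖ₑ ≠ 0 := by simpa using h0
          have hb := enorm_poissonExt_sub_sq_le_of_norm_le ha ht hint y h (mem_ball_zero_iff.1 hh).le
          have e : ‖h‖ₑ ^ 2 * (‖h‖ₑ ^ (n + 1))⁻¹ = ‖h‖ₑ * (‖h‖ₑ ^ n)⁻¹ := by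
            rw [pow_succ ‖h‖ₑ n, ENNReal.mul_inv (by simp) (by simp), sq]
            calc _ = ‖h‖ₑ * (‖h‖ₑ ^ n)⁻¹ * (‖h‖ₑ * ‖h‖ₑ⁻¹) := by ring
              _ = _ := by rw [ENNReal.mul_inv_cancel he0 (by finiteness), mul_one]
          calc F h ≤ ((c * (‖h‖ₑ / T)) ^ 2 * majorantMass n * D) / ‖h‖ₑ ^ (n + 1) :=
                ENNReal.div_le_div_right hb _
            _ = (c ^ 2 * majorantMass n * T⁻¹ ^ 2 * D) * (‖h‖ₑ ^ 2 * (‖h‖ₑ ^ (n + 1))⁻¹) := by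
                rw [div_eq_mul_inv, div_eq_mul_inv]; ring
            _ = _ := by rw [e]
      _ ≤ (c ^ 2 * majorantMass n * T⁻¹ ^ 2 * D) * (C₁ * T) := by
          rw [lintegral_const_mul _ hw']
          gcongr
          exact h₁ t ht
      _ = c ^ 2 * majorantMass n * C₁ * (T⁻¹ * D) * (T⁻¹ * T) := by ring
      _ = _ := by rw [ENNReal.inv_mul_cancel ht0 hti, mul_one]
  have hfar : ∫⁻ h in {h : Euc n | t ≤ ‖h‖}, F h ≤
      C₂ * (2 ^ (n + 1) * majorantMass n) * (T⁻¹ * D) + C₂ * I := by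
    calc ∫⁻ h in {h : Euc n | t ≤ ‖h‖}, F h
        ≤ ∫⁻ h in {h : Euc n | t ≤ ‖h‖}, (C₂ * D * (‖h‖ₑ ^ (n + 1))⁻¹ +
            C₂ * ((‖h‖ₑ ^ (n + 1))⁻¹ * (poissonOsc a t (y + h) + sqOsc a (y + h) y))) := by
          refine lintegral_mono fun h => ?_
          refine (ENNReal.div_le_div_right (h₂ ha ht hint y h) _).trans (le_of_eq ?_)
          rw [div_eq_mul_inv]; ring
      _ = (∫⁻ h in {h : Euc n | t ≤ ‖h‖}, C₂ * D * (‖h‖ₑ ^ (n + 1))⁻¹) + C₂ * I := by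
          rw [lintegral_add_left ((hw (n + 1)).const_mul _),
            lintegral_const_mul' C₂ _ hC₂]
      _ ≤ C₂ * D * (2 ^ (n + 1) * majorantMass n * T⁻¹) + C₂ * I := by
          gcongr
          rw [lintegral_const_mul _ (hw (n + 1))]
          gcongr
          exact lintegral_compl_ball_enorm_pow_inv_le ht
      _ = _ := by ring
  calc energyDensity (poissonExt a t) y
      ≤ g * (c ^ 2 * majorantMass n * C₁ * (T⁻¹ * D) +
          (C₂ * (2 ^ (n + 1) * majorantMass n) * (T⁻¹ * D) + C₂ * I)) :=
        mul_le_mul_right (hsplit.trans (add_le_add hnear hfar)) _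
    _ = g * ((c ^ 2 * majorantMass n * C₁ + C₂ * (2 ^ (n + 1) * majorantMass n)) * (T⁻¹ * D) +
          C₂ * I) := by ring
    _ ≤ g * ((c ^ 2 * majorantMass n * C₁ + C₂ * (2 ^ (n + 1) * majorantMass n) + C₂) * (T⁻¹ * D) +
          (c ^ 2 * majorantMass n * C₁ + C₂ * (2 ^ (n + 1) * majorantMass n) + C₂) * I) := by
        refine mul_le_mul_right (add_le_add (mul_le_mul_left le_self_add _)
          (mul_le_mul_left le_add_self _)) _
    _ = _ := by ring

/-! ### Integration over the scales -/

theorem measurable_poissonOsc {a : Euc n → Euc m} (ha : Measurable a) :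
    Measurable fun p : ℝ × Euc n => poissonOsc a p.1 p.2 := by
  unfold poissonOsc
  refine Measurable.lintegral_prod_right'
    (f := fun p : (ℝ × Euc n) × Euc n =>
      ENNReal.ofReal (poissonMajorant n p.1.1 (p.1.2 - p.2)) * sqOsc a p.2 p.1.2) ?_
  exact (ENNReal.measurable_ofReal.comp (measurable_poissonMajorant.comp
    (measurable_fst.fst.prodMk (measurable_fst.snd.sub measurable_snd)))).mul
    (measurable_sqOsc ha measurable_snd measurable_fst.snd)

theorem measurable_inv_mul_poissonOsc {a : Euc n → Euc m} (ha : Measurable a) :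
    Measurable fun p : ℝ × Euc n => (ENNReal.ofReal p.1)⁻¹ * poissonOsc a p.1 p.2 :=
  (ENNReal.measurable_ofReal.comp measurable_fst).inv.mul (measurable_poissonOsc ha)

theorem tailKernel_sub_comm (r : ℝ) (v w : Euc n) :
    tailKernel n r (v - w) = tailKernel n r (w - v) := by
  unfold tailKernel
  rw [← neg_sub w v, enorm_neg]

theorem lintegral_inv_mul_poissonOsc_le (hn : 1 ≤ n) {a : Euc n → Euc m} (ha : Measurable a)
    {r : ℝ} (hr : 0 < r) (y : Euc n) :
    ∫⁻ t in Ioo 0 r, (ENNReal.ofReal t)⁻¹ * poissonOsc a t y ≤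
      2 * ∫⁻ v, tailKernel n r (v - y) * sqOsc a v y := by
  have hm : Measurable fun p : ℝ × Euc n => (ENNReal.ofReal p.1)⁻¹ *
      (ENNReal.ofReal (poissonMajorant n p.1 (y - p.2)) * sqOsc a p.2 y) :=
    (ENNReal.measurable_ofReal.comp measurable_fst).inv.mul
      ((ENNReal.measurable_ofReal.comp (measurable_poissonMajorant.comp
        (measurable_fst.prodMk (measurable_const.sub measurable_snd)))).mul
      (measurable_sqOsc ha measurable_snd measurable_const))
  have hk : Measurable fun v => tailKernel n r (v - y) * sqOsc a v y :=
    ((measurable_tailKernel r).comp (measurable_id.sub measurable_const)).mul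
      (measurable_sqOsc ha measurable_id measurable_const)
  calc ∫⁻ t in Ioo 0 r, (ENNReal.ofReal t)⁻¹ * poissonOsc a t y
      = ∫⁻ t in Ioo 0 r, ∫⁻ v, (ENNReal.ofReal t)⁻¹ *
          (ENNReal.ofReal (poissonMajorant n t (y - v)) * sqOsc a v y) := by
        refine setLIntegral_congr_fun measurableSet_Ioo fun t ht => ?_
        have : (ENNReal.ofReal t)⁻¹ ≠ ∞ := by simpa using ht.1
        rw [lintegral_const_mul' _ _ this]
        rfl
    _ = ∫⁻ v, ∫⁻ t in Ioo 0 r, (ENNReal.ofReal t)⁻¹ *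
          (ENNReal.ofReal (poissonMajorant n t (y - v)) * sqOsc a v y) :=
        lintegral_lintegral_swap hm.aemeasurable
    _ ≤ ∫⁻ v, 2 * (tailKernel n r (v - y) * sqOsc a v y) := by
        refine lintegral_mono fun v => ?_
        have hs : sqOsc a v y ≠ ∞ := by unfold sqOsc; finiteness
        simp_rw [← mul_assoc]
        rw [lintegral_mul_const' _ _ hs, tailKernel_sub_comm]
        exact mul_le_mul_left (lintegral_poissonMajorant_div_le hn hr _) _
    _ = _ := lintegral_const_mul _ hk

/-- The Poisson oscillations at the scales `t < r ≤ ρ`, integrated over the ball `B_ρ(x)`. -/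
theorem lintegral_ball_inv_mul_poissonOsc_le (hn : 1 ≤ n) {a : Euc n → Euc m} (ha : Measurable a)
    {Q : ℝ≥0∞} (hQ : QBound a Q) (x : Euc n) {r ρ : ℝ} (hr : 0 < r) (hρ : r ≤ ρ) :
    ∫⁻ t in Ioo 0 r, ∫⁻ y in ball x ρ, (ENNReal.ofReal t)⁻¹ * poissonOsc a t y ≤
      2000 * 2 ^ (4 * n) * ENNReal.ofReal ρ ^ n * Q := by
  have hmk := measurable_tailKernel_mul_sqOsc ha ρ
  calc _ = ∫⁻ y in ball x ρ, ∫⁻ t in Ioo 0 r, (ENNReal.ofReal t)⁻¹ * poissonOsc a t y :=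
        lintegral_lintegral_swap (measurable_inv_mul_poissonOsc ha).aemeasurable
    _ ≤ ∫⁻ y in ball x ρ, 2 * ∫⁻ v, tailKernel n ρ (v - y) * sqOsc a v y := by
        refine lintegral_mono fun y => (lintegral_inv_mul_poissonOsc_le hn ha hr y).trans ?_
        refine mul_le_mul_right (lintegral_mono fun v => ?_) _
        exact mul_le_mul_left (tailKernel_mono hρ _) _
    _ = 2 * tailEnergy a x ρ := lintegral_const_mul _ hmk.lintegral_prod_right'
    _ ≤ 2 * (1000 * 2 ^ (4 * n) * ENNReal.ofReal ρ ^ n * Q) :=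
        mul_le_mul_right (tailEnergy_le ha hQ x (hr.trans_le hρ)) _
    _ = _ := by ring

/-- The kernel `|h|⁻⁽ⁿ⁺¹⁾` of the fractional energy, restricted to `|h| ≥ t`. -/
def farKernel (n : ℕ) (t : ℝ) (h : Euc n) : ℝ≥0∞ :=
  {h : Euc n | t ≤ ‖h‖}.indicator (fun h => (‖h‖ₑ ^ (n + 1))⁻¹) h

theorem measurable_farKernel : Measurable fun p : ℝ × Euc n => farKernel n p.1 p.2 := by
  have : (fun p : ℝ × Euc n => farKernel n p.1 p.2) =
      {p : ℝ × Euc n | p.1 ≤ ‖p.2‖}.indicator (fun p => (‖p.2‖ₑ ^ (n + 1))⁻¹) := by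
    ext p; simp [farKernel, indicator]
  rw [this]
  exact (measurable_snd.enorm.pow_const _).inv.indicator
    (measurableSet_le measurable_fst measurable_snd.norm)

theorem lintegral_farKernel_mul (t : ℝ) (f : Euc n → ℝ≥0∞) :
    ∫⁻ h in {h : Euc n | t ≤ ‖h‖}, (‖h‖ₑ ^ (n + 1))⁻¹ * f h = ∫⁻ h, farKernel n t h * f h := by
  rw [← lintegral_indicator (measurableSet_le measurable_const measurable_norm)]
  congr with h
  unfold farKernel
  by_cases hh : h ∈ {h : Euc n | t ≤ ‖h‖} <;> simp [hh]

theorem farKernel_le (t : ℝ) (h : Euc n) : farKernel n t h ≤ (‖h‖ₑ ^ (n + 1))⁻¹ :=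
  indicator_le_self _ _ _

theorem lintegral_farKernel_le {t : ℝ} (ht : 0 < t) :
    ∫⁻ h, farKernel n t h ≤ 2 ^ (n + 1) * majorantMass n * (ENNReal.ofReal t)⁻¹ := by
  have := lintegral_farKernel_mul (n := n) t 1
  simp only [Pi.one_apply, mul_one] at this
  rw [← this]
  exact lintegral_compl_ball_enorm_pow_inv_le ht

/-- The far kernel, integrated over the scales `t < min(r, |h|)`. -/
theorem lintegral_Ioo_farKernel_le {r : ℝ} (h : Euc n) :
    ∫⁻ t in Ioo 0 r, farKernel n t h ≤ tailKernel n r h := by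
  refine le_min ?_ ?_
  · rcases eq_or_ne h 0 with rfl | h0
    · refine le_of_eq_of_le (setLIntegral_congr_fun measurableSet_Ioo (g := 0) fun t ht => ?_)
        (by simp)
      simp [farKernel, ht.1]
    have he0 : ‖h‖ₑ ≠ 0 := by simpa using h0
    calc ∫⁻ t in Ioo 0 r, farKernel n t h ≤ ∫⁻ t in Ioi 0, farKernel n t h :=
          lintegral_mono_set fun t ht => ht.1
      _ = ∫⁻ t in Ioi 0, (Iic ‖h‖).indicator (fun _ => (‖h‖ₑ ^ (n + 1))⁻¹) t := by
          refine lintegral_congr fun t => ?_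
          simp only [farKernel, indicator, mem_ofPred_eq, mem_Iic]
      _ = (‖h‖ₑ ^ (n + 1))⁻¹ * ‖h‖ₑ := by
          rw [setLIntegral_indicator measurableSet_Iic, inter_comm, Ioi_inter_Iic,
            setLIntegral_const, Real.volume_Ioc, sub_zero, ofReal_norm]
      _ ≤ _ := by
          rw [pow_succ, ENNReal.mul_inv (by simp) (by simp), mul_assoc,
            ENNReal.inv_mul_cancel he0 (by finiteness), mul_one]
  · refine (lintegral_mono fun t => farKernel_le t h).trans ?_
    rw [setLIntegral_const, Real.volume_Ioo, sub_zero, mul_comm]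

/-- The contribution of the increments of `a` itself. -/
theorem lintegral_farKernel_sqOsc_le {a : Euc n → Euc m} (ha : Measurable a)
    (x : Euc n) (r : ℝ) :
    ∫⁻ t in Ioo 0 r, ∫⁻ y in ball x r, ∫⁻ h, farKernel n t h * sqOsc a (y + h) y ≤
      tailEnergy a x r := by
  have hm1 : Measurable fun p : (ℝ × Euc n) × Euc n =>
      farKernel n p.1.1 p.2 * sqOsc a (p.1.2 + p.2) p.1.2 :=
    (measurable_farKernel.comp (measurable_fst.fst.prodMk measurable_snd)).mul
      (measurable_sqOsc ha (measurable_fst.snd.add measurable_snd) measurable_fst.snd)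
  calc _ = ∫⁻ y in ball x r, ∫⁻ t in Ioo 0 r, ∫⁻ h, farKernel n t h * sqOsc a (y + h) y :=
        lintegral_lintegral_swap hm1.lintegral_prod_right'.aemeasurable
    _ ≤ ∫⁻ y in ball x r, ∫⁻ v, tailKernel n r (v - y) * sqOsc a v y := by
        refine lintegral_mono fun y => ?_
        have hm2 : Measurable fun p : ℝ × Euc n => farKernel n p.1 p.2 * sqOsc a (y + p.2) y :=
          measurable_farKernel.mul
            (measurable_sqOsc ha (measurable_const.add measurable_snd) measurable_const)
        calc _ = ∫⁻ h, ∫⁻ t in Ioo 0 r, farKernel n t h * sqOsc a (y + h) y :=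
              lintegral_lintegral_swap hm2.aemeasurable
          _ ≤ ∫⁻ h, tailKernel n r (y + h - y) * sqOsc a (y + h) y := by
              refine lintegral_mono fun h => ?_
              rw [lintegral_mul_const' _ _ (by unfold sqOsc; finiteness), add_sub_cancel_left]
              exact mul_le_mul_left (lintegral_Ioo_farKernel_le h) _
          _ = _ := lintegral_add_left_eq_self (fun v => tailKernel n r (v - y) * sqOsc a v y) y
    _ = _ := rfl

/-- The far kernel seen from the `k`-th dyadic shell. The factor `r⁻¹` is weakened to `t⁻¹`, the weight
under which the Poisson oscillations are integrated over the scales. -/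
theorem lintegral_ball_farKernel_le_of_shell {x z : Euc n} {r t : ℝ} (ht : t ∈ Ioo 0 r) {k : ℕ}
    (hz : z ∈ dyadicShell x r k) :
    ∫⁻ y in ball x r, farKernel n t (z - y) ≤
      volume (ball (0 : Euc n) 1) * ((2 ^ k) ^ (n + 1))⁻¹ * (ENNReal.ofReal t)⁻¹ := by
  have hr : 0 < r := ht.1.trans ht.2
  set R := ENNReal.ofReal r
  have hR0 : R ≠ 0 := by simpa [R] using hr
  have hRi : R ≠ ∞ := by finiteness
  calc _ ≤ ∫⁻ y in ball x r, ((2 ^ k * R) ^ (n + 1))⁻¹ := by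
        refine setLIntegral_mono' measurableSet_ball fun y hy => (farKernel_le _ _).trans ?_
        exact ENNReal.inv_le_inv.2 (pow_le_pow_left' (enorm_ge_of_mem_dyadicShell hr hy hz) _)
    _ = volume (ball (0 : Euc n) 1) * ((2 ^ k) ^ (n + 1))⁻¹ * ((R ^ n)⁻¹ * R ^ n) * R⁻¹ := by
        rw [setLIntegral_const, volume_ball_eq x hr, mul_pow,
          ENNReal.mul_inv (Or.inl (by positivity)) (Or.inl (by finiteness)), pow_succ R,
          ENNReal.mul_inv (Or.inl (by positivity)) (Or.inl (by finiteness))]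
        ring
    _ ≤ _ := by
        rw [ENNReal.inv_mul_cancel (by positivity) (by finiteness), mul_one]
        refine mul_le_mul_right (ENNReal.inv_le_inv.2 ?_) _
        exact ENNReal.ofReal_le_ofReal ht.2.le

/-- The contribution of the Poisson oscillations at the displaced points `y + h`. -/
theorem exists_lintegral_farKernel_poissonOsc_le (hn : 1 ≤ n) : ∃ C : ℝ≥0∞, C ≠ ∞ ∧
    ∀ {m : ℕ} {a : Euc n → Euc m}, Measurable a → ∀ {Q : ℝ≥0∞}, QBound a Q →
    ∀ (x : Euc n) {r : ℝ}, 0 < r →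
    ∫⁻ t in Ioo 0 r, ∫⁻ y in ball x r, ∫⁻ h, farKernel n t h * poissonOsc a t (y + h) ≤
      C * ENNReal.ofReal r ^ n * Q := by
  set C₁ := 2 ^ (n + 1) * majorantMass n
  have hC₁t : C₁ ≠ ∞ := by have := majorantMass_ne_top (n := n); finiteness
  set V := volume (ball (0 : Euc n) 1)
  have hV : V ≠ ∞ := measure_ball_lt_top.ne
  refine ⟨C₁ * (2000 * 2 ^ (4 * n) * 2 ^ n) + V * (2000 * 2 ^ (4 * n) * 4 ^ n) * 2, by finiteness,
    fun {m a} ha {Q} hQ x {r} hr => ?_⟩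
  set R := ENNReal.ofReal r
  have hRk : ∀ k : ℕ, ENNReal.ofReal (2 ^ k * r) = 2 ^ k * R := fun k => by
    rw [ENNReal.ofReal_mul (by positivity), ENNReal.ofReal_pow zero_le_two, ENNReal.ofReal_ofNat]
  have hmD : ∀ t, Measurable fun z => poissonOsc a t z := fun t =>
    (measurable_poissonOsc ha).comp measurable_prodMk_left
  have hmJ : ∀ ρ : ℝ, Measurable fun t =>
      ∫⁻ z in ball x ρ, (ENNReal.ofReal t)⁻¹ * poissonOsc a t z := fun ρ =>
    (measurable_inv_mul_poissonOsc ha).lintegral_prod_right'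
  have hVk : ∀ k : ℕ, V * ((2 ^ k) ^ (n + 1))⁻¹ ≠ ∞ := fun k => by finiteness
  have pointwise : ∀ t ∈ Ioo 0 r,
      ∫⁻ y in ball x r, ∫⁻ h, farKernel n t h * poissonOsc a t (y + h) ≤
      C₁ * (∫⁻ z in ball x (2 * r), (ENNReal.ofReal t)⁻¹ * poissonOsc a t z) +
      ∑' k : ℕ, V * ((2 ^ k) ^ (n + 1))⁻¹ *
        ∫⁻ z in ball x (2 ^ (k + 2) * r), (ENNReal.ofReal t)⁻¹ * poissonOsc a t z := by
    intro t ht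
    have hmF : Measurable fun p : Euc n × Euc n => farKernel n t (p.2 - p.1) * poissonOsc a t p.2 :=
      (measurable_farKernel.comp (measurable_const.prodMk (measurable_snd.sub measurable_fst))).mul
        ((hmD t).comp measurable_snd)
    have hmF' : ∀ z, Measurable fun y => farKernel n t (z - y) := fun z =>
      measurable_farKernel.comp (measurable_const.prodMk (measurable_const.sub measurable_id))
    calc _ = ∫⁻ y in ball x r, ∫⁻ z, farKernel n t (z - y) * poissonOsc a t z := by
          refine lintegral_congr fun y => ?_
          refine Eq.trans ?_ (lintegral_add_left_eq_self
            (fun z => farKernel n t (z - y) * poissonOsc a t z) y)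
          simp only [add_sub_cancel_left]
      _ = ∫⁻ z, ∫⁻ y in ball x r, farKernel n t (z - y) * poissonOsc a t z :=
          lintegral_lintegral_swap hmF.aemeasurable
      _ = ∫⁻ z, (∫⁻ y in ball x r, farKernel n t (z - y)) * poissonOsc a t z :=
          lintegral_congr fun z => lintegral_mul_const _ (hmF' z)
      _ ≤ _ := lintegral_le_dyadicShell x hr _
      _ ≤ _ := by
          refine add_le_add ?_ (ENNReal.tsum_le_tsum fun k => ?_)
          · rw [← lintegral_const_mul' _ _ hC₁t]
            refine lintegral_mono fun z => ?_
            rw [← mul_assoc]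
            refine mul_le_mul_left ?_ _
            calc _ ≤ ∫⁻ y, farKernel n t (z - y) := setLIntegral_le_lintegral _ _
              _ = ∫⁻ y, farKernel n t y := lintegral_sub_left_eq_self _ z
              _ ≤ _ := lintegral_farKernel_le ht.1
          · rw [← lintegral_const_mul' _ _ (hVk k)]
            refine (setLIntegral_mono' (measurableSet_dyadicShell x r k) fun z hz => ?_).trans
              (lintegral_mono_set sdiff_subset)
            rw [← mul_assoc]
            exact mul_le_mul_left (lintegral_ball_farKernel_le_of_shell ht hz) _
  calc _ ≤ ∫⁻ t in Ioo 0 r,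
        (C₁ * (∫⁻ z in ball x (2 * r), (ENNReal.ofReal t)⁻¹ * poissonOsc a t z) +
        ∑' k : ℕ, V * ((2 ^ k) ^ (n + 1))⁻¹ *
          ∫⁻ z in ball x (2 ^ (k + 2) * r), (ENNReal.ofReal t)⁻¹ * poissonOsc a t z) :=
        setLIntegral_mono' measurableSet_Ioo pointwise
    _ = C₁ * (∫⁻ t in Ioo 0 r, ∫⁻ z in ball x (2 * r), (ENNReal.ofReal t)⁻¹ * poissonOsc a t z) +
        ∑' k : ℕ, V * ((2 ^ k) ^ (n + 1))⁻¹ * ∫⁻ t in Ioo 0 r,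
          ∫⁻ z in ball x (2 ^ (k + 2) * r), (ENNReal.ofReal t)⁻¹ * poissonOsc a t z := by
        rw [lintegral_add_left ((hmJ _).const_mul _), lintegral_const_mul' _ _ hC₁t,
          lintegral_tsum fun k => ((hmJ _).const_mul _).aemeasurable]
        congr 1
        exact tsum_congr fun k => lintegral_const_mul' _ _ (hVk k)
    _ ≤ C₁ * (2000 * 2 ^ (4 * n) * (2 * R) ^ n * Q) +
        ∑' k : ℕ, V * (2000 * 2 ^ (4 * n) * 4 ^ n) * R ^ n * Q * 2⁻¹ ^ k := by
        refine add_le_add (mul_le_mul_right ?_ _) (ENNReal.tsum_le_tsum fun k => ?_)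
        · have := lintegral_ball_inv_mul_poissonOsc_le hn ha hQ x hr (ρ := 2 * r) (by linarith)
          rwa [ENNReal.ofReal_mul zero_le_two, ENNReal.ofReal_ofNat] at this
        · have h1 : r ≤ 2 ^ (k + 2) * r :=
            le_mul_of_one_le_left hr.le (one_le_pow₀ one_le_two)
          have := lintegral_ball_inv_mul_poissonOsc_le hn ha hQ x hr h1
          rw [hRk] at this
          refine (mul_le_mul_right this _).trans (le_of_eq ?_)
          have e1 : ((2 : ℝ≥0∞) ^ k) ^ n * ((2 ^ k) ^ (n + 1))⁻¹ = 2⁻¹ ^ k := by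
            rw [pow_succ ((2 : ℝ≥0∞) ^ k), ENNReal.mul_inv (Or.inl (by positivity))
              (Or.inl (by finiteness)), ← mul_assoc, ENNReal.mul_inv_cancel (by positivity)
              (by finiteness), one_mul, ENNReal.inv_pow]
          rw [← e1]
          ring
    _ = _ := by
        rw [ENNReal.tsum_mul_left, ENNReal.tsum_geometric, ENNReal.one_sub_inv_two, inv_inv]
        ring

/-- The square of the estimate `[a]_{𝒜_∞} ≤ c [a]_{Q_0}`, before taking suprema. -/
theorem exists_lintegral_energyDensity_le (hn : 1 ≤ n) : ∃ C : ℝ≥0∞, C ≠ ∞ ∧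
    ∀ {m : ℕ} {a : Euc n → Euc m}, Measurable a → ∀ {Q : ℝ≥0∞}, QBound a Q → Q ≠ ∞ →
    ∀ (x : Euc n) {r : ℝ}, 0 < r →
    ∫⁻ t in Ioo 0 r, ∫⁻ y in ball x r, energyDensity (poissonExt a t) y ≤
      C * ENNReal.ofReal r ^ n * Q := by
  obtain ⟨C₁, hC₁, h₁⟩ := exists_energyDensity_poissonExt_le hn
  obtain ⟨C₂, hC₂, h₂⟩ := exists_lintegral_farKernel_poissonOsc_le hn
  refine ⟨C₁ * (2000 * 2 ^ (4 * n) + (C₂ + 1000 * 2 ^ (4 * n))), by finiteness,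
    fun {m a} ha {Q} hQ hQt x {r} hr => ?_⟩
  set R := ENNReal.ofReal r
  have q1 : Measurable fun p : (ℝ × Euc n) × Euc n => ((p.1.1, p.1.2 + p.2) : ℝ × Euc n) :=
    measurable_fst.fst.prodMk (measurable_fst.snd.add measurable_snd)
  have q2 : Measurable fun p : (ℝ × Euc n) × Euc n => farKernel n p.1.1 p.2 :=
    measurable_farKernel.comp (measurable_fst.fst.prodMk measurable_snd)
  have q3 : Measurable fun p : (ℝ × Euc n) × Euc n => poissonOsc a p.1.1 (p.1.2 + p.2) := by
    simpa only [Function.comp_def] using (measurable_poissonOsc ha).comp q1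
  have hm1 : Measurable fun p : (ℝ × Euc n) × Euc n =>
      farKernel n p.1.1 p.2 * poissonOsc a p.1.1 (p.1.2 + p.2) := q2.mul q3
  have m1 : Measurable fun p : ℝ × Euc n =>
      ∫⁻ h, farKernel n p.1 h * poissonOsc a p.1 (p.2 + h) := by
    simpa only using hm1.lintegral_prod_right'
  have m0 := measurable_inv_mul_poissonOsc ha
  have m0' : ∀ t, Measurable fun y => (ENNReal.ofReal t)⁻¹ * poissonOsc a t y := fun t => by
    simpa only [Function.comp_def] using m0.comp (measurable_prodMk_left (x := t))
  have m1' : ∀ t, Measurable fun y => ∫⁻ h, farKernel n t h * poissonOsc a t (y + h) := fun t => by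
    simpa only [Function.comp_def] using m1.comp (measurable_prodMk_left (x := t))
  have m2' : ∀ t y, Measurable fun h => farKernel n t h * poissonOsc a t (y + h) := fun t y => by
    simpa only [Function.comp_def] using hm1.comp (measurable_prodMk_left (x := (t, y)))
  calc _ ≤ ∫⁻ t in Ioo 0 r, ∫⁻ y in ball x r, C₁ * ((ENNReal.ofReal t)⁻¹ * poissonOsc a t y +
          ((∫⁻ h, farKernel n t h * poissonOsc a t (y + h)) +
            ∫⁻ h, farKernel n t h * sqOsc a (y + h) y)) := by
        refine setLIntegral_mono' measurableSet_Ioo fun t ht => lintegral_mono fun y => ?_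
        refine (h₁ ha ht.1 (integrable_poissonKernel_smul_of_QBound ha hQ hQt ht.1) y).trans ?_
        rw [lintegral_farKernel_mul, ← lintegral_add_left (m2' t y)]
        simp only [mul_add, le_refl]
    _ = C₁ * ((∫⁻ t in Ioo 0 r, ∫⁻ y in ball x r, (ENNReal.ofReal t)⁻¹ * poissonOsc a t y) +
          ((∫⁻ t in Ioo 0 r, ∫⁻ y in ball x r, ∫⁻ h, farKernel n t h * poissonOsc a t (y + h)) +
            ∫⁻ t in Ioo 0 r, ∫⁻ y in ball x r, ∫⁻ h, farKernel n t h * sqOsc a (y + h) y)) := by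
        rw [← lintegral_add_left m1.lintegral_prod_right',
          ← lintegral_add_left m0.lintegral_prod_right', ← lintegral_const_mul' _ _ hC₁]
        refine lintegral_congr fun t => ?_
        rw [lintegral_const_mul' _ _ hC₁, lintegral_add_left (m0' t),
          lintegral_add_left (m1' t)]
    _ ≤ C₁ * (2000 * 2 ^ (4 * n) * R ^ n * Q + (C₂ * R ^ n * Q + 1000 * 2 ^ (4 * n) * R ^ n * Q)) := by
        refine mul_le_mul_right (add_le_add ?_ (add_le_add ?_ ?_)) _
        · exact lintegral_ball_inv_mul_poissonOsc_le hn ha hQ x hr le_rfl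
        · exact h₂ ha hQ x hr
        · exact (lintegral_farKernel_sqOsc_le ha x r).trans (tailEnergy_le ha hQ x hr)
    _ = _ := by ring

/-! ### The seminorm estimate -/

theorem QBound.congr_ae {a b : Euc n → Euc m} (hab : a =ᵐ[volume] b) {Q : ℝ≥0∞}
    (hQ : QBound a Q) : QBound b Q := by
  intro x r hr
  refine le_of_eq_of_le ?_ (hQ x r hr)
  have hab' := ae_restrict_of_ae (s := ball x r) hab
  refine lintegral_congr_ae ?_
  filter_upwards [hab'] with z hz
  refine lintegral_congr_ae ?_
  filter_upwards [hab'] with y hy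
  rw [sqOsc, sqOsc, hz, hy]

theorem seminormQ_zero_eq (a : Euc n → Euc m) :
    seminormQ 0 a = (⨆ (x : Euc n) (r : ℝ) (_ : 0 < r),
      (∫⁻ z in ball x r, ∫⁻ y in ball x r, sqOsc a y z / ‖y - z‖ₑ ^ n) /
        ENNReal.ofReal r ^ n) ^ (1 / 2 : ℝ) := by
  simp only [seminormQ, sqOsc, mul_zero, add_zero, sub_zero, ENNReal.rpow_natCast]

theorem rpow_half_sq (x : ℝ≥0∞) : (x ^ (1 / 2 : ℝ)) ^ 2 = x := by
  rw [← ENNReal.rpow_natCast, ← ENNReal.rpow_mul]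
  norm_num

theorem qBound_seminormQ (a : Euc n → Euc m) : QBound a (seminormQ 0 a ^ 2) := by
  intro x r hr
  have hR : ENNReal.ofReal r ≠ 0 := by simpa using hr
  rw [seminormQ_zero_eq, rpow_half_sq, mul_comm, ← ENNReal.div_le_iff (by positivity) (by finiteness)]
  exact le_iSup_of_le x (le_iSup_of_le r (le_iSup_of_le hr le_rfl))

theorem QBound.seminormQ_le {a : Euc n → Euc m} {Q : ℝ≥0∞} (hQ : QBound a Q) :
    seminormQ 0 a ≤ Q ^ (1 / 2 : ℝ) := by
  rw [seminormQ_zero_eq]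
  refine ENNReal.rpow_le_rpow (iSup_le fun x => iSup_le fun r => iSup_le fun hr => ?_) (by norm_num)
  have hR : ENNReal.ofReal r ≠ 0 := by simpa using hr
  rw [ENNReal.div_le_iff (by positivity) (by finiteness), mul_comm]
  exact hQ x r hr

theorem poissonExt_congr_ae {a b : Euc n → Euc m} (hab : a =ᵐ[volume] b) (t : ℝ) :
    poissonExt a t = poissonExt b t := by
  ext1 x
  refine integral_congr_ae ?_
  filter_upwards [hab] with y hy
  rw [hy]

theorem integrable_poissonKernel_smul {a : Euc n → Euc m} (ha : a ∈ spaceQ n m 0) {t : ℝ}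
    (ht : 0 < t) (x : Euc n) : Integrable fun y => poissonKernel n t (x - y) • a y := by
  obtain ⟨hm, hQ⟩ := ha
  have hb := hm.ae_eq_mk
  refine (integrable_poissonKernel_smul_of_QBound hm.stronglyMeasurable_mk.measurable
    ((qBound_seminormQ a).congr_ae hb) (by finiteness) ht x).congr ?_
  filter_upwards [hb] with y hy
  rw [hy]

/-- The embedding `[a]_{𝒜_∞} ≤ c [a]_{Q_0}`. -/
theorem exists_seminormA_le (hn : 1 ≤ n) : ∃ c : ℝ, 0 < c ∧ ∀ (m : ℕ), ∀ a ∈ spaceQ n m 0,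
    seminormA ∞ a ≤ ENNReal.ofReal c * seminormQ 0 a := by
  obtain ⟨C, hC, h⟩ := exists_lintegral_energyDensity_le hn
  set V := volume (ball (0 : Euc n) 1)
  have hV0 : V ≠ 0 := (measure_ball_pos _ _ one_pos).ne'
  have hVi : V ≠ ∞ := measure_ball_lt_top.ne
  have hK : (C / V) ^ (1 / 2 : ℝ) ≠ ∞ := by finiteness
  -- adding `1` makes the constant positive
  refine ⟨((C / V) ^ (1 / 2 : ℝ)).toReal + 1, by positivity, fun m a ha => ?_⟩
  obtain ⟨hm, hQ⟩ := ha
  have hb := hm.ae_eq_mk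
  have hbm := hm.stronglyMeasurable_mk.measurable
  have hbQ := (qBound_seminormQ a).congr_ae hb
  have hQt : seminormQ 0 a ^ 2 ≠ ∞ := by finiteness
  have key : ∀ (x : Euc n) {r : ℝ}, 0 < r →
      ∫⁻ t in Ioo 0 r, ⨍⁻ y in ball x r, energyDensity (poissonExt a t) y ∂volume ≤
        C / V * seminormQ 0 a ^ 2 := by
    intro x r hr
    have hR : ENNReal.ofReal r ≠ 0 := by simpa using hr
    have hB : volume (ball x r) ≠ 0 := (measure_ball_pos _ _ hr).ne'
    simp_rw [poissonExt_congr_ae hb, setLAverage_eq, div_eq_mul_inv]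
    rw [lintegral_mul_const' _ _ (by finiteness)]
    refine (mul_le_mul_left (h hbm hbQ hQt x hr) _).trans (le_of_eq ?_)
    rw [volume_ball_eq x hr, ENNReal.mul_inv (Or.inl (by positivity)) (Or.inl (by finiteness))]
    calc _ = C * V⁻¹ * seminormQ 0 a ^ 2 *
          (ENNReal.ofReal r ^ n * (ENNReal.ofReal r ^ n)⁻¹) := by ring
      _ = _ := by rw [ENNReal.mul_inv_cancel (by positivity) (by finiteness), mul_one]
  calc seminormA ∞ a ≤ (C / V * seminormQ 0 a ^ 2) ^ (1 / 2 : ℝ) := by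
        refine ENNReal.rpow_le_rpow (iSup_le fun r => iSup_le fun hr => iSup_le fun _ =>
          iSup_le fun x => key x hr) (by norm_num)
    _ = (C / V) ^ (1 / 2 : ℝ) * seminormQ 0 a := by
        rw [ENNReal.mul_rpow_of_nonneg _ _ (by norm_num), ← ENNReal.rpow_natCast,
          ← ENNReal.rpow_mul]
        norm_num
    _ ≤ _ := by
        gcongr
        rw [ENNReal.ofReal_add (by positivity) zero_le_one, ENNReal.ofReal_toReal hK]
        exact le_self_add

/-! ### Littlewood-Paley kernels -/

/-- A real Schwartz function, regarded as a complex one. -/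
def complexify (f : 𝓢(Euc n, ℝ)) : 𝓢(Euc n, ℂ) :=
  SchwartzMap.postcompCLM (𝕜 := ℝ) Complex.ofRealCLM f

@[simp]
theorem complexify_apply (f : 𝓢(Euc n, ℝ)) (x : Euc n) : complexify f x = (f x : ℂ) := rfl

/-- The dilated kernel `2^(jn) χ(2^j x)`. -/
def lowPass (χ : 𝓢(Euc n, ℝ)) (j : ℤ) : 𝓢(Euc n, ℝ) :=
  ((2 : ℝ) ^ j) ^ n • SchwartzMap.compCLMOfContinuousLinearEquiv ℝ
    (ContinuousLinearEquiv.smulLeft (Units.mk0 ((2 : ℝ) ^ j) (by positivity)) :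
      Euc n ≃L[ℝ] Euc n) χ

theorem lowPass_apply (χ : 𝓢(Euc n, ℝ)) (j : ℤ) (x : Euc n) :
    lowPass χ j x = ((2 : ℝ) ^ j) ^ n * χ ((2 : ℝ) ^ j • x) := rfl

/-- The kernel `ψ_j` of the `j`-th dyadic block, as a Schwartz function. -/
def bandPass (χ : 𝓢(Euc n, ℝ)) (j : ℤ) : 𝓢(Euc n, ℝ) := lowPass χ j - lowPass χ (j - 1)

theorem integral_smul_eq {E : Type*} [NormedAddCommGroup E] [NormedSpace ℝ E] {s : ℝ} (hs : 0 < s)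
    (f : Euc n → E) : s ^ n • ∫ x, f (s • x) = ∫ x, f x := by
  rw [Measure.integral_comp_smul, finrank_euclideanSpace, Fintype.card_fin,
    abs_of_pos (by positivity), smul_smul, mul_inv_cancel₀ (by positivity), one_smul]

theorem fourier_complexify_lowPass (χ : 𝓢(Euc n, ℝ)) (j : ℤ) (ξ : Euc n) :
    𝓕 (complexify (lowPass χ j)) ξ = 𝓕 (fun x : Euc n => (χ x : ℂ)) (((2 : ℝ) ^ j)⁻¹ • ξ) := by
  have hs : (0 : ℝ) < 2 ^ j := by positivity
  rw [SchwartzMap.fourier_coe, Real.fourier_eq, Real.fourier_eq,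
    ← integral_smul_eq hs fun x => Real.fourierChar (-inner ℝ x (((2 : ℝ) ^ j)⁻¹ • ξ)) • (χ x : ℂ),
    ← integral_smul]
  congr with v
  rw [complexify_apply, lowPass_apply, inner_smul_left, inner_smul_right, Complex.ofReal_mul,
    conj_trivial, mul_inv_cancel_left₀ (by simpa using hs.ne')]
  simp only [Circle.smul_def, smul_eq_mul, Complex.real_smul]
  push_cast
  ring

theorem complexify_sub (f g : 𝓢(Euc n, ℝ)) : complexify (f - g) = complexify f - complexify g := by
  ext x; simp

theorem fourier_complexify_bandPass (χ : 𝓢(Euc n, ℝ)) (j : ℤ) (ξ : Euc n) :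
    𝓕 (complexify (bandPass χ j)) ξ = 𝓕 (fun x : Euc n => (χ x : ℂ)) (((2 : ℝ) ^ j)⁻¹ • ξ) -
      𝓕 (fun x : Euc n => (χ x : ℂ)) (((2 : ℝ) ^ (j - 1))⁻¹ • ξ) := by
  rw [bandPass, complexify_sub, sub_eq_add_neg, FourierTransform.fourier_add,
    FourierTransform.fourier_neg, ← fourier_complexify_lowPass, ← fourier_complexify_lowPass]
  rfl

theorem norm_zpow_inv_smul (j : ℤ) (ξ : Euc n) :
    ‖((2 : ℝ) ^ j)⁻¹ • ξ‖ = ((2 : ℝ) ^ j)⁻¹ * ‖ξ‖ := by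
  rw [norm_smul, norm_inv, Real.norm_of_nonneg (by positivity)]

theorem fourier_complexify_bandPass_of_le {χ : 𝓢(Euc n, ℝ)} (hχ : IsLowPass χ) (j : ℤ) {ξ : Euc n}
    (hξ : (2 : ℝ) ^ (j + 1) ≤ ‖ξ‖) : 𝓕 (complexify (bandPass χ j)) ξ = 0 := by
  have h0 : (0 : ℝ) < 2 ^ (j - 1) := by positivity
  have e1 : (2 : ℝ) ^ j = 2 ^ (j - 1) * 2 := by rw [← zpow_add_one₀ two_ne_zero]; simp
  have e2 : (2 : ℝ) ^ (j + 1) = 2 ^ (j - 1) * 4 := by rw [zpow_add_one₀ two_ne_zero, e1]; ring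
  rw [e2] at hξ
  rw [fourier_complexify_bandPass, hχ.2, hχ.2, sub_zero]
  · rw [norm_zpow_inv_smul, le_inv_mul_iff₀ h0]; linarith
  · rw [norm_zpow_inv_smul, e1, le_inv_mul_iff₀ (by positivity)]; linarith

theorem fourier_complexify_bandPass_of_le' {χ : 𝓢(Euc n, ℝ)} (hχ : IsLowPass χ) (j : ℤ) {ξ : Euc n}
    (hξ : ‖ξ‖ ≤ (2 : ℝ) ^ (j - 1)) : 𝓕 (complexify (bandPass χ j)) ξ = 0 := by
  have h0 : (0 : ℝ) < 2 ^ (j - 1) := by positivity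
  have e1 : (2 : ℝ) ^ j = 2 ^ (j - 1) * 2 := by rw [← zpow_add_one₀ two_ne_zero]; simp
  rw [fourier_complexify_bandPass, hχ.1, hχ.1, sub_self]
  · rw [norm_zpow_inv_smul, inv_mul_le_iff₀ h0]; linarith
  · rw [norm_zpow_inv_smul, e1, inv_mul_le_iff₀ (by positivity)]; linarith

/-- The low-pass kernel at the next scale reproduces the dyadic block. -/
theorem integral_lowPass_mul_bandPass {χ : 𝓢(Euc n, ℝ)} (hχ : IsLowPass χ) (j : ℤ) (x : Euc n) :
    ∫ y, lowPass χ (j + 1) y * bandPass χ j (x - y) = bandPass χ j x := by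
  set F := complexify (lowPass χ (j + 1))
  set G := complexify (bandPass χ j)
  have h1 : SchwartzMap.convolution (ContinuousLinearMap.mul ℂ ℂ) F G = G := by
    have h2 : 𝓕 (SchwartzMap.convolution (ContinuousLinearMap.mul ℂ ℂ) F G) = 𝓕 G := by
      ext ξ
      rw [SchwartzMap.fourier_convolution, SchwartzMap.pairing_apply_apply,
        ContinuousLinearMap.mul_apply']
      rcases le_total ((2 : ℝ) ^ (j + 1)) ‖ξ‖ with h | h
      · rw [fourier_complexify_bandPass_of_le hχ j h, mul_zero]
      · rw [fourier_complexify_lowPass, hχ.1, one_mul]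
        rw [norm_zpow_inv_smul, inv_mul_le_iff₀ (by positivity)]
        linarith
    have h3 := congrArg (fun H : 𝓢(Euc n, ℂ) => (𝓕⁻ H : 𝓢(Euc n, ℂ))) h2
    simpa only [FourierTransform.fourierInv_fourier_eq] using h3
  have h3 := SchwartzMap.convolution_apply (ContinuousLinearMap.mul ℂ ℂ) F G x
  rw [h1, convolution_def] at h3
  apply Complex.ofReal_injective
  rw [← integral_complex_ofReal]
  simp only [Complex.ofReal_mul]
  exact h3.symm

theorem integral_lowPass {χ : 𝓢(Euc n, ℝ)} (hχ : IsLowPass χ) (j : ℤ) :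
    ∫ y, lowPass χ j y = 1 := by
  have h := hχ.1 0 (by simp)
  rw [Real.fourier_eq] at h
  simp only [inner_zero_right, neg_zero, AddChar.map_zero_eq_one, one_smul] at h
  rw [integral_complex_ofReal] at h
  have h2 : ∫ y, χ y = 1 := by exact_mod_cast h
  rw [← h2, ← integral_smul_eq (by positivity : (0 : ℝ) < 2 ^ j) fun y => χ y, smul_eq_mul,
    ← integral_const_mul]
  rfl

/-- Low-frequency cutoffs exist. -/
theorem exists_isLowPass (n : ℕ) : ∃ χ : 𝓢(Euc n, ℝ), IsLowPass χ := by
  let b : ContDiffBump (0 : Euc n) := ⟨1, 2, one_pos, one_lt_two⟩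
  have hb : HasCompactSupport fun ξ : Euc n => (b ξ : ℂ) :=
    b.hasCompactSupport.comp_left (g := ((↑) : ℝ → ℂ)) Complex.ofReal_zero
  have hb' : ContDiff ℝ ((⊤ : ℕ∞) : WithTop ℕ∞) fun ξ : Euc n => (b ξ : ℂ) :=
    Complex.ofRealCLM.contDiff.comp b.contDiff
  let B : 𝓢(Euc n, ℂ) := hb.toSchwartzMap hb'
  have hB : ∀ ξ, B ξ = (b ξ : ℂ) := fun ξ => rfl
  let f : 𝓢(Euc n, ℂ) := 𝓕⁻ B
  let χ : 𝓢(Euc n, ℝ) := SchwartzMap.postcompCLM (𝕜 := ℝ) Complex.reCLM f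
  -- `f` is real-valued because the bump function is even and real
  have hreal : ∀ x, (starRingEnd ℂ) (f x) = f x := fun x => by
    have e : f x = ∫ v, (Real.fourierChar (inner ℝ v x) : ℂ) * (b v : ℂ) := by
      change (𝓕⁻ B) x = _
      rw [SchwartzMap.fourierInv_coe, Real.fourierInv_eq]
      rfl
    rw [e, ← integral_conj, ← integral_neg_eq_self]
    refine integral_congr_ae (Filter.Eventually.of_forall fun v => ?_)
    simp only [map_mul, Complex.conj_ofReal, inner_neg_left, b.neg, AddChar.map_neg_eq_inv,
      Circle.coe_inv_eq_conj, Complex.conj_conj]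
  have hχ : ∀ x, (χ x : ℂ) = f x := fun x => by
    change ((f x).re : ℂ) = f x
    exact Complex.conj_eq_iff_re.1 (hreal x)
  have hF : 𝓕 (fun x : Euc n => (χ x : ℂ)) = B := by
    simp_rw [hχ]
    change 𝓕 (f : Euc n → ℂ) = _
    rw [← SchwartzMap.fourier_coe]
    change ((𝓕 (𝓕⁻ B) : 𝓢(Euc n, ℂ)) : Euc n → ℂ) = _
    rw [FourierTransform.fourier_fourierInv_eq]
  refine ⟨χ, fun ξ hξ => ?_, fun ξ hξ => ?_⟩
  · rw [hF, hB, b.one_of_mem_closedBall (by simpa using hξ), Complex.ofReal_one]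
  · rw [hF, hB, b.zero_of_le_dist (by simpa using hξ), Complex.ofReal_zero]

/-! ### Convolution inequalities and the Besov embedding -/

/-- The convolution `k * f` of a scalar kernel with a vector-valued function. -/
def kernelConv (k : Euc n → ℝ) (f : Euc n → Euc m) (x : Euc n) : Euc m :=
  ∫ y, k (x - y) • f y

theorem dyadicBlock_eq_kernelConv (χ : 𝓢(Euc n, ℝ)) (j : ℤ) (a : Euc n → Euc m) :
    dyadicBlock χ j a = kernelConv (bandPass χ j) a := rfl

theorem exists_ae_norm_le {a : Euc n → Euc m} (ha : a ∈ spaceLinf n m) :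
    ∃ A : ℝ, 0 ≤ A ∧ ∀ᵐ y, ‖a y‖ ≤ A := by
  have h : eLpNormEssSup a volume ≠ ∞ := by
    rw [← eLpNorm_exponent_top]; exact ha.2.ne
  refine ⟨(eLpNormEssSup a volume).toReal, ENNReal.toReal_nonneg, ?_⟩
  filter_upwards [enorm_ae_le_eLpNormEssSup a volume] with y hy
  rw [← toReal_enorm]
  exact ENNReal.toReal_mono h hy

theorem integrable_sub_left_smul {k : Euc n → ℝ} (hk : Integrable k) {a : Euc n → Euc m}
    (ha : a ∈ spaceLinf n m) (x : Euc n) : Integrable fun y => k (x - y) • a y := by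
  obtain ⟨A, -, hA⟩ := exists_ae_norm_le ha
  exact (hk.comp_sub_left x).smul_bdd A ha.1 hA

theorem aestronglyMeasurable_kernelConv {k : Euc n → ℝ} (hk : Continuous k) {f : Euc n → Euc m}
    (hf : AEStronglyMeasurable f volume) : AEStronglyMeasurable (kernelConv k f) volume := by
  have h1 : AEStronglyMeasurable (fun p : Euc n × Euc n => k (p.1 - p.2) • f p.2)
      (volume.prod volume) :=
    (hk.comp (continuous_fst.sub continuous_snd)).aestronglyMeasurable.smul hf.comp_snd
  exact h1.integral_prod_right'

/-- Associativity of convolution, for two integrable kernels acting on a bounded function. -/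
theorem kernelConv_kernelConv {k l : Euc n → ℝ} (hk : Integrable k) (hl : Integrable l)
    {a : Euc n → Euc m} (ha : a ∈ spaceLinf n m) (x : Euc n) :
    kernelConv k (kernelConv l a) x = kernelConv (fun v => ∫ y, k y * l (v - y)) a x := by
  obtain ⟨A, -, hA⟩ := exists_ae_norm_le ha
  have h1 : Integrable (fun p : Euc n × Euc n => k (x - p.2) * l (-(p.1 - p.2)))
      (volume.prod volume) :=
    (hk.comp_sub_left x).convolution_integrand (ContinuousLinearMap.mul ℝ ℝ) hl.comp_neg
  have h2 : Integrable (Function.uncurry fun z y : Euc n => (k (x - y) * l (-(z - y))) • a z)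
      (volume.prod volume) :=
    h1.smul_bdd A ha.1.comp_fst (Measure.quasiMeasurePreserving_fst.ae hA)
  have h3 := integral_integral_swap h2
  unfold kernelConv
  calc ∫ y, k (x - y) • ∫ z, l (y - z) • a z
      = ∫ y, ∫ z, (k (x - y) * l (-(z - y))) • a z := by
        simp only [← integral_smul, smul_smul, neg_sub]
    _ = ∫ z, ∫ y, (k (x - y) * l (-(z - y))) • a z := h3.symm
    _ = _ := by
        congr with z : 1
        rw [integral_smul_const]
        congr 1
        change _ = ∫ y, k y * l (x - z - y)
        rw [← integral_sub_left_eq_self (fun y => k y * l (x - z - y)) volume x]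
        congr with y
        congr 2
        abel

/-- The low-pass kernel at the next scale reproduces the dyadic blocks of a bounded function. -/
theorem kernelConv_lowPass_dyadicBlock {χ : 𝓢(Euc n, ℝ)} (hχ : IsLowPass χ) (j : ℤ)
    {a : Euc n → Euc m} (ha : a ∈ spaceLinf n m) (x : Euc n) :
    kernelConv (lowPass χ (j + 1)) (dyadicBlock χ j a) x = dyadicBlock χ j a x := by
  rw [dyadicBlock_eq_kernelConv, kernelConv_kernelConv (lowPass χ (j + 1)).integrable
    (bandPass χ j).integrable ha]
  simp only [integral_lowPass_mul_bandPass hχ]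

theorem enorm_kernelConv_le (k : Euc n → ℝ) (f : Euc n → Euc m) (x : Euc n) :
    ‖kernelConv k f x‖ₑ ≤ ∫⁻ y, ‖k (x - y)‖ₑ * ‖f y‖ₑ :=
  (enorm_integral_le_lintegral_enorm _).trans_eq (lintegral_congr fun _ => enorm_smul _ _)

theorem kernelConv_mem_spaceLinf {k : Euc n → ℝ} (hk : Continuous k) (hk' : Integrable k)
    {a : Euc n → Euc m} (ha : a ∈ spaceLinf n m) : kernelConv k a ∈ spaceLinf n m := by
  refine ⟨aestronglyMeasurable_kernelConv hk ha.1, ?_⟩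
  rw [eLpNorm_exponent_top]
  have h : ∀ x, ‖kernelConv k a x‖ₑ ≤ (∫⁻ y, ‖k y‖ₑ) * eLpNormEssSup a volume := fun x => by
    refine (enorm_kernelConv_le k a x).trans ?_
    rw [← lintegral_sub_left_eq_self (fun y => ‖k y‖ₑ) x, ← lintegral_mul_const' _ _ ?_]
    · refine lintegral_mono_ae ?_
      filter_upwards [enorm_ae_le_eLpNormEssSup a volume] with y hy
      gcongr
    · rw [← eLpNorm_exponent_top]; exact ha.2.ne
  refine (eLpNormEssSup_le_of_ae_enorm_bound (Filter.Eventually.of_forall h)).trans_lt ?_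
  have h1 := hk'.2
  rw [hasFiniteIntegral_iff_enorm] at h1
  have h2 := ha.2
  rw [eLpNorm_exponent_top] at h2
  exact ENNReal.mul_lt_top h1 h2

theorem measurable_enorm_sub (f : Euc n → ℝ) (hf : Continuous f) :
    Measurable fun p : Euc n × Euc n => ‖f (p.1 - p.2)‖ₑ :=
  (hf.comp (continuous_fst.sub continuous_snd)).measurable.enorm

/-- Young's inequality `‖k * f‖_p ≤ ‖k‖_1 ‖f‖_p`. -/
theorem lintegral_enorm_kernelConv_rpow_le {p : ℝ} (hp : 1 < p) {k : Euc n → ℝ}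
    (hk : Continuous k) {f : Euc n → Euc m} (hf : AEStronglyMeasurable f volume) :
    ∫⁻ x, ‖kernelConv k f x‖ₑ ^ p ≤ (∫⁻ y, ‖k y‖ₑ) ^ p * ∫⁻ y, ‖f y‖ₑ ^ p := by
  have hp0 : 0 ≤ p := by linarith
  have hf2 : AEMeasurable (fun y => ‖f y‖ₑ ^ p) volume := hf.enorm.pow_const p
  calc ∫⁻ x, ‖kernelConv k f x‖ₑ ^ p
      ≤ ∫⁻ x, (∫⁻ y, ‖k y‖ₑ) ^ (p - 1) * ∫⁻ y, ‖k (x - y)‖ₑ * ‖f y‖ₑ ^ p := by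
        refine lintegral_mono fun x => ?_
        refine (ENNReal.rpow_le_rpow (enorm_kernelConv_le k f x) hp0).trans ?_
        rw [← lintegral_sub_left_eq_self (fun y => ‖k y‖ₑ) x]
        exact lintegral_mul_rpow_le hp
          ((hk.comp (continuous_const.sub continuous_id)).measurable.enorm.aemeasurable) hf.enorm
    _ = (∫⁻ y, ‖k y‖ₑ) ^ (p - 1) * ∫⁻ x, ∫⁻ y, ‖k (x - y)‖ₑ * ‖f y‖ₑ ^ p := by
        refine lintegral_const_mul'' _ ?_
        exact ((measurable_enorm_sub k hk).aemeasurable.mul hf2.comp_snd).lintegral_prod_right'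
    _ = (∫⁻ y, ‖k y‖ₑ) ^ (p - 1) * ∫⁻ y, ∫⁻ x, ‖k (x - y)‖ₑ * ‖f y‖ₑ ^ p := by
        rw [lintegral_lintegral_swap
          ((measurable_enorm_sub k hk).aemeasurable.mul hf2.comp_snd)]
    _ = (∫⁻ y, ‖k y‖ₑ) ^ (p - 1) * ((∫⁻ y, ‖k y‖ₑ) * ∫⁻ y, ‖f y‖ₑ ^ p) := by
        congr 1
        rw [← lintegral_const_mul'' _ hf2]
        refine lintegral_congr fun y => ?_
        have h1 : Measurable fun x => ‖k (x - y)‖ₑ :=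
          (hk.comp (continuous_id.sub continuous_const)).measurable.enorm
        rw [lintegral_mul_const _ h1, lintegral_sub_right_eq_self (fun x => ‖k x‖ₑ)]
    _ = _ := by
        rw [← mul_assoc]
        congr 1
        nth_rw 2 [← ENNReal.rpow_one (∫⁻ y, ‖k y‖ₑ)]
        rw [← ENNReal.rpow_add_of_nonneg _ _ (by linarith) zero_le_one, sub_add_cancel]

/-- The Cauchy-Schwarz bound `‖k * f‖_∞ ≤ ‖k‖_2 ‖f‖_2`. -/
theorem enorm_kernelConv_sq_le {k : Euc n → ℝ} (hk : Continuous k) {f : Euc n → Euc m}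
    (hf : AEStronglyMeasurable f volume) (x : Euc n) :
    ‖kernelConv k f x‖ₑ ^ 2 ≤ (∫⁻ y, ‖k y‖ₑ ^ 2) * ∫⁻ y, ‖f y‖ₑ ^ 2 := by
  have h := ENNReal.lintegral_mul_le_Lp_mul_Lq volume Real.HolderConjugate.two_two
    (hk.comp (continuous_const.sub continuous_id : Continuous fun y => x - y)).measurable.enorm.aemeasurable
    hf.enorm
  have h2 : ‖kernelConv k f x‖ₑ ≤ _ := (enorm_kernelConv_le k f x).trans h
  have h3 := pow_le_pow_left' h2 2
  rw [mul_pow, rpow_half_sq, rpow_half_sq] at h3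
  simp only [ENNReal.rpow_two] at h3
  refine h3.trans_eq ?_
  congr 1
  exact lintegral_sub_left_eq_self (fun y => ‖k y‖ₑ ^ 2) x

theorem lintegral_enorm_lowPass_sq (χ : 𝓢(Euc n, ℝ)) (j : ℤ) :
    ∫⁻ y, ‖lowPass χ j y‖ₑ ^ 2 = ENNReal.ofReal ((2 : ℝ) ^ j) ^ n * ∫⁻ y, ‖χ y‖ₑ ^ 2 := by
  have hj : (0 : ℝ) < 2 ^ j := by positivity
  rw [lintegral_smul_eq hj fun y => ‖χ y‖ₑ ^ 2, ← mul_assoc, ← pow_add,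
    ← lintegral_const_mul' _ _ (by finiteness)]
  refine lintegral_congr fun y => ?_
  rw [lowPass_apply, enorm_mul, mul_pow, Real.enorm_of_nonneg (by positivity),
    ENNReal.ofReal_pow hj.le, ← pow_mul, mul_two]

theorem eLpNorm_two_mul_pow {N : ℕ} (hN : 1 ≤ N) (f : Euc n → Euc m) :
    eLpNorm f (2 * N) volume ^ (2 * N) = ∫⁻ x, ‖f x‖ₑ ^ (2 * N) := by
  have h := eLpNorm_nnreal_pow_eq_lintegral (f := f) (μ := volume) (p := 2 * (N : NNReal))
    (by positivity)
  have e : ((2 * (N : NNReal) : NNReal) : ℝ) = ((2 * N : ℕ) : ℝ) := by push_cast; rfl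
  rw [e] at h
  simp only [ENNReal.rpow_natCast] at h
  rw [← h]
  norm_cast

/-- The dyadic weights `2^(js)` as extended nonnegative reals. -/
theorem ofReal_two_rpow_pow (j : ℤ) (s : ℝ) {N : ℕ} {k : ℕ} (h : s * N = k) :
    ENNReal.ofReal ((2 : ℝ) ^ ((j : ℝ) * s)) ^ N = ENNReal.ofReal ((2 : ℝ) ^ j) ^ k := by
  rw [← ENNReal.ofReal_pow (by positivity), ← ENNReal.ofReal_pow (by positivity),
    ← Real.rpow_natCast, ← Real.rpow_mul zero_le_two, mul_assoc, h,
    ← Real.rpow_intCast, ← Real.rpow_natCast, ← Real.rpow_mul zero_le_two]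

/-- Membership in `L^∞ ∩ Ḃ^s_{2N,∞}`, with the norms of the dyadic blocks written as integrals. -/
theorem mem_spaceLinfBesov_iff {s : ℝ} {N k : ℕ} (hN : 1 ≤ N) (hk : s * (2 * N : ℕ) = k)
    {a : Euc n → Euc m} : a ∈ spaceLinfBesov n m s (2 * N) ↔ a ∈ spaceLinf n m ∧
      ∃ χ : 𝓢(Euc n, ℝ), IsLowPass χ ∧ ∃ M : ℝ≥0∞, M ≠ ∞ ∧ ∀ j : ℤ,
        ENNReal.ofReal ((2 : ℝ) ^ j) ^ k * ∫⁻ x, ‖dyadicBlock χ j a x‖ₑ ^ (2 * N) ≤ M := by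
  have key : ∀ (χ : 𝓢(Euc n, ℝ)) (j : ℤ),
      (ENNReal.ofReal ((2 : ℝ) ^ ((j : ℝ) * s)) *
        eLpNorm (dyadicBlock χ j a) (2 * N) volume) ^ (2 * N) =
      ENNReal.ofReal ((2 : ℝ) ^ j) ^ k * ∫⁻ x, ‖dyadicBlock χ j a x‖ₑ ^ (2 * N) := fun χ j => by
    rw [mul_pow, ofReal_two_rpow_pow j s hk, eLpNorm_two_mul_pow hN]
  refine and_congr_right fun _ => exists_congr fun χ => and_congr_right fun _ => ⟨fun h => ?_, ?_⟩
  · refine ⟨_, (ENNReal.pow_lt_top (n := 2 * N) h).ne, fun j => ?_⟩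
    rw [← key]
    exact pow_le_pow_left' (le_iSup (fun j : ℤ => ENNReal.ofReal ((2 : ℝ) ^ ((j : ℝ) * s)) *
      eLpNorm (dyadicBlock χ j a) (2 * N) volume) j) _
  · rintro ⟨M, hM, h⟩
    refine lt_of_le_of_lt (iSup_le fun j => ?_)
      (ENNReal.rpow_lt_top_of_nonneg (y := ((2 * N : ℕ) : ℝ)⁻¹) (by positivity) hM)
    rw [ENNReal.le_rpow_inv_iff (by positivity), ENNReal.rpow_natCast, key]
    exact h j

/-- Bernstein's inequality for dyadic blocks, in the form `‖ψ_j * a‖_∞² ≤ C 2^(jn) ‖ψ_j * a‖_2²`. -/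
theorem enorm_dyadicBlock_sq_le {χ : 𝓢(Euc n, ℝ)} (hχ : IsLowPass χ) (j : ℤ)
    {a : Euc n → Euc m} (ha : a ∈ spaceLinf n m) (x : Euc n) :
    ‖dyadicBlock χ j a x‖ₑ ^ 2 ≤ (2 ^ n * ∫⁻ y, ‖χ y‖ₑ ^ 2) *
      (ENNReal.ofReal ((2 : ℝ) ^ j) ^ n * ∫⁻ y, ‖dyadicBlock χ j a y‖ₑ ^ 2) := by
  have h := enorm_kernelConv_sq_le (lowPass χ (j + 1)).continuous
    (aestronglyMeasurable_kernelConv (bandPass χ j).continuous ha.1) x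
  rw [← dyadicBlock_eq_kernelConv, kernelConv_lowPass_dyadicBlock hχ j ha,
    lintegral_enorm_lowPass_sq] at h
  refine h.trans_eq ?_
  have e : ENNReal.ofReal ((2 : ℝ) ^ (j + 1)) = ENNReal.ofReal ((2 : ℝ) ^ j) * 2 := by
    have e2 : ENNReal.ofReal 2 = 2 := by simp
    rw [zpow_add_one₀ two_ne_zero, ENNReal.ofReal_mul (by positivity), e2]
  rw [e, mul_pow]
  ring

/-- The Besov embedding `L^∞ ∩ Ḃ^{n/2}_{2,∞} ⊆ L^∞ ∩ Ḃ^{1/2}_{2n,∞}`: interpolate Bernstein's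
inequality with the `L²` bound. -/
theorem spaceLinfBesov_subset (hn : 1 ≤ n) :
    spaceLinfBesov n m ((n : ℝ) / 2) 2 ⊆ spaceLinfBesov n m (1 / 2) (2 * n) := by
  intro a ha
  have e2 : (2 : ℝ≥0∞) = 2 * (1 : ℕ) := by simp
  nth_rw 1 [e2] at ha
  rw [mem_spaceLinfBesov_iff (k := n) le_rfl (by push_cast; ring)] at ha
  rw [mem_spaceLinfBesov_iff (k := n) hn (by push_cast; ring)]
  obtain ⟨ha, χ, hχ, M, hM, h⟩ := ha
  simp only [mul_one] at h
  set K : ℝ≥0∞ := 2 ^ n * ∫⁻ y, ‖χ y‖ₑ ^ 2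
  have hK : K ≠ ∞ := by
    refine ENNReal.mul_ne_top (by finiteness) ?_
    have h1 := ((χ.memLp 2).eLpNorm_lt_top)
    rw [eLpNorm_lt_top_iff_lintegral_rpow_enorm_lt_top two_ne_zero ENNReal.ofNat_ne_top] at h1
    simpa using h1.ne
  refine ⟨ha, χ, hχ, (K * M) ^ (n - 1) * M, by finiteness, fun j => ?_⟩
  have h1 : ∀ x, ‖dyadicBlock χ j a x‖ₑ ^ (2 * n) ≤
      (K * M) ^ (n - 1) * ‖dyadicBlock χ j a x‖ₑ ^ 2 := fun x => by
    obtain ⟨k, rfl⟩ : ∃ k, n = k + 1 := ⟨n - 1, by omega⟩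
    rw [pow_mul, pow_succ, Nat.add_sub_cancel]
    gcongr
    exact (enorm_dyadicBlock_sq_le hχ j ha x).trans (mul_le_mul_right (h j) _)
  calc _ ≤ ENNReal.ofReal ((2 : ℝ) ^ j) ^ n *
        ((K * M) ^ (n - 1) * ∫⁻ x, ‖dyadicBlock χ j a x‖ₑ ^ 2) := by
        refine mul_le_mul_right ?_ _
        rw [← lintegral_const_mul' _ _ (by finiteness)]
        exact lintegral_mono h1
    _ = (K * M) ^ (n - 1) *
        (ENNReal.ofReal ((2 : ℝ) ^ j) ^ n * ∫⁻ x, ‖dyadicBlock χ j a x‖ₑ ^ 2) := by ring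
    _ ≤ _ := by gcongr; exact h j

/-! ### Translation differences of dyadic blocks -/

/-- The first difference of a Schwartz function is controlled in `L¹` by its gradient. -/
theorem exists_lintegral_enorm_difference_le (χ : 𝓢(Euc n, ℝ)) : ∃ L : ℝ≥0∞, L ≠ ∞ ∧
    ∀ h : Euc n, ∫⁻ x, ‖χ (x + h) - χ x‖ₑ ≤ L * ‖h‖ₑ := by
  set D := SchwartzMap.fderivCLM ℝ (Euc n) ℝ χ
  have hD : ∀ x, HasFDerivAt χ (D x) x := fun x => χ.differentiableAt.hasFDerivAt
  have hint := (D.integrable (μ := volume)).2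
  rw [hasFiniteIntegral_iff_enorm] at hint
  refine ⟨∫⁻ x, ‖D x‖ₑ, hint.ne, fun h => ?_⟩
  have h1 : ∀ x, ‖χ (x + h) - χ x‖ₑ ≤ ∫⁻ t in Ioc (0 : ℝ) 1, ‖D (x + t • h)‖ₑ * ‖h‖ₑ := fun x => by
    have hd : ∀ t : ℝ, HasDerivAt (fun t : ℝ => χ (x + t • h)) (D (x + t • h) h) t := fun t => by
      have e1 : HasDerivAt (fun t : ℝ => x + t • h) h t := by
        simpa using ((hasDerivAt_id t).smul_const h).const_add x
      exact (hD (x + t • h)).comp_hasDerivAt t e1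
    have hc : Continuous fun t : ℝ => D (x + t • h) h :=
      (D.continuous.comp (by fun_prop)).clm_apply continuous_const
    have e := intervalIntegral.integral_eq_sub_of_hasDerivAt (a := 0) (b := 1)
      (fun t _ => hd t) (hc.intervalIntegrable _ _)
    simp only [one_smul, zero_smul, add_zero] at e
    rw [← e, intervalIntegral.integral_of_le zero_le_one]
    refine (enorm_integral_le_lintegral_enorm _).trans (lintegral_mono fun t => ?_)
    exact ContinuousLinearMap.le_opENorm _ _
  have hm : Measurable fun p : Euc n × ℝ => ‖D (p.1 + p.2 • h)‖ₑ * ‖h‖ₑ := by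
    have : Continuous fun p : Euc n × ℝ => D (p.1 + p.2 • h) := D.continuous.comp (by fun_prop)
    exact this.measurable.enorm.mul_const _
  calc _ ≤ ∫⁻ x, ∫⁻ t in Ioc (0 : ℝ) 1, ‖D (x + t • h)‖ₑ * ‖h‖ₑ := lintegral_mono h1
    _ = ∫⁻ t in Ioc (0 : ℝ) 1, ∫⁻ x, ‖D (x + t • h)‖ₑ * ‖h‖ₑ :=
        lintegral_lintegral_swap hm.aemeasurable
    _ = ∫⁻ t in Ioc (0 : ℝ) 1, (∫⁻ x, ‖D x‖ₑ) * ‖h‖ₑ := by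
        refine lintegral_congr fun t => ?_
        rw [lintegral_mul_const' _ _ enorm_ne_top,
          lintegral_add_right_eq_self (fun x => ‖D x‖ₑ)]
    _ = _ := by simp

theorem exists_lintegral_enorm_lowPass_difference_le (χ : 𝓢(Euc n, ℝ)) : ∃ L : ℝ≥0∞, L ≠ ∞ ∧
    ∀ (j : ℤ) (h : Euc n), ∫⁻ x, ‖lowPass χ j (x + h) - lowPass χ j x‖ₑ ≤
      L * (ENNReal.ofReal ((2 : ℝ) ^ j) * ‖h‖ₑ) := by
  obtain ⟨L, hL, H⟩ := exists_lintegral_enorm_difference_le χ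
  refine ⟨L, hL, fun j h => ?_⟩
  have hj : (0 : ℝ) < 2 ^ j := by positivity
  have h1 := H ((2 : ℝ) ^ j • h)
  rw [enorm_smul, Real.enorm_of_nonneg hj.le, lintegral_smul_eq hj,
    ← lintegral_const_mul' _ _ (by finiteness)] at h1
  refine (lintegral_congr fun x => ?_).trans_le h1
  rw [lowPass_apply, lowPass_apply, ← mul_sub, enorm_mul, Real.enorm_of_nonneg (by positivity),
    ENNReal.ofReal_pow hj.le, smul_add]

theorem kernelConv_add_sub {k : Euc n → ℝ} (hk : Integrable k) {a : Euc n → Euc m}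
    (ha : a ∈ spaceLinf n m) (h x : Euc n) :
    kernelConv k a (x + h) - kernelConv k a x = kernelConv (fun v => k (v + h) - k v) a x := by
  unfold kernelConv
  rw [← integral_sub (integrable_sub_left_smul hk ha _) (integrable_sub_left_smul hk ha _)]
  congr with y : 1
  rw [sub_smul, sub_add_eq_add_sub]

/-- The dyadic block is the difference of two consecutive low-pass approximations. -/
theorem kernelConv_lowPass_sub (χ : 𝓢(Euc n, ℝ)) (j : ℤ) {a : Euc n → Euc m}
    (ha : a ∈ spaceLinf n m) (x : Euc n) :
    kernelConv (lowPass χ j) a x - kernelConv (lowPass χ (j - 1)) a x = dyadicBlock χ j a x := by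
  unfold kernelConv
  rw [← integral_sub (integrable_sub_left_smul (lowPass χ j).integrable ha _)
    (integrable_sub_left_smul (lowPass χ (j - 1)).integrable ha _)]
  congr with y : 1
  rw [← sub_smul]
  rfl

theorem dyadicBlock_mem_spaceLinf (χ : 𝓢(Euc n, ℝ)) (j : ℤ) {a : Euc n → Euc m}
    (ha : a ∈ spaceLinf n m) : dyadicBlock χ j a ∈ spaceLinf n m :=
  kernelConv_mem_spaceLinf (bandPass χ j).continuous (bandPass χ j).integrable ha

/-- Young's inequality `‖k * f‖_{2n} ≤ ‖k‖_1 ‖f‖_{2n}`. -/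
theorem eLpNorm_kernelConv_le (hn : 1 ≤ n) {k : Euc n → ℝ} (hk : Continuous k)
    {f : Euc n → Euc m} (hf : AEStronglyMeasurable f volume) :
    eLpNorm (kernelConv k f) (2 * n) volume ≤ (∫⁻ y, ‖k y‖ₑ) * eLpNorm f (2 * n) volume := by
  have hp : (1 : ℝ) < ((2 * n : ℕ) : ℝ) := by
    have : 1 < 2 * n := by omega
    exact_mod_cast this
  have h := lintegral_enorm_kernelConv_rpow_le hp hk hf
  simp only [ENNReal.rpow_natCast] at h
  rw [← eLpNorm_two_mul_pow hn, ← eLpNorm_two_mul_pow hn, ← mul_pow] at h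
  exact (ENNReal.pow_le_pow_left_iff (by omega)).1 h

theorem aestronglyMeasurable_comp_add_right {f : Euc n → Euc m}
    (hf : AEStronglyMeasurable f volume) (h : Euc n) :
    AEStronglyMeasurable (fun x => f (x + h)) volume :=
  hf.comp_quasiMeasurePreserving (quasiMeasurePreserving_add_right volume h)

theorem eLpNorm_comp_add_right {f : Euc n → Euc m} (hf : AEStronglyMeasurable f volume)
    (h : Euc n) (p : ℝ≥0∞) : eLpNorm (fun x => f (x + h)) p volume = eLpNorm f p volume :=
  eLpNorm_comp_measurePreserving hf (measurePreserving_add_right volume h)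

/-- Translation differences of dyadic blocks: the trivial bound at high frequencies and the
gradient bound at low frequencies. -/
theorem exists_eLpNorm_dyadicBlock_difference_le (hn : 1 ≤ n) {χ : 𝓢(Euc n, ℝ)}
    (hχ : IsLowPass χ) : ∃ L : ℝ≥0∞, L ≠ ∞ ∧ ∀ (m : ℕ) (a : Euc n → Euc m), a ∈ spaceLinf n m →
      ∀ (j : ℤ) (h : Euc n),
        eLpNorm (fun x => dyadicBlock χ j a (x + h) - dyadicBlock χ j a x) (2 * n) volume ≤
          L * min 1 (ENNReal.ofReal ((2 : ℝ) ^ j) * ‖h‖ₑ) *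
            eLpNorm (dyadicBlock χ j a) (2 * n) volume := by
  obtain ⟨L, hL, H⟩ := exists_lintegral_enorm_lowPass_difference_le χ
  refine ⟨max 2 (2 * L), by finiteness, fun m a ha j h => ?_⟩
  have hb := dyadicBlock_mem_spaceLinf χ j ha
  have hp : (1 : ℝ≥0∞) ≤ 2 * n := by
    have : 1 ≤ 2 * n := by omega
    exact_mod_cast this
  rcases le_total 1 (ENNReal.ofReal ((2 : ℝ) ^ j) * ‖h‖ₑ) with h1 | h1
  · rw [min_eq_left h1, mul_one]
    calc _ ≤ eLpNorm (fun x => dyadicBlock χ j a (x + h)) (2 * n) volume +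
          eLpNorm (dyadicBlock χ j a) (2 * n) volume :=
          eLpNorm_sub_le (aestronglyMeasurable_comp_add_right hb.1 h) hb.1 hp
      _ = 2 * eLpNorm (dyadicBlock χ j a) (2 * n) volume := by
          rw [eLpNorm_comp_add_right hb.1]; exact (two_mul _).symm
      _ ≤ _ := by gcongr; exact le_max_left _ _
  · rw [min_eq_right h1]
    have e : (fun x => dyadicBlock χ j a (x + h) - dyadicBlock χ j a x) =
        kernelConv (fun v => lowPass χ (j + 1) (v + h) - lowPass χ (j + 1) v)
          (dyadicBlock χ j a) := by
      ext1 x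
      rw [← kernelConv_add_sub (lowPass χ (j + 1)).integrable hb,
        kernelConv_lowPass_dyadicBlock hχ j ha, kernelConv_lowPass_dyadicBlock hχ j ha]
    have hc : Continuous fun v => lowPass χ (j + 1) (v + h) - lowPass χ (j + 1) v :=
      ((lowPass χ (j + 1)).continuous.comp (by fun_prop)).sub (lowPass χ (j + 1)).continuous
    rw [e]
    refine (eLpNorm_kernelConv_le hn hc hb.1).trans (mul_le_mul_left ?_ _)
    refine (H (j + 1) h).trans ?_
    have e : ENNReal.ofReal ((2 : ℝ) ^ (j + 1)) = 2 * ENNReal.ofReal ((2 : ℝ) ^ j) := by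
      have e2 : ENNReal.ofReal 2 = 2 := by simp
      rw [zpow_add_one₀ two_ne_zero, mul_comm, ENNReal.ofReal_mul zero_le_two, e2]
    rw [e, mul_assoc 2, ← mul_assoc, mul_comm L]
    gcongr
    exact le_max_right _ _

/-! ### Convergence of the low-pass approximations -/

/-- `∑_j min(1, 2^j t) 2^(-j/2) ≤ C √t`: the two regimes balance at `2^j ∼ 1/t`. -/
theorem exists_tsum_min_le : ∃ C : ℝ≥0∞, C ≠ ∞ ∧ ∀ t : ℝ, 0 < t →
    ∑' j : ℤ, min 1 (ENNReal.ofReal ((2 : ℝ) ^ j) * ENNReal.ofReal t) *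
      ENNReal.ofReal ((2 : ℝ) ^ (-((j : ℝ) / 2))) ≤ C * ENNReal.ofReal (t ^ (1 / 2 : ℝ)) := by
  set q : ℝ := 2 ^ (-(1 / 2) : ℝ) with hq
  have hq0 : 0 < q := by positivity
  have hq1 : q < 1 := Real.rpow_lt_one_of_one_lt_of_neg one_lt_two (by norm_num)
  have hsum : Summable fun k : ℤ => q ^ k.natAbs :=
    Summable.of_nat_of_neg (by simpa using summable_geometric_of_lt_one hq0.le hq1)
      (by simpa using summable_geometric_of_lt_one hq0.le hq1)
  have hS : ∑' k : ℤ, ENNReal.ofReal (q ^ k.natAbs) ≠ ∞ := hsum.tsum_ofReal_ne_top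
  refine ⟨2 * ∑' k : ℤ, ENNReal.ofReal (q ^ k.natAbs), by finiteness, fun t ht => ?_⟩
  -- the critical index `i`, with `2^i ≤ 1/t < 2^(i+1)`
  obtain ⟨i, hi1, hi2⟩ := exists_mem_Ico_zpow (x := t⁻¹) (y := (2 : ℝ)) (by positivity) one_lt_two
  have hpow : ∀ k : ℕ, q ^ k = 2 ^ (-((k : ℝ) / 2)) := fun k => by
    rw [hq, ← Real.rpow_natCast, ← Real.rpow_mul zero_le_two]; congr 1; ring
  have ht1 : t ≤ 2 ^ (-(i : ℝ)) := by
    rw [Real.rpow_neg zero_le_two, Real.rpow_intCast]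
    exact (le_inv_comm₀ (by positivity) ht).1 hi1
  have ht2 : (2 : ℝ) ^ (-(i : ℝ)) ≤ 2 * t := by
    rw [zpow_add_one₀ two_ne_zero] at hi2
    rw [Real.rpow_neg zero_le_two, Real.rpow_intCast, inv_le_iff_one_le_mul₀ (by positivity)]
    have := mul_lt_mul_of_pos_left hi2 ht
    rw [mul_inv_cancel₀ ht.ne'] at this
    linarith
  have hs1 : t ≤ 2 ^ (-((i : ℝ) / 2)) * t ^ (1 / 2 : ℝ) := by
    have h1 := Real.rpow_le_rpow ht.le ht1 (by norm_num : (0 : ℝ) ≤ 1 / 2)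
    rw [← Real.rpow_mul zero_le_two] at h1
    calc t = t ^ (1 / 2 : ℝ) * t ^ (1 / 2 : ℝ) := by rw [← Real.rpow_add ht]; norm_num
      _ ≤ 2 ^ (-(i : ℝ) * (1 / 2)) * t ^ (1 / 2 : ℝ) := by gcongr
      _ = _ := by congr 2; ring
  have hs2 : (2 : ℝ) ^ (-((i : ℝ) / 2)) ≤ 2 * t ^ (1 / 2 : ℝ) := by
    have h1 := Real.rpow_le_rpow (by positivity) ht2 (by norm_num : (0 : ℝ) ≤ 1 / 2)
    rw [← Real.rpow_mul zero_le_two, Real.mul_rpow zero_le_two ht.le] at h1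
    calc (2 : ℝ) ^ (-((i : ℝ) / 2)) = 2 ^ (-(i : ℝ) * (1 / 2)) := by congr 1; ring
      _ ≤ _ := h1
      _ ≤ 2 ^ (1 : ℝ) * t ^ (1 / 2 : ℝ) := by gcongr <;> norm_num
      _ = _ := by rw [Real.rpow_one]
  have key : ∀ j : ℤ, min 1 (2 ^ j * t) * 2 ^ (-((j : ℝ) / 2)) ≤
      q ^ (j - i).natAbs * (2 * t ^ (1 / 2 : ℝ)) := fun j => by
    rcases le_total i j with hij | hij
    · obtain ⟨k, rfl⟩ : ∃ k : ℕ, j = i + k := ⟨(j - i).toNat, by omega⟩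
      have e : (i + (k : ℤ) - i).natAbs = k := by omega
      rw [e, hpow]
      calc min 1 ((2 : ℝ) ^ (i + (k : ℤ)) * t) * 2 ^ (-(((i + (k : ℤ) : ℤ) : ℝ) / 2))
          ≤ 1 * 2 ^ (-(((i + (k : ℤ) : ℤ) : ℝ) / 2)) := by gcongr; exact min_le_left _ _
        _ = 2 ^ (-((k : ℝ) / 2)) * 2 ^ (-((i : ℝ) / 2)) := by
            rw [← Real.rpow_add two_pos, one_mul]; congr 1; push_cast; ring
        _ ≤ _ := by gcongr
    · obtain ⟨k, rfl⟩ : ∃ k : ℕ, j = i - k := ⟨(i - j).toNat, by omega⟩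
      have e : (i - (k : ℤ) - i).natAbs = k := by omega
      rw [e, hpow]
      calc min 1 ((2 : ℝ) ^ (i - (k : ℤ)) * t) * 2 ^ (-(((i - (k : ℤ) : ℤ) : ℝ) / 2))
          ≤ (2 : ℝ) ^ (i - (k : ℤ)) * t * 2 ^ (-(((i - (k : ℤ) : ℤ) : ℝ) / 2)) := by
            gcongr; exact min_le_right _ _
        _ = 2 ^ (-((k : ℝ) / 2)) * (2 ^ ((i : ℝ) / 2) * t) := by
            rw [← Real.rpow_intCast, mul_right_comm, ← mul_assoc, ← Real.rpow_add two_pos,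
              ← Real.rpow_add two_pos]
            congr 2; push_cast; ring
        _ ≤ 2 ^ (-((k : ℝ) / 2)) * (2 ^ ((i : ℝ) / 2) * (2 ^ (-((i : ℝ) / 2)) * t ^ (1 / 2 : ℝ))) := by
            gcongr
        _ = 2 ^ (-((k : ℝ) / 2)) * t ^ (1 / 2 : ℝ) := by
            rw [← mul_assoc (2 ^ ((i : ℝ) / 2)), ← Real.rpow_add two_pos, add_neg_cancel,
              Real.rpow_zero, one_mul]
        _ ≤ _ := by
            gcongr
            have : 0 ≤ t ^ (1 / 2 : ℝ) := by positivity
            linarith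
  have key2 : ∀ j : ℤ, min 1 (ENNReal.ofReal ((2 : ℝ) ^ j) * ENNReal.ofReal t) *
      ENNReal.ofReal ((2 : ℝ) ^ (-((j : ℝ) / 2))) ≤
      ENNReal.ofReal (q ^ (j - i).natAbs) * (2 * ENNReal.ofReal (t ^ (1 / 2 : ℝ))) := fun j => by
    have e2 : (2 : ℝ≥0∞) = ENNReal.ofReal 2 := by simp
    have e1 : min 1 (ENNReal.ofReal ((2 : ℝ) ^ j) * ENNReal.ofReal t) =
        ENNReal.ofReal (min 1 (2 ^ j * t)) := by
      rw [ENNReal.ofReal_min, ENNReal.ofReal_one, ENNReal.ofReal_mul (by positivity)]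
    rw [e1, e2, ← ENNReal.ofReal_mul (by positivity), ← ENNReal.ofReal_mul (by positivity),
      ← ENNReal.ofReal_mul (by positivity)]
    exact ENNReal.ofReal_le_ofReal (key j)
  calc _ ≤ ∑' j : ℤ, ENNReal.ofReal (q ^ (j - i).natAbs) * (2 * ENNReal.ofReal (t ^ (1 / 2 : ℝ))) :=
        ENNReal.tsum_le_tsum key2
    _ = (∑' j : ℤ, ENNReal.ofReal (q ^ j.natAbs)) * (2 * ENNReal.ofReal (t ^ (1 / 2 : ℝ))) := by
        rw [ENNReal.tsum_mul_right]
        congr 1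
        exact (Equiv.subRight i).tsum_eq fun j : ℤ => ENNReal.ofReal (q ^ j.natAbs)
    _ = _ := by ring

/-- By scaling, the mass of the low-pass kernel outside the ball of radius `2^(-j) R` does not depend
on `j`. -/
theorem lintegral_lowPass_far (χ : 𝓢(Euc n, ℝ)) (j : ℤ) (R : ℝ) (x : Euc n) :
    ∫⁻ y in (closedBall x (R * ((2 : ℝ) ^ j)⁻¹))ᶜ, ‖lowPass χ j (x - y)‖ₑ =
      ∫⁻ w in (closedBall 0 R)ᶜ, ‖χ w‖ₑ := by
  have hj : (0 : ℝ) < 2 ^ j := by positivity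
  rw [← lintegral_indicator measurableSet_closedBall.compl,
    ← lintegral_indicator measurableSet_closedBall.compl,
    lintegral_smul_eq hj ((closedBall (0 : Euc n) R)ᶜ.indicator fun w => ‖χ w‖ₑ),
    ← lintegral_sub_left_eq_self _ x, ← lintegral_const_mul' _ _ (by finiteness)]
  refine lintegral_congr fun y => ?_
  have e : (y ∈ (closedBall (0 : Euc n) (R * ((2 : ℝ) ^ j)⁻¹))ᶜ) ↔
      (2 : ℝ) ^ j • y ∈ (closedBall (0 : Euc n) R)ᶜ := by
    simp only [mem_compl_iff, mem_closedBall, dist_zero_right, norm_smul,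
      Real.norm_of_nonneg hj.le]
    rw [not_iff_not, ← div_eq_mul_inv, le_div_iff₀ hj, mul_comm]
  have e2 : (x - y ∈ (closedBall x (R * ((2 : ℝ) ^ j)⁻¹))ᶜ) ↔
      y ∈ (closedBall (0 : Euc n) (R * ((2 : ℝ) ^ j)⁻¹))ᶜ := by
    simp [mem_closedBall, dist_eq_norm]
  by_cases hy : (2 : ℝ) ^ j • y ∈ (closedBall (0 : Euc n) R)ᶜ
  · rw [indicator_of_mem hy, indicator_of_mem (e2.2 (e.2 hy)), sub_sub_cancel, lowPass_apply,
      enorm_mul, Real.enorm_of_nonneg (by positivity), ENNReal.ofReal_pow hj.le]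
  · rw [indicator_of_notMem hy, indicator_of_notMem fun h => hy (e.1 (e2.1 h)), mul_zero]

open Filter Topology in
theorem tendsto_lintegral_far (χ : 𝓢(Euc n, ℝ)) :
    Tendsto (fun R : ℕ => ∫⁻ w in (closedBall 0 (R : ℝ))ᶜ, ‖χ w‖ₑ) atTop (𝓝 0) := by
  simp_rw [← lintegral_indicator measurableSet_closedBall.compl]
  have h0 : (0 : ℝ≥0∞) = ∫⁻ _ : Euc n, 0 := by simp
  have hint := (χ.integrable (μ := volume)).2
  rw [hasFiniteIntegral_iff_enorm] at hint
  rw [h0]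
  refine tendsto_lintegral_of_dominated_convergence (fun w => ‖χ w‖ₑ)
    (fun R => χ.continuous.measurable.enorm.indicator measurableSet_closedBall.compl)
    (fun R => Eventually.of_forall fun w => indicator_le_self _ _ w) hint.ne
    (Eventually.of_forall fun w => ?_)
  refine tendsto_const_nhds.congr' ?_
  filter_upwards [eventually_ge_atTop ⌈‖w‖⌉₊] with R hR
  rw [indicator_of_notMem]
  simpa using Nat.ceil_le.1 hR

theorem exists_enorm_lowPass_le (χ : 𝓢(Euc n, ℝ)) : ∃ B : ℝ≥0∞, B ≠ ∞ ∧ ∀ (j : ℤ) (x : Euc n),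
    ‖lowPass χ j x‖ₑ ≤ ENNReal.ofReal ((2 : ℝ) ^ j) ^ n * B := by
  obtain ⟨B, hB⟩ := χ.decay 0 0
  refine ⟨ENNReal.ofReal B, by finiteness, fun j x => ?_⟩
  rw [lowPass_apply, enorm_mul, Real.enorm_of_nonneg (by positivity),
    ENNReal.ofReal_pow (by positivity)]
  gcongr
  rw [← ofReal_norm]
  refine ENNReal.ofReal_le_ofReal ?_
  simpa using hB.2 ((2 : ℝ) ^ j • x)

theorem kernelConv_lowPass_sub_const {χ : 𝓢(Euc n, ℝ)} (hχ : IsLowPass χ) (j : ℤ)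
    {a : Euc n → Euc m} (ha : a ∈ spaceLinf n m) (x : Euc n) (c : Euc m) :
    kernelConv (lowPass χ j) a x - c = ∫ y, lowPass χ j (x - y) • (a y - c) := by
  have e : c = ∫ y, lowPass χ j (x - y) • c := by
    rw [integral_smul_const, integral_sub_left_eq_self (fun y => lowPass χ j y), integral_lowPass hχ,
      one_smul]
  unfold kernelConv
  nth_rw 1 [e]
  rw [← integral_sub (integrable_sub_left_smul (lowPass χ j).integrable ha _)
    (((lowPass χ j).integrable.comp_sub_left x).smul_const c)]
  simp only [smul_sub]

open Filter Topology in
/-- The low-pass approximations converge at every Lebesgue point: the mass of the kernel far from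
the origin contributes little since `a` is bounded, and the rest is an average over a small ball. -/
theorem ae_tendsto_kernelConv_lowPass {χ : 𝓢(Euc n, ℝ)} (hχ : IsLowPass χ)
    {a : Euc n → Euc m} (ha : a ∈ spaceLinf n m) :
    ∀ᵐ x, Tendsto (fun J : ℕ => kernelConv (lowPass χ J) a x) atTop (𝓝 (a x)) := by
  obtain ⟨A, -, hA⟩ := exists_ae_norm_le ha
  obtain ⟨B, hB, hB'⟩ := exists_enorm_lowPass_le χ
  have hloc : LocallyIntegrable a volume := ha.locallyIntegrable le_top
  filter_upwards [IsUnifLocDoublingMeasure.ae_tendsto_average_norm_sub.{0, 0, 0} volume hloc 1, hA]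
    with x hx hAx
  set avg : ℕ → ℕ → ℝ := fun R J =>
    ⨍ y in closedBall x ((R : ℝ) * ((2 : ℝ) ^ (J : ℤ))⁻¹), ‖a y - a x‖
  have key : ∀ R J : ℕ, 0 < R → ‖kernelConv (lowPass χ J) a x - a x‖ₑ ≤
      B * (ENNReal.ofReal R ^ n * volume (ball (0 : Euc n) 1)) * ENNReal.ofReal (avg R J) +
        ENNReal.ofReal (A + A) * ∫⁻ w in (closedBall 0 (R : ℝ))ᶜ, ‖χ w‖ₑ := fun R J hR => by
    set ρ : ℝ := (R : ℝ) * ((2 : ℝ) ^ (J : ℤ))⁻¹ with hρ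
    have hρ0 : 0 < ρ := by positivity
    rw [kernelConv_lowPass_sub_const hχ _ ha]
    refine (enorm_integral_le_lintegral_enorm _).trans ?_
    rw [← lintegral_add_compl _ (measurableSet_closedBall (x := x) (ε := ρ))]
    refine add_le_add ?_ ?_
    · have hint : IntegrableOn (fun y => ‖a y - a x‖) (closedBall x ρ) :=
        ((hloc.integrableOn_isCompact (isCompact_closedBall x ρ)).sub
          (integrableOn_const measure_closedBall_lt_top.ne)).norm
      have h1 : ∫⁻ y in closedBall x ρ, ‖a y - a x‖ₑ =
          volume (closedBall x ρ) * ENNReal.ofReal (avg R J) := by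
        have h2 : ∫ y in closedBall x ρ, ‖a y - a x‖ =
            volume.real (closedBall x ρ) * avg R J := by
          rw [← smul_eq_mul]
          exact (measure_smul_setAverage _ measure_closedBall_lt_top.ne).symm
        rw [← lintegral_congr fun y => enorm_norm (a y - a x),
          ← ofReal_integral_norm_eq_lintegral_enorm hint]
        simp only [norm_norm]
        rw [h2, ENNReal.ofReal_mul measureReal_nonneg, measureReal_def,
          ENNReal.ofReal_toReal measure_closedBall_lt_top.ne]
      calc _ ≤ ∫⁻ y in closedBall x ρ,
            (ENNReal.ofReal ((2 : ℝ) ^ (J : ℤ)) ^ n * B) * ‖a y - a x‖ₑ := by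
            refine lintegral_mono fun y => ?_
            rw [enorm_smul]
            exact mul_le_mul_left (hB' J _) _
        _ = B * ((ENNReal.ofReal ((2 : ℝ) ^ (J : ℤ)) * ENNReal.ofReal ρ) ^ n *
            volume (ball (0 : Euc n) 1)) * ENNReal.ofReal (avg R J) := by
            rw [lintegral_const_mul' _ _ (by finiteness), h1, Measure.addHaar_closedBall _ _ hρ0.le,
              finrank_euclideanSpace, Fintype.card_fin, ENNReal.ofReal_pow hρ0.le, mul_pow]
            ring
        _ = _ := by
            have e : (2 : ℝ) ^ (J : ℤ) * ρ = R := by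
              rw [hρ, mul_left_comm, mul_inv_cancel₀ (by positivity), mul_one]
            rw [← ENNReal.ofReal_mul (by positivity), e]
    · rw [← lintegral_lowPass_far χ J R x, ← lintegral_const_mul' _ _ (by finiteness)]
      refine lintegral_mono_ae ?_
      filter_upwards [ae_restrict_of_ae hA] with y hy
      rw [enorm_smul, mul_comm]
      gcongr
      rw [← ofReal_norm]
      exact ENNReal.ofReal_le_ofReal ((norm_sub_le _ _).trans (add_le_add hy hAx))
  have hlim : ∀ R : ℕ, 0 < R → Tendsto (avg R) atTop (𝓝 0) := fun R hR => by
    have h1 : Tendsto (fun J : ℕ => (R : ℝ) * ((2 : ℝ) ^ (J : ℤ))⁻¹) atTop (𝓝[>] 0) := by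
      refine tendsto_nhdsWithin_iff.2 ⟨?_, Eventually.of_forall fun J => ?_⟩
      · have := (tendsto_pow_atTop_nhds_zero_of_lt_one (by norm_num : (0 : ℝ) ≤ 2⁻¹)
          (by norm_num)).const_mul (R : ℝ)
        simpa using this
      · simp only [mem_Ioi]; positivity
    refine hx (fun _ => x) _ h1 (Eventually.of_forall fun J => ?_)
    simp only [one_mul]
    exact mem_closedBall_self (by positivity)
  rw [tendsto_iff_edist_tendsto_0]
  simp_rw [edist_eq_enorm_sub]
  rw [ENNReal.tendsto_nhds_zero]
  intro ε hε
  have hε2 : 0 < ε / 2 := ENNReal.half_pos hε.ne'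
  have t1 : Tendsto (fun R : ℕ => ENNReal.ofReal (A + A) * ∫⁻ w in (closedBall 0 (R : ℝ))ᶜ, ‖χ w‖ₑ)
      atTop (𝓝 0) := by
    simpa using ENNReal.Tendsto.const_mul (tendsto_lintegral_far χ) (Or.inr ENNReal.ofReal_ne_top)
  obtain ⟨R, hR1, hR0⟩ := ((ENNReal.tendsto_nhds_zero.1 t1 _ hε2).and
    (eventually_gt_atTop 0)).exists
  have t2 : Tendsto (fun J : ℕ => B * (ENNReal.ofReal R ^ n * volume (ball (0 : Euc n) 1)) *
      ENNReal.ofReal (avg R J)) atTop (𝓝 0) := by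
    simpa using ENNReal.Tendsto.const_mul (ENNReal.tendsto_ofReal (hlim R hR0))
      (Or.inr (by finiteness))
  filter_upwards [ENNReal.tendsto_nhds_zero.1 t2 _ hε2] with J hJ
  calc _ ≤ _ := key R J hR0
    _ ≤ ε / 2 + ε / 2 := add_le_add hJ hR1
    _ = ε := ENNReal.add_halves ε

/-! ### From the Besov space to `Q_0` -/

open Filter Topology in
/-- The low-frequency part of a bounded function becomes constant in the limit. -/
theorem tendsto_kernelConv_lowPass_neg_difference (χ : 𝓢(Euc n, ℝ)) {a : Euc n → Euc m}
    (ha : a ∈ spaceLinf n m) (h x : Euc n) :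
    Tendsto (fun J : ℕ => kernelConv (lowPass χ (-J)) a (x + h) - kernelConv (lowPass χ (-J)) a x)
      atTop (𝓝 0) := by
  obtain ⟨A, -, hA⟩ := exists_ae_norm_le ha
  obtain ⟨L, hL, H⟩ := exists_lintegral_enorm_lowPass_difference_le χ
  have key : ∀ J : ℕ,
      ‖kernelConv (lowPass χ (-J)) a (x + h) - kernelConv (lowPass χ (-J)) a x‖ₑ ≤
        (L * ‖h‖ₑ * ENNReal.ofReal A) * ENNReal.ofReal ((2 : ℝ)⁻¹ ^ J) := fun J => by
    rw [kernelConv_add_sub (lowPass χ (-J)).integrable ha]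
    refine (enorm_kernelConv_le _ a x).trans ?_
    calc _ ≤ ∫⁻ y, ‖lowPass χ (-J) (x - y + h) - lowPass χ (-J) (x - y)‖ₑ * ENNReal.ofReal A := by
          refine lintegral_mono_ae ?_
          filter_upwards [hA] with y hy
          gcongr
          rw [← ofReal_norm]
          exact ENNReal.ofReal_le_ofReal hy
      _ = (∫⁻ y, ‖lowPass χ (-J) (y + h) - lowPass χ (-J) y‖ₑ) * ENNReal.ofReal A := by
          rw [lintegral_mul_const' _ _ ENNReal.ofReal_ne_top, lintegral_sub_left_eq_self
            (fun y => ‖lowPass χ (-J) (y + h) - lowPass χ (-J) y‖ₑ)]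
      _ ≤ L * (ENNReal.ofReal ((2 : ℝ) ^ (-(J : ℤ))) * ‖h‖ₑ) * ENNReal.ofReal A := by
          gcongr; exact H _ h
      _ = _ := by
          rw [zpow_neg, zpow_natCast, inv_pow]; ring
  rw [tendsto_iff_edist_tendsto_0]
  simp_rw [edist_zero_right]
  have ht : Tendsto (fun J : ℕ => (L * ‖h‖ₑ * ENNReal.ofReal A) * ENNReal.ofReal ((2 : ℝ)⁻¹ ^ J))
      atTop (𝓝 0) := by
    have h1 := ENNReal.tendsto_ofReal (tendsto_pow_atTop_nhds_zero_of_lt_one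
      (by norm_num : (0 : ℝ) ≤ 2⁻¹) (by norm_num))
    simpa using ENNReal.Tendsto.const_mul h1 (Or.inr (by finiteness))
  exact tendsto_of_tendsto_of_tendsto_of_le_of_le tendsto_const_nhds ht (fun _ => zero_le) key

/-- Telescoping sum of the dyadic blocks of the frequencies between `2^(-J)` and `2^J`. -/
theorem sum_dyadicBlock (χ : 𝓢(Euc n, ℝ)) {a : Euc n → Euc m} (ha : a ∈ spaceLinf n m)
    (J : ℕ) (x : Euc n) : ∑ i ∈ Finset.range (2 * J), dyadicBlock χ (-J + 1 + i) a x =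
      kernelConv (lowPass χ J) a x - kernelConv (lowPass χ (-J)) a x := by
  have h := Finset.sum_range_sub (fun i : ℕ => kernelConv (lowPass χ (-J + i)) a x) (2 * J)
  have e1 : -(J : ℤ) + ((2 * J : ℕ) : ℤ) = J := by push_cast; ring
  have e2 : -(J : ℤ) + ((0 : ℕ) : ℤ) = -J := by simp
  rw [e1, e2] at h
  rw [← h]
  refine Finset.sum_congr rfl fun i _ => ?_
  rw [← kernelConv_lowPass_sub χ _ ha]
  have e3 : -(J : ℤ) + ((i + 1 : ℕ) : ℤ) = -J + 1 + i := by push_cast; ring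
  have e4 : -(J : ℤ) + 1 + i - 1 = -J + i := by ring
  rw [e3, e4]

open Filter Topology in
/-- Functions in the Besov space are `1/2`-Hölder continuous in the mean of order `2n`: sum the
difference bounds of the dyadic blocks and pass to the limit by Fatou's lemma. -/
theorem exists_eLpNorm_difference_le (hn : 1 ≤ n) {a : Euc n → Euc m}
    (ha : a ∈ spaceLinfBesov n m (1 / 2) (2 * n)) : ∃ K : ℝ≥0∞, K ≠ ∞ ∧ ∀ h : Euc n,
      eLpNorm (fun x => a (x + h) - a x) (2 * n) volume ≤
        K * ENNReal.ofReal (‖h‖ ^ (1 / 2 : ℝ)) := by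
  obtain ⟨ha, χ, hχ, hM⟩ := ha
  set M := ⨆ j : ℤ, ENNReal.ofReal ((2 : ℝ) ^ ((j : ℝ) * (1 / 2))) *
    eLpNorm (dyadicBlock χ j a) (2 * n) volume
  obtain ⟨L, hL, HL⟩ := exists_eLpNorm_dyadicBlock_difference_le hn hχ
  obtain ⟨C, hC, HC⟩ := exists_tsum_min_le
  have hp : (1 : ℝ≥0∞) ≤ 2 * n := by
    have : 1 ≤ 2 * n := by omega
    exact_mod_cast this
  have hN : ∀ j : ℤ, eLpNorm (dyadicBlock χ j a) (2 * n) volume ≤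
      ENNReal.ofReal ((2 : ℝ) ^ (-((j : ℝ) / 2))) * M := fun j => by
    have h1 : ENNReal.ofReal ((2 : ℝ) ^ (-((j : ℝ) / 2))) *
        ENNReal.ofReal ((2 : ℝ) ^ ((j : ℝ) * (1 / 2))) = 1 := by
      rw [← ENNReal.ofReal_mul (by positivity), ← Real.rpow_add two_pos]
      have : -((j : ℝ) / 2) + (j : ℝ) * (1 / 2) = 0 := by ring
      rw [this, Real.rpow_zero, ENNReal.ofReal_one]
    calc _ = ENNReal.ofReal ((2 : ℝ) ^ (-((j : ℝ) / 2))) *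
          (ENNReal.ofReal ((2 : ℝ) ^ ((j : ℝ) * (1 / 2))) *
            eLpNorm (dyadicBlock χ j a) (2 * n) volume) := by rw [← mul_assoc, h1, one_mul]
      _ ≤ _ := by
          gcongr
          exact le_iSup (fun j : ℤ => ENNReal.ofReal ((2 : ℝ) ^ ((j : ℝ) * (1 / 2))) *
            eLpNorm (dyadicBlock χ j a) (2 * n) volume) j
  refine ⟨L * M * C, by finiteness, fun h => ?_⟩
  rcases eq_or_ne h 0 with rfl | hh
  · have e : (fun x => a (x + 0) - a x) = 0 := by ext1 x; simp
    rw [e, eLpNorm_zero]; exact zero_le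
  have hh0 : 0 < ‖h‖ := norm_pos_iff.2 hh
  set d : ℤ → Euc n → Euc m := fun j x => dyadicBlock χ j a (x + h) - dyadicBlock χ j a x with hd
  have hdm : ∀ j, AEStronglyMeasurable (d j) volume := fun j =>
    (aestronglyMeasurable_comp_add_right (dyadicBlock_mem_spaceLinf χ j ha).1 h).sub
      (dyadicBlock_mem_spaceLinf χ j ha).1
  set g : ℕ → Euc n → Euc m := fun J => ∑ i ∈ Finset.range (2 * J), d (-J + 1 + i) with hg
  have hgm : ∀ J, AEStronglyMeasurable (g J) volume := fun J =>
    Finset.aestronglyMeasurable_sum _ fun i _ => hdm _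
  have hgle : ∀ J, eLpNorm (g J) (2 * n) volume ≤
      L * M * C * ENNReal.ofReal (‖h‖ ^ (1 / 2 : ℝ)) := fun J => by
    have hinj : Function.Injective fun i : ℕ => -(J : ℤ) + 1 + i := fun i k hik => by
      simpa using hik
    set w : ℤ → ℝ≥0∞ := fun j => min 1 (ENNReal.ofReal ((2 : ℝ) ^ j) * ENNReal.ofReal ‖h‖) *
      ENNReal.ofReal ((2 : ℝ) ^ (-((j : ℝ) / 2))) with hw
    calc _ ≤ ∑ i ∈ Finset.range (2 * J), eLpNorm (d (-J + 1 + i)) (2 * n) volume :=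
          eLpNorm_sum_le (fun i _ => hdm _) hp
      _ ≤ ∑ i ∈ Finset.range (2 * J), L * M * w (-J + 1 + i) := by
          refine Finset.sum_le_sum fun i _ => ?_
          refine (HL m a ha _ h).trans ?_
          refine (mul_le_mul_right (hN _) _).trans_eq ?_
          rw [hw, ofReal_norm]
          ring
      _ = L * M * ∑ i ∈ Finset.range (2 * J), w (-J + 1 + i) := by rw [Finset.mul_sum]
      _ ≤ L * M * ∑' j, w j := by
          gcongr
          exact (ENNReal.sum_le_tsum _).trans
            (ENNReal.tsum_comp_le_tsum_of_injective hinj w)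
      _ ≤ L * M * (C * ENNReal.ofReal (‖h‖ ^ (1 / 2 : ℝ))) := by gcongr; exact HC _ hh0
      _ = _ := by ring
  have hT := ae_tendsto_kernelConv_lowPass hχ ha
  have hlim : ∀ᵐ x, Tendsto (fun J => g J x) atTop (𝓝 (a (x + h) - a x)) := by
    filter_upwards [hT, (quasiMeasurePreserving_add_right volume h).ae hT] with x hx hxh
    have h1 := (hxh.sub hx).sub (tendsto_kernelConv_lowPass_neg_difference χ ha h x)
    rw [sub_zero] at h1
    refine h1.congr fun J => ?_
    rw [hg]
    simp only [Finset.sum_apply, hd, Finset.sum_sub_distrib, sum_dyadicBlock χ ha]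
    abel
  refine (Lp.eLpNorm_lim_le_liminf_eLpNorm hgm _ hlim).trans ?_
  exact (liminf_le_liminf (Eventually.of_forall hgle)).trans_eq (liminf_const _)

/-- Hölder's inequality on a ball, from `L²` to `L^{2n}`. -/
theorem lintegral_ball_enorm_sq_le (hn : 1 ≤ n) {f : Euc n → Euc m}
    (hf : AEStronglyMeasurable f volume) (x : Euc n) {r : ℝ} (hr : 0 < r) :
    ∫⁻ z in ball x r, ‖f z‖ₑ ^ 2 ≤ eLpNorm f (2 * n) volume ^ 2 *
      (ENNReal.ofReal r ^ (n - 1) * volume (ball (0 : Euc n) 1) ^ (1 - 1 / (n : ℝ))) := by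
  have hn0 : (0 : ℝ) < n := by exact_mod_cast hn
  have h1 := eLpNorm_le_eLpNorm_mul_rpow_measure_univ (μ := volume.restrict (ball x r))
    (p := 2) (q := 2 * n) (by
      have : 2 ≤ 2 * n := by omega
      exact_mod_cast this) hf.restrict
  have h2 : eLpNorm f 2 (volume.restrict (ball x r)) ^ 2 = ∫⁻ z in ball x r, ‖f z‖ₑ ^ 2 := by
    have := eLpNorm_nnreal_pow_eq_lintegral (f := f) (μ := volume.restrict (ball x r)) (p := 2)
      two_ne_zero
    simpa using this
  rw [← h2]
  refine (pow_le_pow_left' h1 2).trans ?_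
  rw [mul_pow, Measure.restrict_apply_univ]
  refine mul_le_mul' (pow_le_pow_left' (eLpNorm_restrict_le _ _ _ _) 2) (le_of_eq ?_)
  have e1 : (2 * (n : ℝ≥0∞)).toReal = 2 * n := by simp
  have e3 : ENNReal.ofReal r ^ (n - 1) = ENNReal.ofReal r ^ ((n : ℝ) * (1 - 1 / (n : ℝ))) := by
    rw [← ENNReal.rpow_natCast, Nat.cast_sub hn]
    congr 1
    field_simp
    simp
  have e4 : 0 ≤ 1 - 1 / (n : ℝ) := by
    rw [sub_nonneg, div_le_one hn0]; exact_mod_cast hn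
  rw [volume_ball_eq x hr, e1, e3, ENNReal.rpow_mul (ENNReal.ofReal r),
    ENNReal.rpow_natCast (ENNReal.ofReal r), ← ENNReal.mul_rpow_of_nonneg _ _ e4,
    ← ENNReal.rpow_natCast _ 2, ← ENNReal.rpow_mul]
  congr 1
  have e2 : (2 : ℝ≥0∞).toReal = 2 := rfl
  rw [e2]
  push_cast
  field_simp

/-- A function whose translation differences satisfy `‖a(· + h) - a‖_{2n} ≤ K |h|^{1/2}` lies in
`Q_0`: the substitution `y = z + h` and Hölder's inequality reduce the double integral over a ball to
`∫_{|h| < 2r} |h|^{1-n}`. -/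
theorem exists_qBound_of_eLpNorm_difference_le (hn : 1 ≤ n) {a : Euc n → Euc m}
    (ha : Measurable a) {K : ℝ≥0∞} (hK : K ≠ ∞) (hle : ∀ h : Euc n,
      eLpNorm (fun x => a (x + h) - a x) (2 * n) volume ≤
        K * ENNReal.ofReal (‖h‖ ^ (1 / 2 : ℝ))) : ∃ Q : ℝ≥0∞, Q ≠ ∞ ∧ QBound a Q := by
  obtain ⟨C, hC, HC⟩ := exists_lintegral_ball_enorm_le hn
  set ω := volume (ball (0 : Euc n) 1) ^ (1 - 1 / (n : ℝ))
  have hn0 : (0 : ℝ) < n := by exact_mod_cast hn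
  have hω' : ω ≠ ∞ := by
    refine ENNReal.rpow_ne_top_of_nonneg ?_ measure_ball_lt_top.ne
    rw [sub_nonneg, div_le_one hn0]; exact_mod_cast hn
  have hsq : ∀ h : Euc n, ENNReal.ofReal (‖h‖ ^ (1 / 2 : ℝ)) ^ 2 = ‖h‖ₑ := fun h => by
    rw [← ENNReal.ofReal_rpow_of_nonneg (norm_nonneg _) (by norm_num), rpow_half_sq, ofReal_norm]
  refine ⟨2 * (K ^ 2 * ω * C), by finiteness, fun x r hr => ?_⟩
  have hm : Measurable fun p : Euc n × Euc n => sqOsc a (p.1 + p.2) p.1 * (‖p.2‖ₑ ^ n)⁻¹ :=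
    (measurable_sqOsc ha (measurable_fst.add measurable_snd) measurable_fst).mul
      (measurable_snd.enorm.pow_const _).inv
  calc ∫⁻ z in ball x r, ∫⁻ y in ball x r, sqOsc a y z / ‖y - z‖ₑ ^ n
      ≤ ∫⁻ z in ball x r, ∫⁻ h in ball (0 : Euc n) (2 * r), sqOsc a (z + h) z * (‖h‖ₑ ^ n)⁻¹ := by
        refine setLIntegral_mono' measurableSet_ball fun z hz => ?_
        rw [← lintegral_indicator measurableSet_ball, ← lintegral_indicator measurableSet_ball,
          ← lintegral_add_left_eq_self _ z]
        refine lintegral_mono fun h => ?_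
        by_cases hzh : z + h ∈ ball x r
        · have hh : h ∈ ball (0 : Euc n) (2 * r) := by
            rw [mem_ball, dist_zero_right]
            rw [mem_ball, dist_eq_norm] at hz hzh
            calc ‖h‖ = ‖(z + h - x) - (z - x)‖ := by congr 1; abel
              _ ≤ _ := norm_sub_le _ _
              _ < 2 * r := by linarith
          rw [indicator_of_mem hzh, indicator_of_mem hh, add_sub_cancel_left, div_eq_mul_inv]
        · rw [indicator_of_notMem hzh]; exact zero_le
    _ = ∫⁻ h in ball (0 : Euc n) (2 * r), ∫⁻ z in ball x r, sqOsc a (z + h) z * (‖h‖ₑ ^ n)⁻¹ :=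
        lintegral_lintegral_swap hm.aemeasurable
    _ ≤ ∫⁻ h in ball (0 : Euc n) (2 * r),
        (K ^ 2 * (ENNReal.ofReal r ^ (n - 1) * ω)) * (‖h‖ₑ * (‖h‖ₑ ^ n)⁻¹) := by
        refine lintegral_mono fun h => ?_
        have h1 : Measurable fun z => sqOsc a (z + h) z :=
          measurable_sqOsc ha (measurable_id.add_const h) measurable_id
        rw [lintegral_mul_const _ h1]
        have h2 : AEStronglyMeasurable (fun z => a (z + h) - a z) volume :=
          ((ha.comp (measurable_id.add_const h)).sub ha).aestronglyMeasurable
        have h3 := lintegral_ball_enorm_sq_le hn h2 x hr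
        have h4 := pow_le_pow_left' (hle h) 2
        rw [mul_pow, hsq] at h4
        calc _ ≤ (K ^ 2 * ‖h‖ₑ * (ENNReal.ofReal r ^ (n - 1) * ω)) * (‖h‖ₑ ^ n)⁻¹ :=
              mul_le_mul_left (h3.trans (mul_le_mul_left h4 _)) _
          _ = _ := by ring
    _ ≤ (K ^ 2 * (ENNReal.ofReal r ^ (n - 1) * ω)) * (C * ENNReal.ofReal (2 * r)) := by
        rw [lintegral_const_mul' _ _ (by finiteness)]
        gcongr
        exact HC _ (by positivity)
    _ = ENNReal.ofReal r ^ n * (2 * (K ^ 2 * ω * C)) := by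
        have e2 : ENNReal.ofReal 2 = 2 := by simp
        obtain ⟨k, rfl⟩ : ∃ k, n = k + 1 := ⟨n - 1, by omega⟩
        rw [ENNReal.ofReal_mul zero_le_two, e2, Nat.add_sub_cancel, pow_succ]
        ring

/-- `L^∞ ∩ Ḃ^{1/2}_{2n,∞} ⊆ Q_0`. -/
theorem spaceLinfBesov_subset_spaceQ (hn : 1 ≤ n) :
    spaceLinfBesov n m (1 / 2) (2 * n) ⊆ spaceQ n m 0 := by
  intro a ha
  obtain ⟨K, hK, hle⟩ := exists_eLpNorm_difference_le hn ha
  -- the Fubini argument needs a measurable representative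
  have ham : AEStronglyMeasurable a volume := ha.1.1
  set b := ham.mk a
  have hab : a =ᵐ[volume] b := ham.ae_eq_mk
  obtain ⟨Q, hQ, hb⟩ := exists_qBound_of_eLpNorm_difference_le hn
    ham.stronglyMeasurable_mk.measurable hK fun h => by
      refine (eLpNorm_congr_ae ?_).trans_le (hle h)
      filter_upwards [hab, (quasiMeasurePreserving_add_right volume h).ae hab] with x h1 h2
      rw [h1, h2]
  refine ⟨ham, (QBound.seminormQ_le (hb.congr_ae hab.symm)).trans_lt ?_⟩
  exact ENNReal.rpow_lt_top_of_nonneg (by norm_num) hQ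

/-! ### From the Sobolev space to the Besov space -/

theorem continuous_neg_innerₗ :
    Continuous fun p : Euc n × Euc n => (-innerₗ (Euc n)) p.1 p.2 := by
  have : Continuous fun p : Euc n × Euc n => -inner ℝ p.1 p.2 := by fun_prop
  exact this

theorem continuous_fourierInv {G : Euc n → ℂ} (hG : Integrable G) : Continuous (𝓕⁻ G) :=
  VectorFourier.fourierIntegral_continuous Real.continuous_fourierChar continuous_neg_innerₗ hG

/-- On `L¹ ∩ L²` the `L²` Fourier transform is given by the integral. -/
theorem fourierInv_ae_eq_toLp {G : Euc n → ℂ} (h1 : Integrable G) (h2 : MemLp G 2 volume) :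
    𝓕⁻ G =ᵐ[volume] (𝓕⁻ (h2.toLp G) : Lp ℂ 2 (volume : Measure (Euc n))) := by
  refine ae_eq_of_integral_contDiff_smul_eq (continuous_fourierInv h1).locallyIntegrable
    ((Lp.memLp _).locallyIntegrable one_le_two) fun g hg hgc => ?_
  have hg1 : HasCompactSupport (Complex.ofRealCLM ∘ g) := hgc.comp_left rfl
  have hg2 : ContDiff ℝ ((⊤ : ℕ∞) : WithTop ℕ∞) (Complex.ofRealCLM ∘ g) := by fun_prop
  set φ : 𝓢(Euc n, ℂ) := hg1.toSchwartzMap hg2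
  have hφ : ∀ x, φ x = (g x : ℂ) := fun x => rfl
  -- both sides are the inverse Fourier transform of `G` in the sense of tempered distributions
  have e1 := DFunLike.congr_fun (Lp.fourierInv_toTemperedDistribution_eq (h2.toLp G)) φ
  rw [TemperedDistribution.fourierInv_apply, Lp.toTemperedDistribution_apply,
    Lp.toTemperedDistribution_apply] at e1
  have e2 : ∫ x, (𝓕⁻ φ) x • (h2.toLp G) x = ∫ x, (𝓕⁻ φ) x • G x := by
    refine integral_congr_ae ?_
    filter_upwards [h2.coeFn_toLp] with x hx
    rw [hx]
  have e3 : ∫ x, (𝓕⁻ φ) x • G x = ∫ x, φ x • 𝓕⁻ G x := by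
    have h := VectorFourier.integral_fourierIntegral_smul_eq_flip (μ := volume) (ν := volume)
      (L := -innerₗ (Euc n)) Real.continuous_fourierChar continuous_neg_innerₗ
      (φ.integrable (μ := volume)) h1
    have hflip : (-innerₗ (Euc n)).flip = -innerₗ (Euc n) := by
      ext x y; simp [real_inner_comm]
    rw [hflip] at h
    rw [SchwartzMap.fourierInv_coe]
    exact h
  rw [e2, e3] at e1
  simp only [hφ, Complex.coe_smul] at e1
  exact e1

/-- Plancherel's theorem on `L¹ ∩ L²`. -/
theorem lintegral_enorm_fourierInv_sq {G : Euc n → ℂ} (h1 : Integrable G)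
    (h2 : MemLp G 2 volume) : ∫⁻ x, ‖𝓕⁻ G x‖ₑ ^ 2 = ∫⁻ x, ‖G x‖ₑ ^ 2 := by
  have key : ∀ f : Euc n → ℂ, eLpNorm f 2 volume ^ 2 = ∫⁻ x, ‖f x‖ₑ ^ 2 := fun f => by
    have := eLpNorm_nnreal_pow_eq_lintegral (f := f) (μ := (volume : Measure (Euc n))) (p := 2)
      two_ne_zero
    simpa using this
  rw [← key, ← key, eLpNorm_congr_ae (fourierInv_ae_eq_toLp h1 h2),
    ← eLpNorm_congr_ae h2.coeFn_toLp, ← Lp.enorm_def, ← Lp.enorm_def]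
  congr 1
  exact ((Lp.fourierTransformₗᵢ (Euc n) ℂ).symm.enorm_map _)

/-- The function `y ↦ k(x - y)`, as a complex Schwartz function. -/
def reflectTranslate (k : 𝓢(Euc n, ℝ)) (x : Euc n) : 𝓢(Euc n, ℂ) :=
  SchwartzMap.compSubConstCLM ℂ x
    (SchwartzMap.compCLMOfContinuousLinearEquiv ℂ (ContinuousLinearEquiv.neg ℝ) (complexify k))

theorem reflectTranslate_apply (k : 𝓢(Euc n, ℝ)) (x y : Euc n) :
    reflectTranslate k x y = (k (x - y) : ℂ) := by
  change (k (-(y - x)) : ℂ) = _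
  rw [neg_sub]

/-- The inverse Fourier transform of `y ↦ k(x - y)` is the Fourier transform of `k`, modulated. -/
theorem fourierInv_reflectTranslate (k : 𝓢(Euc n, ℝ)) (x ξ : Euc n) :
    𝓕⁻ (reflectTranslate k x) ξ = Real.fourierChar (inner ℝ ξ x) • 𝓕 (complexify k) ξ := by
  have e : ∀ (c : Circle) (F : Euc n → ℂ), c • ∫ v, F v = ∫ v, c • F v := fun c F => by
    simp only [Circle.smul_def]
    exact (integral_smul _ _).symm
  rw [SchwartzMap.fourierInv_coe, SchwartzMap.fourier_coe, Real.fourierInv_eq, Real.fourier_eq,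
    e, ← integral_sub_left_eq_self _ volume x]
  congr with y
  rw [reflectTranslate_apply, sub_sub_cancel, smul_smul, ← AddChar.map_add_eq_mul,
    complexify_apply, inner_sub_left, real_inner_comm x ξ, sub_eq_add_neg]

theorem exists_norm_fourier_bandPass_le (χ : 𝓢(Euc n, ℝ)) : ∃ D : ℝ, 0 ≤ D ∧
    ∀ (j : ℤ) (ξ : Euc n), ‖𝓕 (complexify (bandPass χ j)) ξ‖ ≤ D := by
  obtain ⟨D, hD, hD'⟩ := (𝓕 (complexify χ)).decay 0 0
  have h : ∀ ξ, ‖𝓕 (fun x : Euc n => (χ x : ℂ)) ξ‖ ≤ D := fun ξ => by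
    have := hD' ξ
    rw [pow_zero, one_mul, norm_iteratedFDeriv_zero, SchwartzMap.fourier_coe] at this
    exact this
  refine ⟨D + D, by positivity, fun j ξ => ?_⟩
  rw [fourier_complexify_bandPass]
  exact (norm_sub_le _ _).trans (add_le_add (h _) (h _))

/-- The localized symbol `ψ̂_j(ξ) |ξ|^(-s) g(ξ)` of a dyadic block of a Sobolev function. -/
def blockSymbol (χ : 𝓢(Euc n, ℝ)) (j : ℤ) (s : ℝ) (g : Euc n → ℂ) (ξ : Euc n) : ℂ :=
  𝓕 (complexify (bandPass χ j)) ξ * (((‖ξ‖ ^ (-s) : ℝ) : ℂ) * g ξ)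

/-- The symbol `ψ̂_j` vanishes for `|ξ| ≤ 2^(j-1)`, so the weight `|ξ|^(-s)` is at most `2^(-(j-1)s)`. -/
theorem norm_blockSymbol_le {χ : 𝓢(Euc n, ℝ)} (hχ : IsLowPass χ) (j : ℤ) {s : ℝ} (hs : 0 ≤ s)
    {D : ℝ} (hD : ∀ ξ : Euc n, ‖𝓕 (complexify (bandPass χ j)) ξ‖ ≤ D)
    (g : Euc n → ℂ) (ξ : Euc n) :
    ‖blockSymbol χ j s g ξ‖ ≤ D * ((2 : ℝ) ^ (j - 1)) ^ (-s) * ‖g ξ‖ := by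
  have hD0 : 0 ≤ D := (norm_nonneg _).trans (hD ξ)
  unfold blockSymbol
  rcases le_total ‖ξ‖ ((2 : ℝ) ^ (j - 1)) with h | h
  · rw [fourier_complexify_bandPass_of_le' hχ j h, zero_mul, norm_zero]; positivity
  · rw [norm_mul, norm_mul, Complex.norm_real, Real.norm_of_nonneg (by positivity), mul_assoc]
    refine mul_le_mul (hD ξ) (mul_le_mul_of_nonneg_right ?_ (norm_nonneg _)) (by positivity) hD0
    exact Real.rpow_le_rpow_of_nonpos (by positivity) h (neg_nonpos.2 hs)

theorem memLp_blockSymbol {χ : 𝓢(Euc n, ℝ)} (hχ : IsLowPass χ) (j : ℤ) {s : ℝ} (hs : 0 ≤ s)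
    {g : Euc n → ℂ} (hg : MemLp g 2 volume) : MemLp (blockSymbol χ j s g) 2 volume := by
  obtain ⟨D, hD0, hD⟩ := exists_norm_fourier_bandPass_le χ
  refine hg.of_le_mul (c := D * ((2 : ℝ) ^ (j - 1)) ^ (-s)) ?_
    (Filter.Eventually.of_forall fun ξ => norm_blockSymbol_le hχ j hs (hD j) g ξ)
  have h1 : Measurable fun ξ : Euc n => ((‖ξ‖ ^ (-s) : ℝ) : ℂ) := by fun_prop
  exact (𝓕 (complexify (bandPass χ j))).continuous.aestronglyMeasurable.mul
    (h1.aestronglyMeasurable.mul hg.1)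

theorem integrable_blockSymbol {χ : 𝓢(Euc n, ℝ)} (hχ : IsLowPass χ) (j : ℤ) {s : ℝ} (hs : 0 ≤ s)
    {g : Euc n → ℂ} (hg : MemLp g 2 volume) : Integrable (blockSymbol χ j s g) := by
  rw [← integrableOn_iff_integrable_of_support_subset (s := ball 0 ((2 : ℝ) ^ (j + 1)))]
  · have : IsFiniteMeasure (volume.restrict (ball (0 : Euc n) ((2 : ℝ) ^ (j + 1)))) :=
      ⟨by rw [Measure.restrict_apply_univ]; exact measure_ball_lt_top⟩
    exact ((memLp_blockSymbol hχ j hs hg).restrict _).integrable one_le_two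
  · intro ξ hξ
    by_contra h
    rw [mem_ball, dist_zero_right, not_lt] at h
    exact hξ (by rw [blockSymbol, fourier_complexify_bandPass_of_le hχ j h, zero_mul])

/-- The dyadic blocks of a Sobolev function are inverse Fourier integrals: test the distributional
identity with `φ = 𝓕⁻¹(ψ_j(x - ·))`. -/
theorem dyadicBlock_eq_fourierInv {χ : 𝓢(Euc n, ℝ)} (hχ : IsLowPass χ) (j : ℤ) {s : ℝ}
    {a : Euc n → Euc m} (ha : a ∈ spaceLinf n m) {g : Euc n → ℂ} {i : Fin m}
    (h : ∀ φ : 𝓢(Euc n, ℂ), (0 : Euc n) ∉ tsupport φ →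
      ∫ x, 𝓕 (φ : Euc n → ℂ) x * (a x i : ℂ) = ∫ ξ, φ ξ * (((‖ξ‖ ^ (-s) : ℝ) : ℂ) * g ξ))
    (x : Euc n) : (dyadicBlock χ j a x i : ℂ) = 𝓕⁻ (blockSymbol χ j s g) x := by
  set φ : 𝓢(Euc n, ℂ) := 𝓕⁻ (reflectTranslate (bandPass χ j) x) with hφ
  have hφ0 : (0 : Euc n) ∉ tsupport φ := by
    rw [notMem_tsupport_iff_eventuallyEq]
    filter_upwards [ball_mem_nhds (0 : Euc n) (by positivity : (0 : ℝ) < 2 ^ (j - 1))] with ξ hξ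
    rw [mem_ball, dist_zero_right] at hξ
    rw [hφ, fourierInv_reflectTranslate, fourier_complexify_bandPass_of_le' hχ j hξ.le, smul_zero]
    rfl
  have h1 := h φ hφ0
  have h2 : 𝓕 (φ : Euc n → ℂ) = reflectTranslate (bandPass χ j) x := by
    rw [← SchwartzMap.fourier_coe, hφ, FourierTransform.fourier_fourierInv_eq]
  have h3 : ∫ y, 𝓕 (φ : Euc n → ℂ) y * (a y i : ℂ) = (dyadicBlock χ j a x i : ℂ) := by
    rw [h2]
    have e : dyadicBlock χ j a x i = ∫ y, bandPass χ j (x - y) * a y i := by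
      have := (EuclideanSpace.proj (𝕜 := ℝ) i).integral_comp_comm
        (integrable_sub_left_smul (bandPass χ j).integrable ha x)
      exact this.symm
    rw [e, ← integral_complex_ofReal]
    simp only [reflectTranslate_apply, Complex.ofReal_mul]
  rw [← h3, h1, Real.fourierInv_eq]
  congr with ξ
  rw [hφ, fourierInv_reflectTranslate, blockSymbol, smul_mul_assoc]

/-- `L^∞ ∩ Ḣ^{n/2} ⊆ L^∞ ∩ Ḃ^{n/2}_{2,∞}`. -/
theorem spaceLinfSobolev_subset :
    spaceLinfSobolev n m ((n : ℝ) / 2) ⊆ spaceLinfBesov n m ((n : ℝ) / 2) 2 := by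
  rintro a ⟨ha, g, hg⟩
  have e2 : (2 : ℝ≥0∞) = 2 * (1 : ℕ) := by simp
  rw [e2, mem_spaceLinfBesov_iff (k := n) le_rfl (by push_cast; ring)]
  obtain ⟨χ, hχ⟩ := exists_isLowPass n
  obtain ⟨D, hD0, hD⟩ := exists_norm_fourier_bandPass_le χ
  have hs : 0 ≤ (n : ℝ) / 2 := by positivity
  have hfin : ∀ i, ∫⁻ ξ, ‖g i ξ‖ₑ ^ 2 ≠ ∞ := fun i => by
    have h1 := (hg i).1.2
    rw [eLpNorm_lt_top_iff_lintegral_rpow_enorm_lt_top two_ne_zero ENNReal.ofNat_ne_top] at h1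
    simpa using h1.ne
  refine ⟨ha, χ, hχ, ENNReal.ofReal (2 ^ n * D ^ 2) * ∑ i, ∫⁻ ξ, ‖g i ξ‖ₑ ^ 2,
    ENNReal.mul_ne_top (by finiteness) (ENNReal.sum_ne_top.2 fun i _ => hfin i), fun j => ?_⟩
  simp only [mul_one]
  have h1 : ∀ x, ‖dyadicBlock χ j a x‖ₑ ^ 2 =
      ∑ i, ‖𝓕⁻ (blockSymbol χ j ((n : ℝ) / 2) (g i)) x‖ₑ ^ 2 := fun x => by
    simp_rw [← dyadicBlock_eq_fourierInv hχ j ha (hg _).2 x]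
    rw [← ofReal_norm, ← ENNReal.ofReal_pow (norm_nonneg _), EuclideanSpace.norm_sq_eq,
      ENNReal.ofReal_sum_of_nonneg fun i _ => by positivity]
    refine Finset.sum_congr rfl fun i _ => ?_
    rw [← ofReal_norm, ← ENNReal.ofReal_pow (norm_nonneg _), Complex.norm_real]
  have hI := fun i => integrable_blockSymbol hχ j hs (hg i).1
  have h2 : ∀ i, ∫⁻ x, ‖𝓕⁻ (blockSymbol χ j ((n : ℝ) / 2) (g i)) x‖ₑ ^ 2 ≤
      ENNReal.ofReal (D * ((2 : ℝ) ^ (j - 1)) ^ (-((n : ℝ) / 2))) ^ 2 * ∫⁻ ξ, ‖g i ξ‖ₑ ^ 2 := fun i => by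
    rw [lintegral_enorm_fourierInv_sq (hI i) (memLp_blockSymbol hχ j hs (hg i).1),
      ← lintegral_const_mul' _ _ (by finiteness)]
    refine lintegral_mono fun ξ => ?_
    rw [← mul_pow]
    refine pow_le_pow_left' ?_ 2
    rw [← ofReal_norm, ← ofReal_norm, ← ENNReal.ofReal_mul (by positivity)]
    exact ENNReal.ofReal_le_ofReal (norm_blockSymbol_le hχ j hs (hD j) _ ξ)
  have h3 : ENNReal.ofReal ((2 : ℝ) ^ j) ^ n *
      ENNReal.ofReal (D * ((2 : ℝ) ^ (j - 1)) ^ (-((n : ℝ) / 2))) ^ 2 =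
      ENNReal.ofReal (2 ^ n * D ^ 2) := by
    rw [← ENNReal.ofReal_pow (by positivity), ← ENNReal.ofReal_pow (by positivity),
      ← ENNReal.ofReal_mul (by positivity)]
    congr 1
    have e1 : (2 : ℝ) ^ j = 2 ^ (j - 1) * 2 := by rw [← zpow_add_one₀ two_ne_zero]; simp
    have e3 : (((2 : ℝ) ^ (j - 1)) ^ (-((n : ℝ) / 2))) ^ 2 = (((2 : ℝ) ^ (j - 1)) ^ n)⁻¹ := by
      rw [← Real.rpow_natCast, ← Real.rpow_mul (by positivity), ← Real.rpow_natCast _ n,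
        ← Real.rpow_neg (by positivity)]
      congr 1; push_cast; ring
    have e4 : ((2 : ℝ) ^ (j - 1)) ^ n ≠ 0 := by positivity
    rw [mul_pow, e3, e1, mul_pow]
    field_simp
  simp only [h1]
  rw [lintegral_finsetSum' _ fun i _ => ((continuous_fourierInv (hI i)).measurable.enorm.pow_const
    2).aemeasurable]
  calc _ ≤ ENNReal.ofReal ((2 : ℝ) ^ j) ^ n * ∑ i,
        ENNReal.ofReal (D * ((2 : ℝ) ^ (j - 1)) ^ (-((n : ℝ) / 2))) ^ 2 * ∫⁻ ξ, ‖g i ξ‖ₑ ^ 2 := by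
        gcongr with i
        exact h2 i
    _ = _ := by rw [← Finset.mul_sum, ← mul_assoc, h3]

end HalfHarmonic

end

theorem theorem2p4 (n : ℕ) (hn : 1 ≤ n) :
    (∃ c : ℝ, 0 < c ∧ ∀ (m : ℕ), ∀ a ∈ HalfHarmonic.spaceQ n m 0,
      (∀ (t : ℝ) (x : HalfHarmonic.Euc n), 0 < t →
        Integrable (fun y => HalfHarmonic.poissonKernel n t (x - y) • a y) volume) ∧
      HalfHarmonic.seminormA ∞ a ≤ ENNReal.ofReal c * HalfHarmonic.seminormQ 0 a) ∧
    ∀ (m : ℕ),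
      HalfHarmonic.spaceLinf n m ∩ HalfHarmonic.spaceQ n m 0 ⊆ HalfHarmonic.spaceA n m ∧
      HalfHarmonic.spaceLinfSobolev n m ((n : ℝ) / 2) ⊆
        HalfHarmonic.spaceLinfBesov n m ((n : ℝ) / 2) 2 ∧
      HalfHarmonic.spaceLinfBesov n m ((n : ℝ) / 2) 2 ⊆
        HalfHarmonic.spaceLinfBesov n m (1 / 2) (2 * n) ∧
      HalfHarmonic.spaceLinfBesov n m (1 / 2) (2 * n) ⊆ HalfHarmonic.spaceQ n m 0 := by
  obtain ⟨c, hc, h⟩ := HalfHarmonic.exists_seminormA_le hn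
  refine ⟨⟨c, hc, fun m a ha => ⟨fun t x ht => ?_, h m a ha⟩⟩, fun m => ⟨?_, ?_, ?_, ?_⟩⟩
  · exact HalfHarmonic.integrable_poissonKernel_smul ha ht x
  · exact fun a ha => ⟨ha.1, (h m a ha.2).trans_lt (ENNReal.mul_lt_top ENNReal.ofReal_lt_top ha.2.2)⟩
  · exact HalfHarmonic.spaceLinfSobolev_subset
  · exact HalfHarmonic.spaceLinfBesov_subset hn
  · exact HalfHarmonic.spaceLinfBesov_subset_spaceQ hn
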